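/- **Setting.** Let $\Omega\subset\mathbb R^2$ be a bounded connected open set with Lipschitz boundary. Let $h\in L^\infty(\Omega)$, and let $c,\sigma$ be positive measurable functions on $\Omega$ that are bounded with bounded inverse. Let $\partial\Omega$ be partitioned into measurable sets $\Gamma_N,\Gamma_D,\Gamma_R,\Gamma_\sharp$ (any of which may be empty). On $\Gamma_R$ a bounded measurable function $a>0$ is given. $\Gamma_\sharp$ is the union of finitely many measurable sets $G_j$ and their translates $G_j+v_j$, and a function on $\partial\Omega$ is called periodic on $\Gamma_\sharp$ if its values at $x$ and $x+v_j$ agree for almost every $x\in G_j$ and every $j$. Let $$V=\{s\in H^1(\Omega):\ s=0\text{ on }\Gamma_D,\ s\text{ periodic on }\Gamma_\sharp\}$$ in the sense of traces. The constants are called controlled if $\Gamma_D\cup\Gamma_R$ has positive length. Put $H=V$ if the constants are controlled and $H=V/\mathbb R$ otherwise, and $\mathcal H=L^2(\Omega)\times H$ with $$\big((u,s)\,|\,(u',s')\big)_{\mathcal H}=\int_\Omega c\,uu'+\int_\Omega\sigma\nabla s\cdot\nabla s'+\int_{\Gamma_R}a\,ss'.$$ The Graetz operator is $\mathcal A(u,s)=\big(c^{-1}(hu-\operatorname{div}(\sigma\nabla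 s)),\,u\big)$; its domain consists of the $(u,s)\in\mathcal H$ such that $u\in V$, $\operatorname{div}(\sigma\nabla s)\in L^2(\Omega)$ and, in the weak sense, $\sigma\nabla s\cdot n=0$ on $\Gamma_N$, $\sigma\nabla s\cdot n+as=0$ on $\Gamma_R$, and the flux $\sigma\nabla s$ through $\Gamma_\sharp$ is periodic; that is, there is $f\in L^2(\Omega)$ (namely $f=-\operatorname{div}(\sigma\nabla s)$) with $\int_\Omega\sigma\nabla s\cdot\nabla v+\int_{\Gamma_R}a\,sv=\int_\Omega fv$ for all $v\in V$. Let $P(u,s)=(u,0)$. Let $\pi_-$ and $\pi_+$ be the orthogonal projections of $\mathcal H$ onto the closed spans of the eigenvectors of $\mathcal A$ with negative and with positive eigenvalues, respectively, and let $\mathcal R(\pi_\pm)$ be their ranges. For $\varphi\in\mathcal H$ put $$\|\varphi\|_{1/2}=\Big(\sum_\lambda|\lambda|\,\|E_\lambda\varphi\|_{\mathcal H}^2\Big)^{1/2}\in[0,\infty],$$ where the sum is over the eigenvalues $\lambda$ of $\mathcal A$ and $E_\lambda$ is the orthogonal projection onto the eigenspace of $\lambda$. **Theorem.** The form $(\cdot|\cdot)_{\mathcal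 H}$ is an inner product (i.e. it is definite) that makes $\mathcal H$ a Hilbert space, and the following holds. The operator $\pi_-P\pi_-$ is invertible on $\mathcal R(\pi_-)$ (a bijection of $\mathcal R(\pi_-)$ with bounded inverse). The operator $B_-=\pi_-(\pi_-P\pi_-)^{-1}\pi_-$ on $\mathcal H$ is bounded and self-adjoint, and there is a constant $C$ such that for all $\varphi\in\mathcal H$ $$\|B_-\varphi\|_{\mathcal H}\le C\|\pi_-\varphi\|_{\mathcal H}\qquad\text{and}\qquad\|B_-\varphi\|_{1/2}\le C\|\pi_-\varphi\|_{1/2}.$$ The same holds with $\pi_+$ and $B_+=\pi_+(\pi_+P\pi_+)^{-1}\pi_+$ in place of $\pi_-$ and $B_-$. -/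

import Mathlib

open MeasureTheory Set Filter Topology
open scoped ENNReal ContDiff

noncomputable section

namespace Graetz

/-- The Euclidean plane, which contains the cross section of the pipe. -/
abbrev Plane : Type := EuclideanSpace ℝ (Fin 2)

/-- Length (one-dimensional Hausdorff measure) in the plane. -/
abbrev len : Measure Plane := Measure.hausdorffMeasure 1

/-- Lipschitz boundary: near each boundary point, in suitable orthonormal coordinates centred there,
the set is the part of the plane strictly above the graph of a Lipschitz function. -/
def HasLipschitzBoundary (Ω : Set Plane) : Prop :=
  ∀ p ∈ frontier Ω, ∃ (e : Plane ≃ₗᵢ[ℝ] Plane) (γ : ℝ → ℝ) (K : NNReal) (r : ℝ),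
    LipschitzWith K γ ∧ 0 < r ∧
      ∀ x ∈ Metric.ball p r, x ∈ Ω ↔ γ (e (x - p) 0) < e (x - p) 1

/-- The data of a generalized Graetz problem: the cross section `Ω`, the velocity `h`, the diffusion
coefficients `c` and `σ`, and the lateral boundary conditions. The boundary is partitioned into a
Neumann part `ΓN`, a Dirichlet part `ΓD`, a Robin part `ΓR` with coefficient `a`, and a periodic part
`Γper`. The periodic part consists of finitely many pieces `piece j` and their translates by
`shift j`; the condition identifies the values at `x` and `x + shift j` for `x ∈ piece j`. Any of the
four parts may be empty. -/
structure Data where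
  Ω : Set Plane
  isOpen_Ω : IsOpen Ω
  isConnected_Ω : IsConnected Ω
  isBounded_Ω : Bornology.IsBounded Ω
  lipschitz_Ω : HasLipschitzBoundary Ω
  h : Plane → ℝ
  c : Plane → ℝ
  σ : Plane → ℝ
  measurable_h : Measurable h
  measurable_c : Measurable c
  measurable_σ : Measurable σ
  h_bound : ∃ M : ℝ, ∀ᵐ x ∂(volume.restrict Ω), |h x| ≤ M
  c_bound : ∃ m M : ℝ, 0 < m ∧ ∀ᵐ x ∂(volume.restrict Ω), m ≤ c x ∧ c x ≤ M
  σ_bound : ∃ m M : ℝ, 0 < m ∧ ∀ᵐ x ∂(volume.restrict Ω), m ≤ σ x ∧ σ x ≤ M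
  ΓN : Set Plane
  ΓD : Set Plane
  ΓR : Set Plane
  Γper : Set Plane
  measurableSet_ΓN : MeasurableSet ΓN
  measurableSet_ΓD : MeasurableSet ΓD
  measurableSet_ΓR : MeasurableSet ΓR
  measurableSet_Γper : MeasurableSet Γper
  cover : ΓN ∪ ΓD ∪ ΓR ∪ Γper = frontier Ω
  disjoint_ND : Disjoint ΓN ΓD
  disjoint_NR : Disjoint ΓN ΓR
  disjoint_Nper : Disjoint ΓN Γper
  disjoint_DR : Disjoint ΓD ΓR
  disjoint_Dper : Disjoint ΓD Γper
  disjoint_Rper : Disjoint ΓR Γper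
  a : Plane → ℝ
  measurable_a : Measurable a
  a_bound : ∃ M : ℝ, ∀ x ∈ ΓR, 0 < a x ∧ a x ≤ M
  numPieces : ℕ
  piece : Fin numPieces → Set Plane
  shift : Fin numPieces → Plane
  measurableSet_piece : ∀ j, MeasurableSet (piece j)
  periodic_cover : Γper = ⋃ j, (piece j ∪ (fun x => x + shift j) '' piece j)

namespace Data

variable (D : Data)

/-- Lebesgue measure on `Ω`. -/
abbrev vol : Measure Plane := volume.restrict D.Ω

/-- Length measure on `∂Ω`. -/
abbrev bd : Measure Plane := len.restrict (frontier D.Ω)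

/-- Triples (function, gradient, boundary values), all square integrable. -/
abbrev Triple : Type := Lp ℝ 2 D.vol × Lp Plane 2 D.vol × Lp ℝ 2 D.bd

/-- `G` is the weak gradient of `s` in `Ω`. -/
def IsWeakGradient (s : Lp ℝ 2 D.vol) (G : Lp Plane 2 D.vol) : Prop :=
  ∀ φ : Plane → ℝ, ContDiff ℝ ∞ φ → HasCompactSupport φ → tsupport φ ⊆ D.Ω →
    ∫ x in D.Ω, s x • gradient φ x = -∫ x in D.Ω, φ x • G x

/-- `g` is the trace on `∂Ω` of the function `s` with gradient `G`: there are functions smooth up to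
the boundary that converge to `s` in `H¹(Ω)` and whose boundary values converge to `g` in `L²(∂Ω)`.
On a bounded Lipschitz domain each function in `H¹(Ω)` has exactly one trace. -/
def IsTrace (s : Lp ℝ 2 D.vol) (G : Lp Plane 2 D.vol) (g : Lp ℝ 2 D.bd) : Prop :=
  ∀ ε : ℝ≥0∞, 0 < ε → ∃ f : Plane → ℝ, ContDiff ℝ ∞ f ∧
    eLpNorm (fun x => f x - s x) 2 D.vol ≤ ε ∧
    eLpNorm (fun x => gradient f x - G x) 2 D.vol ≤ ε ∧
    eLpNorm (fun x => f x - g x) 2 D.bd ≤ ε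

/-- The boundary values `g` vanish on the Dirichlet part. -/
def VanishesOnDirichlet (g : Lp ℝ 2 D.bd) : Prop :=
  ∀ᵐ x ∂(len.restrict D.ΓD), g x = 0

/-- The boundary values `g` are periodic on the periodic part. -/
def IsPeriodic (g : Lp ℝ 2 D.bd) : Prop :=
  ∀ j, ∀ᵐ x ∂(len.restrict (D.piece j)), g (x + D.shift j) = g x

theorem contDiff_gradient_continuous {f : Plane → ℝ} (hf : ContDiff ℝ ∞ f) :
    Continuous (gradient f) := by
  unfold gradient
  exact (InnerProductSpace.toDual ℝ Plane).symm.continuous.comp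
    (hf.continuous_fderiv (by simp))

theorem gradient_add' {f g : Plane → ℝ} (hf : ContDiff ℝ ∞ f) (hg : ContDiff ℝ ∞ g) (x : Plane) :
    gradient (fun y => f y + g y) x = gradient f x + gradient g x := by
  have h1 : DifferentiableAt ℝ f x := (hf.differentiable (by simp)) x
  have h2 : DifferentiableAt ℝ g x := (hg.differentiable (by simp)) x
  unfold gradient
  rw [fderiv_fun_add h1 h2, map_add]

theorem gradient_smul' {f : Plane → ℝ} (hf : ContDiff ℝ ∞ f) (r : ℝ) (x : Plane) :
    gradient (fun y => r * f y) x = r • gradient f x := by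
  have h1 : DifferentiableAt ℝ f x := (hf.differentiable (by simp)) x
  unfold gradient
  rw [fderiv_const_mul h1]
  simp

theorem gradient_compact {f : Plane → ℝ} (hf : HasCompactSupport f) :
    HasCompactSupport (gradient f) := by
  unfold gradient
  exact (hf.fderiv (𝕜 := ℝ)).comp_left (map_zero _)

theorem integrable_smul_gradient (s : Lp ℝ 2 D.vol) {φ : Plane → ℝ} (hφ : ContDiff ℝ ∞ φ)
    (hc : HasCompactSupport φ) : Integrable (fun x => s x • gradient φ x) D.vol := by
  have h1 : MemLp (gradient φ) 2 D.vol :=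
    (contDiff_gradient_continuous hφ).memLp_of_hasCompactSupport (gradient_compact hc)
  exact memLp_one_iff_integrable.1 (h1.smul (Lp.memLp s))

theorem integrable_smul_grad (G : Lp Plane 2 D.vol) {φ : Plane → ℝ} (hφ : ContDiff ℝ ∞ φ)
    (hc : HasCompactSupport φ) : Integrable (fun x => φ x • G x) D.vol := by
  have h1 : MemLp φ 2 D.vol := hφ.continuous.memLp_of_hasCompactSupport hc
  exact memLp_one_iff_integrable.1 ((Lp.memLp G).smul h1)

theorem isWeakGradient_add {s s' : Lp ℝ 2 D.vol} {G G' : Lp Plane 2 D.vol}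
    (h : D.IsWeakGradient s G) (h' : D.IsWeakGradient s' G') :
    D.IsWeakGradient (s + s') (G + G') := by
  intro φ hφ hc hs
  have e1 : ∫ x in D.Ω, (s + s') x • gradient φ x
      = ∫ x in D.Ω, (s x • gradient φ x + s' x • gradient φ x) := by
    apply integral_congr_ae
    filter_upwards [Lp.coeFn_add s s'] with x hx
    rw [hx, Pi.add_apply, add_smul]
  have e2 : ∫ x in D.Ω, φ x • (G + G') x = ∫ x in D.Ω, (φ x • G x + φ x • G' x) := by
    apply integral_congr_ae
    filter_upwards [Lp.coeFn_add G G'] with x hx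
    rw [hx, Pi.add_apply, smul_add]
  rw [e1, e2, integral_add (D.integrable_smul_gradient s hφ hc) (D.integrable_smul_gradient s' hφ hc),
    integral_add (D.integrable_smul_grad G hφ hc) (D.integrable_smul_grad G' hφ hc),
    h φ hφ hc hs, h' φ hφ hc hs, neg_add]

theorem isWeakGradient_smul (r : ℝ) {s : Lp ℝ 2 D.vol} {G : Lp Plane 2 D.vol}
    (h : D.IsWeakGradient s G) : D.IsWeakGradient (r • s) (r • G) := by
  intro φ hφ hc hs
  have e1 : ∫ x in D.Ω, (r • s) x • gradient φ x = ∫ x in D.Ω, r • (s x • gradient φ x) := by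
    apply integral_congr_ae
    filter_upwards [Lp.coeFn_smul r s] with x hx
    rw [hx, Pi.smul_apply, smul_assoc]
  have e2 : ∫ x in D.Ω, φ x • (r • G) x = ∫ x in D.Ω, r • (φ x • G x) := by
    apply integral_congr_ae
    filter_upwards [Lp.coeFn_smul r G] with x hx
    rw [hx, Pi.smul_apply, smul_comm]
  rw [e1, e2, integral_smul, integral_smul, h φ hφ hc hs, smul_neg]

theorem eLpNorm_sub_add_le {E : Type*} [NormedAddCommGroup E] {μ : Measure Plane} {f f' : Plane → E}
    (hf : AEStronglyMeasurable f μ) (hf' : AEStronglyMeasurable f' μ) (s s' : Lp E 2 μ) {ε : ℝ≥0∞}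
    (h : eLpNorm (fun x => f x - s x) 2 μ ≤ ε / 2) (h' : eLpNorm (fun x => f' x - s' x) 2 μ ≤ ε / 2) :
    eLpNorm (fun x => (f x + f' x) - (s + s') x) 2 μ ≤ ε := by
  have e : eLpNorm (fun x => (f x + f' x) - (s + s') x) 2 μ
      = eLpNorm ((fun x => f x - s x) + (fun x => f' x - s' x)) 2 μ := by
    apply eLpNorm_congr_ae
    filter_upwards [Lp.coeFn_add s s'] with x hx
    rw [hx]
    simp only [Pi.add_apply]
    abel
  rw [e]
  refine (eLpNorm_add_le (hf.sub (Lp.aestronglyMeasurable s))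
    (hf'.sub (Lp.aestronglyMeasurable s')) (by norm_num)).trans ?_
  exact (add_le_add h h').trans (ENNReal.add_halves ε).le

theorem eLpNorm_sub_smul_le {E : Type*} [NormedAddCommGroup E] [NormedSpace ℝ E]
    {μ : Measure Plane} {f : Plane → E} (s : Lp E 2 μ) {ε : ℝ≥0∞} (r : ℝ)
    (h : eLpNorm (fun x => f x - s x) 2 μ ≤ ε / (‖r‖ₑ + 1)) :
    eLpNorm (fun x => r • f x - (r • s) x) 2 μ ≤ ε := by
  have e : eLpNorm (fun x => r • f x - (r • s) x) 2 μ = eLpNorm (r • fun x => f x - s x) 2 μ := by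
    apply eLpNorm_congr_ae
    filter_upwards [Lp.coeFn_smul r s] with x hx
    rw [hx]
    simp only [Pi.smul_apply, smul_sub]
  rw [e]
  refine eLpNorm_const_smul_le.trans ?_
  have h1 : ‖r‖ₑ * (ε / (‖r‖ₑ + 1)) ≤ (‖r‖ₑ + 1) * (ε / (‖r‖ₑ + 1)) := by
    gcongr
    exact le_self_add
  exact (mul_le_mul_right h _).trans (h1.trans ENNReal.mul_div_le)

theorem isTrace_add {s s' : Lp ℝ 2 D.vol} {G G' : Lp Plane 2 D.vol} {g g' : Lp ℝ 2 D.bd}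
    (h : D.IsTrace s G g) (h' : D.IsTrace s' G' g') : D.IsTrace (s + s') (G + G') (g + g') := by
  intro ε hε
  obtain ⟨f, hf, h1, h2, h3⟩ := h (ε / 2) (ENNReal.half_pos hε.ne')
  obtain ⟨f', hf', h1', h2', h3'⟩ := h' (ε / 2) (ENNReal.half_pos hε.ne')
  refine ⟨fun x => f x + f' x, hf.add hf', ?_, ?_, ?_⟩
  · exact eLpNorm_sub_add_le hf.continuous.aestronglyMeasurable
      hf'.continuous.aestronglyMeasurable s s' h1 h1'
  · simp only [gradient_add' hf hf']
    exact eLpNorm_sub_add_le (contDiff_gradient_continuous hf).aestronglyMeasurable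
      (contDiff_gradient_continuous hf').aestronglyMeasurable G G' h2 h2'
  · exact eLpNorm_sub_add_le hf.continuous.aestronglyMeasurable
      hf'.continuous.aestronglyMeasurable g g' h3 h3'

theorem isTrace_smul (r : ℝ) {s : Lp ℝ 2 D.vol} {G : Lp Plane 2 D.vol} {g : Lp ℝ 2 D.bd}
    (h : D.IsTrace s G g) : D.IsTrace (r • s) (r • G) (r • g) := by
  intro ε hε
  obtain ⟨f, hf, h1, h2, h3⟩ := h (ε / (‖r‖ₑ + 1))
    (ENNReal.div_pos hε.ne' (by simp [enorm_ne_top]))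
  refine ⟨fun x => r * f x, contDiff_const.mul hf, ?_, ?_, ?_⟩
  · exact eLpNorm_sub_smul_le s r h1
  · simp only [gradient_smul' hf]
    exact eLpNorm_sub_smul_le G r h2
  · exact eLpNorm_sub_smul_le g r h3

theorem isTrace_zero : D.IsTrace 0 0 0 := by
  intro ε hε
  refine ⟨fun _ => 0, contDiff_const, ?_, ?_, ?_⟩
  · rw [eLpNorm_congr_ae (g := 0)]
    · simp
    · filter_upwards [Lp.coeFn_zero ℝ 2 D.vol] with x hx
      simp only [hx, Pi.zero_apply]
      simp
  · rw [eLpNorm_congr_ae (g := 0)]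
    · simp
    · filter_upwards [Lp.coeFn_zero Plane 2 D.vol] with x hx
      simp only [hx, Pi.zero_apply]
      simp [gradient]
  · rw [eLpNorm_congr_ae (g := 0)]
    · simp
    · filter_upwards [Lp.coeFn_zero ℝ 2 D.bd] with x hx
      simp only [hx, Pi.zero_apply]
      simp

theorem ΓD_subset : D.ΓD ⊆ frontier D.Ω := by
  rw [← D.cover]
  intro x hx
  simp [hx]

theorem Γper_subset : D.Γper ⊆ frontier D.Ω := by
  rw [← D.cover]
  intro x hx
  simp [hx]

theorem piece_subset (j : Fin D.numPieces) : D.piece j ⊆ frontier D.Ω := by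
  refine Subset.trans ?_ D.Γper_subset
  rw [D.periodic_cover]
  exact subset_iUnion_of_subset j subset_union_left

theorem ae_piece {p : Plane → Prop} (hp : ∀ᵐ x ∂D.bd, p x) (j : Fin D.numPieces) :
    ∀ᵐ x ∂(len.restrict (D.piece j)), p x :=
  ae_restrict_of_ae_restrict_of_subset (D.piece_subset j) hp

theorem ae_shift {p : Plane → Prop} (hp : ∀ᵐ x ∂D.bd, p x) (j : Fin D.numPieces) :
    ∀ᵐ x ∂(len.restrict (D.piece j)), p (x + D.shift j) := by
  have hmp : MeasurePreserving (fun x => x + D.shift j) len len :=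
    (IsometryEquiv.addRight (D.shift j)).measurePreserving_hausdorffMeasure 1
  rw [ae_restrict_iff' isClosed_frontier.measurableSet] at hp
  have h2 := hmp.quasiMeasurePreserving.ae hp
  rw [ae_restrict_iff' (D.measurableSet_piece j)]
  filter_upwards [h2] with x hx hxj
  apply hx
  apply D.Γper_subset
  rw [D.periodic_cover]
  exact mem_iUnion.2 ⟨j, Or.inr ⟨x, hxj, rfl⟩⟩

/-- The functions in `H¹(Ω)` that vanish on `ΓD` and are periodic on `Γper`. An element is a Sobolev
function together with its weak gradient and its trace, which the function determines. -/
def sobolev : Submodule ℝ D.Triple where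
  carrier := {w | D.IsWeakGradient w.1 w.2.1 ∧ D.IsTrace w.1 w.2.1 w.2.2 ∧
    D.VanishesOnDirichlet w.2.2 ∧ D.IsPeriodic w.2.2}
  zero_mem' := by
    refine ⟨?_, D.isTrace_zero, ?_, ?_⟩
    · intro φ hφ hc hs
      have e1 : ∫ x in D.Ω, (0 : Lp ℝ 2 D.vol) x • gradient φ x = 0 := by
        rw [← integral_zero Plane Plane (μ := D.vol)]
        apply integral_congr_ae
        filter_upwards [Lp.coeFn_zero ℝ 2 D.vol] with x hx
        simp only [hx, Pi.zero_apply]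
        simp
      have e2 : ∫ x in D.Ω, φ x • (0 : Lp Plane 2 D.vol) x = 0 := by
        rw [← integral_zero Plane Plane (μ := D.vol)]
        apply integral_congr_ae
        filter_upwards [Lp.coeFn_zero Plane 2 D.vol] with x hx
        simp only [hx, Pi.zero_apply]
        simp
      exact e1.trans (by rw [← neg_zero, ← e2]; rfl)
    · exact ae_restrict_of_ae_restrict_of_subset D.ΓD_subset (Lp.coeFn_zero ℝ 2 D.bd)
    · intro j
      filter_upwards [D.ae_piece (Lp.coeFn_zero ℝ 2 D.bd) j,
        D.ae_shift (Lp.coeFn_zero ℝ 2 D.bd) j] with x h1 h2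
      exact h2.trans h1.symm
  add_mem' := by
    rintro ⟨s, G, g⟩ ⟨s', G', g'⟩ ⟨h1, h2, h3, h4⟩ ⟨h1', h2', h3', h4'⟩
    refine ⟨D.isWeakGradient_add h1 h1', D.isTrace_add h2 h2', ?_, ?_⟩
    · filter_upwards [h3, h3', ae_restrict_of_ae_restrict_of_subset D.ΓD_subset
        (Lp.coeFn_add g g')] with x hx hx' hs
      refine hs.trans ?_
      simp only [Pi.add_apply]
      rw [hx, hx', add_zero]
    · intro j
      filter_upwards [h4 j, h4' j, D.ae_piece (Lp.coeFn_add g g') j,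
        D.ae_shift (Lp.coeFn_add g g') j] with x hx hx' hs hs'
      refine hs'.trans (Eq.trans ?_ hs.symm)
      simp only [Pi.add_apply]
      rw [hx, hx']
  smul_mem' := by
    rintro r ⟨s, G, g⟩ ⟨h1, h2, h3, h4⟩
    refine ⟨D.isWeakGradient_smul r h1, D.isTrace_smul r h2, ?_, ?_⟩
    · filter_upwards [h3, ae_restrict_of_ae_restrict_of_subset D.ΓD_subset
        (Lp.coeFn_smul r g)] with x hx hs
      refine hs.trans ?_
      simp only [Pi.smul_apply]
      rw [hx, smul_zero]
    · intro j
      filter_upwards [h4 j, D.ae_piece (Lp.coeFn_smul r g) j,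
        D.ae_shift (Lp.coeFn_smul r g) j] with x hx hs hs'
      refine hs'.trans (Eq.trans ?_ hs.symm)
      simp only [Pi.smul_apply]
      rw [hx]

/-- The space of the functions in `sobolev`, to be equipped with the energy product. -/
def V : Type := ↥D.sobolev

instance : AddCommGroup D.V := inferInstanceAs (AddCommGroup ↥D.sobolev)
instance : Module ℝ D.V := inferInstanceAs (Module ℝ ↥D.sobolev)

variable {D}

/-- The function itself. -/
def V.fn (s : D.V) : Lp ℝ 2 D.vol := s.1.1

/-- Its weak gradient. -/
def V.grad (s : D.V) : Lp Plane 2 D.vol := s.1.2.1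

/-- Its trace on `∂Ω`. -/
def V.trace (s : D.V) : Lp ℝ 2 D.bd := s.1.2.2

/-- The energy product `∫_Ω σ ∇s·∇s' + ∫_{ΓR} a s s'`. -/
def energy (s s' : D.V) : ℝ :=
  (∫ x in D.Ω, D.σ x * inner ℝ (s.grad x) (s'.grad x)) +
    ∫ x in D.ΓR, D.a x * (s.trace x * s'.trace x) ∂len

theorem ΓR_subset : D.ΓR ⊆ frontier D.Ω := by
  rw [← D.cover]
  intro x hx
  simp [hx]

theorem bd_restrict : D.bd.restrict D.ΓR = len.restrict D.ΓR :=
  Measure.restrict_restrict_of_subset ΓR_subset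

theorem integrable_grad (G G' : Lp Plane 2 D.vol) :
    Integrable (fun x => D.σ x * inner ℝ (G x) (G' x)) D.vol := by
  obtain ⟨m, M, hm, hM⟩ := D.σ_bound
  refine (L2.integrable_inner (𝕜 := ℝ) G G').bdd_mul (c := M)
    D.measurable_σ.aestronglyMeasurable ?_
  filter_upwards [hM] with x hx
  rw [Real.norm_eq_abs, abs_of_nonneg (hm.le.trans hx.1)]
  exact hx.2

theorem integrable_trace (g g' : Lp ℝ 2 D.bd) :
    Integrable (fun x => D.a x * (g x * g' x)) (len.restrict D.ΓR) := by
  obtain ⟨M, hM⟩ := D.a_bound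
  have h0 : Integrable (fun x => g x * g' x) (len.restrict D.ΓR) := by
    have := (MemLp.integrable_mul (Lp.memLp g) (Lp.memLp g')).restrict (s := D.ΓR)
    rwa [bd_restrict] at this
  refine h0.bdd_mul (c := M) D.measurable_a.aestronglyMeasurable ?_
  filter_upwards [ae_restrict_mem D.measurableSet_ΓR] with x hx
  rw [Real.norm_eq_abs, abs_of_pos (hM x hx).1]
  exact (hM x hx).2

theorem ae_ΓR {p : Plane → Prop} (hp : ∀ᵐ x ∂D.bd, p x) : ∀ᵐ x ∂(len.restrict D.ΓR), p x :=
  ae_restrict_of_ae_restrict_of_subset ΓR_subset hp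

theorem energy_comm (s s' : D.V) : energy s' s = energy s s' := by
  unfold energy
  congr 1
  · simp only [real_inner_comm]
  · simp only [mul_comm]

theorem energy_nonneg (s : D.V) : 0 ≤ energy s s := by
  unfold energy
  apply add_nonneg
  · apply integral_nonneg_of_ae
    obtain ⟨m, M, hm, hM⟩ := D.σ_bound
    filter_upwards [hM] with x hx
    exact mul_nonneg (hm.le.trans hx.1) real_inner_self_nonneg
  · apply integral_nonneg_of_ae
    obtain ⟨M, hM⟩ := D.a_bound
    filter_upwards [ae_restrict_mem D.measurableSet_ΓR] with x hx
    exact mul_nonneg (hM x hx).1.le (mul_self_nonneg _)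

theorem energy_add (s t r : D.V) : energy (s + t) r = energy s r + energy t r := by
  have e1 : ∫ x in D.Ω, D.σ x * inner ℝ ((s + t).grad x) (r.grad x)
      = ∫ x in D.Ω, (D.σ x * inner ℝ (s.grad x) (r.grad x) +
          D.σ x * inner ℝ (t.grad x) (r.grad x)) := by
    apply integral_congr_ae
    filter_upwards [Lp.coeFn_add s.grad t.grad] with x hx
    have hx' : (s + t).grad x = s.grad x + t.grad x := hx
    simp only [hx', inner_add_left, mul_add]
  have e2 : ∫ x in D.ΓR, D.a x * ((s + t).trace x * r.trace x) ∂len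
      = ∫ x in D.ΓR, (D.a x * (s.trace x * r.trace x) + D.a x * (t.trace x * r.trace x)) ∂len := by
    apply integral_congr_ae
    filter_upwards [ae_ΓR (Lp.coeFn_add s.trace t.trace)] with x hx
    have hx' : (s + t).trace x = s.trace x + t.trace x := hx
    simp only [hx']
    ring
  unfold energy
  rw [e1, e2, integral_add (integrable_grad _ _) (integrable_grad _ _),
    integral_add (integrable_trace _ _) (integrable_trace _ _)]
  ring

theorem energy_smul (k : ℝ) (s r : D.V) : energy (k • s) r = k * energy s r := by
  have e1 : ∫ x in D.Ω, D.σ x * inner ℝ ((k • s).grad x) (r.grad x)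
      = ∫ x in D.Ω, k * (D.σ x * inner ℝ (s.grad x) (r.grad x)) := by
    apply integral_congr_ae
    filter_upwards [Lp.coeFn_smul k s.grad] with x hx
    have hx' : (k • s).grad x = k • s.grad x := hx
    simp only [hx', real_inner_smul_left]
    ring
  have e2 : ∫ x in D.ΓR, D.a x * ((k • s).trace x * r.trace x) ∂len
      = ∫ x in D.ΓR, k * (D.a x * (s.trace x * r.trace x)) ∂len := by
    apply integral_congr_ae
    filter_upwards [ae_ΓR (Lp.coeFn_smul k s.trace)] with x hx
    have hx' : (k • s).trace x = k * s.trace x := hx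
    simp only [hx']
    ring
  unfold energy
  rw [e1, e2, integral_const_mul, integral_const_mul]
  ring

variable (D)

/-- The energy product as a positive semidefinite inner product on `V`. -/
abbrev energyCore : PreInnerProductSpace.Core ℝ D.V where
  inner := energy
  conj_inner_symm s t := energy_comm s t
  re_inner_nonneg s := energy_nonneg s
  add_left s t r := energy_add s t r
  smul_left s t k := energy_smul k s t

instance : SeminormedAddCommGroup D.V :=
  InnerProductSpace.Core.toSeminormedAddCommGroup (c := D.energyCore)

instance : InnerProductSpace ℝ D.V := InnerProductSpace.ofCore D.energyCore

/-- The constants are controlled: Dirichlet or Robin conditions hold on a part of the boundary (of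
positive length). -/
def ConstantsControlled : Prop := 0 < len (D.ΓD ∪ D.ΓR)

/-- The functions that are divided out in the definition of `H`: only `0` if the constants are
controlled, and the constants otherwise. -/
def IsNegligible (s : D.V) : Prop :=
  (∀ᵐ x ∂D.vol, s.fn x = 0) ∨ (¬ D.ConstantsControlled ∧ ∃ k : ℝ, ∀ᵐ x ∂D.vol, s.fn x = k)

/-- The space `H` with the energy product: the functions in `V`, two of them being identified if
their difference has energy `0`. It is `V` itself if the constants are controlled, and the quotient
of `V` by the constants otherwise (the main theorem contains this fact). -/
abbrev H : Type := SeparationQuotient D.V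

/-- The class in `H` of a function in `V`. -/
def V.toH {D : Data} (s : D.V) : D.H := SeparationQuotient.mk s

/-- `L²(Ω)` with the inner product `∫_Ω c u u'`. -/
abbrev L2c : Type := Lp ℝ 2 (D.vol.withDensity fun x => ENNReal.ofReal (D.c x))

/-- The space of the pairs `(u, s)` with `u ∈ L²(Ω)`, `s ∈ H`, with the inner product
`∫_Ω c u u' + ∫_Ω σ ∇s·∇s' + ∫_{ΓR} a s s'`. -/
abbrev Space : Type := WithLp 2 (D.L2c × D.H)

/-- `-div (σ ∇s) = f` in `Ω`, with the natural boundary conditions in the weak sense: the conormal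
derivative `σ ∇s·n` is `0` on `ΓN`, is `-a s` on `ΓR`, and matches on the periodic part. -/
def IsNegDiv {D : Data} (s : D.V) (f : Lp ℝ 2 D.vol) : Prop :=
  ∀ v : D.V, inner ℝ s v = ∫ x in D.Ω, f x * v.fn x

/-- `φ = (u, s)` is in the domain of the Graetz operator and `ψ = (c⁻¹ (h u - div (σ ∇s)), u)` is its
image. -/
def IsImage {D : Data} (φ ψ : D.Space) : Prop :=
  ∃ (u s : D.V) (f : Lp ℝ 2 D.vol), IsNegDiv s f ∧
    (∀ᵐ x ∂D.vol, φ.fst x = u.fn x) ∧ φ.snd = s.toH ∧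
    (∀ᵐ x ∂D.vol, ψ.fst x = (D.c x)⁻¹ * (D.h x * u.fn x + f x)) ∧ ψ.snd = u.toH

variable {D}

theorem isNegDiv_add {s s' : D.V} {f f' : Lp ℝ 2 D.vol} (h : IsNegDiv s f) (h' : IsNegDiv s' f') :
    IsNegDiv (s + s') (f + f') := by
  intro v
  have e : ∫ x in D.Ω, (f + f') x * v.fn x = ∫ x in D.Ω, (f x * v.fn x + f' x * v.fn x) := by
    apply integral_congr_ae
    filter_upwards [Lp.coeFn_add f f'] with x hx
    rw [hx, Pi.add_apply, add_mul]
  rw [inner_add_left, h v, h' v, e, integral_add]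
  · exact MemLp.integrable_mul (Lp.memLp f) (Lp.memLp v.fn)
  · exact MemLp.integrable_mul (Lp.memLp f') (Lp.memLp v.fn)

theorem isNegDiv_smul (k : ℝ) {s : D.V} {f : Lp ℝ 2 D.vol} (h : IsNegDiv s f) :
    IsNegDiv (k • s) (k • f) := by
  intro v
  have e : ∫ x in D.Ω, (k • f) x * v.fn x = ∫ x in D.Ω, k * (f x * v.fn x) := by
    apply integral_congr_ae
    filter_upwards [Lp.coeFn_smul k f] with x hx
    rw [hx, Pi.smul_apply, smul_eq_mul, mul_assoc]
  rw [real_inner_smul_left, h v, e, integral_const_mul]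

theorem vol_ac : D.vol ≪ D.vol.withDensity fun x => ENNReal.ofReal (D.c x) := by
  obtain ⟨m, M, hm, hM⟩ := D.c_bound
  refine withDensity_absolutelyContinuous' (by have := D.measurable_c; fun_prop) ?_
  filter_upwards [hM] with x hx
  simpa using hm.trans_le hx.1

theorem isImage_add {φ ψ φ' ψ' : D.Space} (h : IsImage φ ψ) (h' : IsImage φ' ψ') :
    IsImage (φ + φ') (ψ + ψ') := by
  obtain ⟨u, s, f, h1, h2, h3, h4, h5⟩ := h
  obtain ⟨u', s', f', h1', h2', h3', h4', h5'⟩ := h'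
  refine ⟨u + u', s + s', f + f', isNegDiv_add h1 h1', ?_, ?_, ?_, ?_⟩
  · filter_upwards [h2, h2', vol_ac.ae_le (Lp.coeFn_add φ.fst φ'.fst),
      Lp.coeFn_add u.fn u'.fn] with x a1 a2 a3 a4
    exact a3.trans ((congrArg₂ (· + ·) a1 a2).trans a4.symm)
  · rw [WithLp.add_snd, h3, h3']
    rfl
  · filter_upwards [h4, h4', vol_ac.ae_le (Lp.coeFn_add ψ.fst ψ'.fst),
      Lp.coeFn_add u.fn u'.fn, Lp.coeFn_add f f'] with x a1 a2 a3 a4 a5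
    have a4' : (u + u').fn x = u.fn x + u'.fn x := a4
    refine a3.trans ((congrArg₂ (· + ·) a1 a2).trans ?_)
    rw [a4', a5, Pi.add_apply]
    ring
  · rw [WithLp.add_snd, h5, h5']
    rfl

theorem isImage_smul (k : ℝ) {φ ψ : D.Space} (h : IsImage φ ψ) : IsImage (k • φ) (k • ψ) := by
  obtain ⟨u, s, f, h1, h2, h3, h4, h5⟩ := h
  refine ⟨k • u, k • s, k • f, isNegDiv_smul k h1, ?_, ?_, ?_, ?_⟩
  · filter_upwards [h2, vol_ac.ae_le (Lp.coeFn_smul k φ.fst), Lp.coeFn_smul k u.fn] with x a1 a3 a4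
    exact a3.trans ((congrArg (k • ·) a1).trans a4.symm)
  · rw [WithLp.smul_snd, h3]
    rfl
  · filter_upwards [h4, vol_ac.ae_le (Lp.coeFn_smul k ψ.fst), Lp.coeFn_smul k u.fn,
      Lp.coeFn_smul k f] with x a1 a3 a4 a5
    have a4' : (k • u).fn x = k * u.fn x := a4
    refine a3.trans ((congrArg (k • ·) a1).trans ?_)
    rw [a4', a5, Pi.smul_apply]
    simp only [smul_eq_mul]
    ring
  · rw [WithLp.smul_snd, h5]
    rfl

theorem isImage_zero : IsImage (0 : D.Space) 0 := by
  refine ⟨0, 0, 0, ?_, ?_, rfl, ?_, rfl⟩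
  · intro v
    rw [inner_zero_left]
    symm
    rw [← integral_zero Plane ℝ (μ := D.vol)]
    apply integral_congr_ae
    filter_upwards [Lp.coeFn_zero ℝ 2 D.vol] with x hx
    simp only [hx, Pi.zero_apply]
    simp
  · filter_upwards [vol_ac.ae_le (Lp.coeFn_zero ℝ 2
      (D.vol.withDensity fun x => ENNReal.ofReal (D.c x))), Lp.coeFn_zero ℝ 2 D.vol] with x a1 a2
    exact a1.trans a2.symm
  · filter_upwards [vol_ac.ae_le (Lp.coeFn_zero ℝ 2
      (D.vol.withDensity fun x => ENNReal.ofReal (D.c x))), Lp.coeFn_zero ℝ 2 D.vol] with x a1 a2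
    refine a1.trans ?_
    have a2' : (0 : D.V).fn x = 0 := a2
    rw [a2', a2]
    simp

variable (D)

/-- The graph of the Graetz operator `𝒜 (u, s) = (c⁻¹ (h u - div (σ ∇s)), u)`, with the domain given
by `u ∈ H`, `div (σ ∇s) ∈ L²(Ω)` and the lateral boundary conditions. -/
def graph : Submodule ℝ (D.Space × D.Space) where
  carrier := {p | IsImage p.1 p.2}
  zero_mem' := isImage_zero
  add_mem' h h' := isImage_add h h'
  smul_mem' k _ h := isImage_smul k h

/-- The eigenspace `{φ | 𝒜 φ = μ φ}`. -/
def eigenspace (μ : ℝ) : Submodule ℝ D.Space :=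
  D.graph.comap (LinearMap.id.prod (μ • LinearMap.id))

/-- The closed span of the eigenvectors whose eigenvalue lies in `S`; it is the range of the spectral
projection for `S`. -/
def spectralSpace (S : Set ℝ) : Submodule ℝ D.Space :=
  (⨆ μ ∈ S, D.eigenspace μ).topologicalClosure

/-- The projection `P (u, s) = (u, 0)`. -/
def P : D.Space →L[ℝ] D.Space :=
  (WithLp.prodContinuousLinearEquiv 2 ℝ D.L2c D.H).symm.toContinuousLinearMap ∘L
    (ContinuousLinearMap.inl ℝ D.L2c D.H ∘L ContinuousLinearMap.fst ℝ D.L2c D.H) ∘L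
      (WithLp.prodContinuousLinearEquiv 2 ℝ D.L2c D.H).toContinuousLinearMap

section Hilbert

variable [CompleteSpace D.Space]

instance (S : Set ℝ) : (D.spectralSpace S).HasOrthogonalProjection := by
  unfold spectralSpace
  infer_instance

/-- The spectral projection `π_S`: the orthogonal projection onto the closed span of the eigenvectors
whose eigenvalue lies in `S`. Thus `π₋` and `π₊` belong to `Iio 0` and `Ioi 0`. -/
def proj (S : Set ℝ) : D.Space →L[ℝ] D.Space := (D.spectralSpace S).starProjection

/-- The orthogonal projection onto the (closed) eigenspace of `μ`. -/
def eigenProj (μ : ℝ) : D.Space →L[ℝ] D.Space :=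
  (D.eigenspace μ).topologicalClosure.starProjection

/-- The `α`-norm `(∑_μ |μ|^{2α} ‖E_μ φ‖²)^{1/2} ∈ [0, ∞]`, where `E_μ` is the orthogonal projection
onto the eigenspace of `μ`. -/
def powNorm (α : ℝ) (φ : D.Space) : ℝ≥0∞ :=
  (∑' μ : ℝ, ENNReal.ofReal (|μ| ^ (2 * α)) * ‖D.eigenProj μ φ‖ₑ ^ 2) ^ (1 / 2 : ℝ)

/-- The operator `π_S P π_S` on the range of `π_S`. -/
def compression (S : Set ℝ) : D.spectralSpace S →L[ℝ] D.spectralSpace S :=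
  (D.spectralSpace S).orthogonalProjectionOnto ∘L D.P ∘L (D.spectralSpace S).subtypeL

/-- `B_S = π_S (π_S P π_S)⁻¹ π_S`, the inverse being taken on the range of `π_S`. -/
def B (S : Set ℝ) : D.Space →L[ℝ] D.Space :=
  (D.spectralSpace S).subtypeL ∘L (D.compression S).inverse ∘L
    (D.spectralSpace S).orthogonalProjectionOnto

/-- `π_S P π_S` is invertible on the range of `π_S`, and `B_S` is a self-adjoint operator that is
bounded in the norm of the space and in the `1/2`-norm. -/
def InvertibleWithBounds (S : Set ℝ) : Prop :=
  (D.compression S).IsInvertible ∧ IsSelfAdjoint (D.B S) ∧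
    ∃ C : ℝ, 0 < C ∧ ∀ φ : D.Space,
      ‖D.B S φ‖ ≤ C * ‖D.proj S φ‖ ∧
      D.powNorm (1 / 2) (D.B S φ) ≤ ENNReal.ofReal C * D.powNorm (1 / 2) (D.proj S φ)

end Hilbert

end Data

end Graetz

end

/-! Let `J = 2 P - 1`. On the domain of the Graetz operator `𝒜` one has
`(J 𝒜 φ | ψ) + (J φ | 𝒜 ψ) = 2 ∫ h u u'`, so between the eigenspaces with positive (or negative)
eigenvalues `J` is a weak solution of a Lyapunov equation `L J + J L = 2 k`, where `L = |𝒜|` and the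
form `k` is bounded. Writing `(λ + μ)⁻¹ = ∫₀^∞ e^{-λ t} e^{-μ t} dt` and applying the Cauchy-Schwarz
inequality in `t`, one finds that the compression of `J` to the spectral space maps it to the
vectors with finite `1/2`-norm. As the eigenvalues of `𝒜` accumulate only at infinity, the
compression of `J` is compact, and `π P π = (1 + π J π) / 2` is a Fredholm operator of index zero.
If `π P π x = 0`, then `P x = 0` by positivity, `x = - π J π x` has a finite `1/2`-norm, and the
Lyapunov equation on the diagonal expresses this norm by `k(x, x)`, which vanishes with `P x`; so
`π P π` is injective, hence invertible. The smoothing property of `J` bounds the inverse in the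
`1/2`-norm.

The eigenspaces are finite-dimensional with eigenvalues that accumulate only at infinity because
the vectors in a span of eigenspaces with bounded eigenvalues are bounded in the graph norm, and the
domain of `𝒜` with the graph norm embeds compactly into `𝓗`. This rests on the compactness of the
embedding of the Sobolev space into `L²(Ω)`: on the cells of a small grid a function is close to its
means, and near the boundary, where the cells leave `Ω`, its square integral over a thin strip is
controlled by integrating along the direction transversal to the boundary in a Lipschitz chart. The
same integration yields the trace inequality.
-/

namespace Graetz

/-! ### Orthogonal families and weighted norms -/

section ENNReal

theorem sq_lintegral_mul_le {α : Type*} [MeasurableSpace α] {μ : Measure α} {f g : α → ℝ≥0∞}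
    (hf : AEMeasurable f μ) (hg : AEMeasurable g μ) :
    (∫⁻ x, f x * g x ∂μ) ^ 2 ≤ (∫⁻ x, f x ^ 2 ∂μ) * ∫⁻ x, g x ^ 2 ∂μ := by
  have h := ENNReal.lintegral_mul_le_Lp_mul_Lq μ Real.HolderConjugate.two_two hf hg
  simp only [Pi.mul_apply, ENNReal.rpow_two] at h
  refine (ENNReal.pow_le_pow_left h).trans (le_of_eq ?_)
  rw [mul_pow, ← ENNReal.rpow_two, ← ENNReal.rpow_two, ← ENNReal.rpow_mul, ← ENNReal.rpow_mul]
  simp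

theorem ennreal_add_sq_le (a b : ℝ≥0∞) : (a + b) ^ 2 ≤ 2 * (a ^ 2 + b ^ 2) := by
  have h := ENNReal.rpow_add_le_mul_rpow_add_rpow a b one_le_two
  simp only [ENNReal.rpow_two] at h
  norm_num at h
  exact h

end ENNReal

section OrthogonalProjections

variable {ι E : Type*} [NormedAddCommGroup E] [InnerProductSpace ℝ E] {V : ι → Submodule ℝ E}

theorem enorm_sum_sq (hV : OrthogonalFamily ℝ (fun i => V i) fun i => (V i).subtypeₗᵢ)
    (F : Finset ι) (a : ∀ i, V i) : ‖∑ i ∈ F, (a i : E)‖ₑ ^ 2 = ∑ i ∈ F, ‖a i‖ₑ ^ 2 := by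
  have h : ‖∑ i ∈ F, (a i : E)‖ ^ 2 = ∑ i ∈ F, ‖a i‖ ^ 2 := hV.norm_sum a F
  simp only [← ofReal_norm, ← ENNReal.ofReal_pow (norm_nonneg _), h]
  exact ENNReal.ofReal_sum_of_nonneg fun i _ => sq_nonneg _

variable [∀ i, (V i).HasOrthogonalProjection]

variable (V) in
/-- The sum of the orthogonal projections onto the subspaces `V i` with `i ∈ F`. -/
noncomputable def partialProj (F : Finset ι) : E →L[ℝ] E := ∑ i ∈ F, (V i).starProjection

theorem partialProj_apply (F : Finset ι) (x : E) :
    partialProj V F x = ∑ i ∈ F, ((V i).orthogonalProjectionOnto x : E) :=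
  sum_apply ..

theorem partialProj_mem_iSup (F : Finset ι) (x : E) : partialProj V F x ∈ ⨆ i, V i := by
  rw [partialProj_apply]
  exact Submodule.sum_mem _ fun i _ => Submodule.mem_iSup_of_mem i (Subtype.prop _)

theorem inner_sum_right_eq (F : Finset ι) (x : E) (a : ∀ i, V i) :
    inner ℝ x (∑ i ∈ F, (a i : E)) = ∑ i ∈ F, inner ℝ ((V i).orthogonalProjectionOnto x) (a i) := by
  rw [inner_sum]
  exact Finset.sum_congr rfl fun i _ =>
    (Submodule.inner_orthogonalProjectionOnto_eq_of_mem_right (a i) x).symm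

theorem starProjection_sum [DecidableEq ι]
    (hV : OrthogonalFamily ℝ (fun i => V i) fun i => (V i).subtypeₗᵢ) (F : Finset ι)
    (a : ∀ i, V i) (i : ι) :
    (V i).starProjection (∑ j ∈ F, (a j : E)) = if i ∈ F then (a i : E) else 0 := by
  have h : ∀ j, (V i).starProjection (a j : E) = if i = j then (a i : E) else 0 := by
    intro j
    split_ifs with hij
    · subst hij
      exact Submodule.starProjection_eq_self_iff.2 (a i).2
    · exact (Submodule.starProjection_apply_eq_zero_iff _).2
        ((hV.isOrtho (Ne.symm hij)).le (a j).2)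
  simp only [map_sum, h, Finset.sum_ite_eq]

theorem starProjection_partialProj [DecidableEq ι]
    (hV : OrthogonalFamily ℝ (fun i => V i) fun i => (V i).subtypeₗᵢ) (F : Finset ι) (x : E)
    (i : ι) :
    (V i).starProjection (partialProj V F x) = if i ∈ F then (V i).starProjection x else 0 := by
  rw [partialProj_apply, starProjection_sum hV]
  rfl

theorem norm_partialProj_le (hV : OrthogonalFamily ℝ (fun i => V i) fun i => (V i).subtypeₗᵢ)
    (F : Finset ι) (x : E) : ‖partialProj V F x‖ ≤ ‖x‖ := by
  have h : ‖partialProj V F x‖ ^ 2 = inner ℝ x (partialProj V F x) := by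
    rw [partialProj_apply, inner_sum_right_eq]
    exact (hV.norm_sum _ F).trans (by simp only [real_inner_self_eq_norm_sq])
  rcases (norm_nonneg (partialProj V F x)).eq_or_lt with h0 | h0
  · exact h0 ▸ norm_nonneg x
  · exact le_of_mul_le_mul_right (by simpa [← sq, h] using real_inner_le_norm _ _) h0

theorem eventually_partialProj_eq
    (hV : OrthogonalFamily ℝ (fun i => V i) fun i => (V i).subtypeₗᵢ) {x : E} (hx : x ∈ ⨆ i, V i) :
    ∀ᶠ F : Finset ι in atTop, partialProj V F x = x := by
  classical
  induction hx using Submodule.iSup_induction' with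
  | mem i x hx =>
    filter_upwards [eventually_ge_atTop {i}] with F hF
    have hi : i ∈ F := hF (Finset.mem_singleton_self i)
    lift x to V i using hx
    have h := fun j => starProjection_sum hV {i} (Pi.single i x) j
    simp only [Finset.sum_singleton, Pi.single_eq_same, Finset.mem_singleton] at h
    simp [partialProj, h, hi]
  | zero => simp
  | add x y _ _ h1 h2 =>
    filter_upwards [h1, h2] with F e1 e2
    rw [map_add, e1, e2]

theorem tendsto_partialProj (hV : OrthogonalFamily ℝ (fun i => V i) fun i => (V i).subtypeₗᵢ)
    {x : E} (hx : x ∈ (⨆ i, V i).topologicalClosure) :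
    Tendsto (fun F : Finset ι => partialProj V F x) atTop (𝓝 x) := by
  rw [Metric.tendsto_nhds]
  intro ε hε
  obtain ⟨y, hy, hxy⟩ := Metric.mem_closure_iff.1 hx (ε / 2) (half_pos hε)
  filter_upwards [eventually_partialProj_eq hV hy] with F hF
  calc dist (partialProj V F x) x
      ≤ dist (partialProj V F x) (partialProj V F y) + dist y x := by
        simpa only [hF] using dist_triangle _ y x
    _ ≤ dist x y + dist y x := by
        gcongr
        simpa only [dist_eq_norm, map_sub] using norm_partialProj_le hV F (x - y)
    _ < ε := by linarith [dist_comm x y]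

theorem isCompactOperator_partialProj [∀ i, FiniteDimensional ℝ (V i)] (F : Finset ι) :
    IsCompactOperator (partialProj V F) := by
  refine Submodule.sum_mem (compactOperator (RingHom.id ℝ) E E) fun i _ => ?_
  exact (isCompactOperator_of_locallyCompactSpace_rng (V i).subtypeL).comp_clm
    (V i).orthogonalProjectionOnto

end OrthogonalProjections

section WeightedNorms

variable {ι E : Type*} [NormedAddCommGroup E] [InnerProductSpace ℝ E] {V : ι → Submodule ℝ E}
  [∀ i, (V i).HasOrthogonalProjection]

variable (V) in
/-- The square `∑ i, w i * ‖E_i x‖²` of the weighted norm of `x`, where `E_i` is the orthogonal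
projection onto `V i`. With the weights `|λ|` it is the square of the norm `‖·‖_{1/2}`. -/
noncomputable def weightedSq (w : ι → ℝ) (x : E) : ℝ≥0∞ :=
  ∑' i, ENNReal.ofReal (w i) * ‖(V i).starProjection x‖ₑ ^ 2

theorem weightedSq_le_mul {w w' : ι → ℝ} {c : ℝ} (hc : 0 ≤ c) (h : ∀ i, w i ≤ c * w' i) (x : E) :
    weightedSq V w x ≤ ENNReal.ofReal c * weightedSq V w' x := by
  rw [weightedSq, weightedSq, ← ENNReal.tsum_mul_left]
  refine ENNReal.tsum_le_tsum fun i => ?_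
  rw [← mul_assoc, ← ENNReal.ofReal_mul hc]
  gcongr
  exact h i

theorem weightedSq_add_le (w : ι → ℝ) (x y : E) :
    weightedSq V w (x + y) ≤ 2 * (weightedSq V w x + weightedSq V w y) := by
  simp only [weightedSq, ← ENNReal.tsum_add, ← ENNReal.tsum_mul_left, map_add]
  refine ENNReal.tsum_le_tsum fun i => ?_
  rw [← mul_add, mul_left_comm]
  gcongr
  exact (ENNReal.pow_le_pow_left (enorm_add_le _ _)).trans (ennreal_add_sq_le _ _)

theorem weightedSq_smul (w : ι → ℝ) (t : ℝ) (x : E) :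
    weightedSq V w (t • x) = ‖t‖ₑ ^ 2 * weightedSq V w x := by
  simp only [weightedSq, ← ENNReal.tsum_mul_left, map_smul, enorm_smul, mul_pow, mul_left_comm]

theorem weightedSq_sum (hV : OrthogonalFamily ℝ (fun i => V i) fun i => (V i).subtypeₗᵢ)
    (w : ι → ℝ) (F : Finset ι) (a : ∀ i, V i) :
    weightedSq V w (∑ i ∈ F, (a i : E)) = ∑ i ∈ F, ENNReal.ofReal (w i) * ‖a i‖ₑ ^ 2 := by
  classical
  simp only [weightedSq, starProjection_sum hV]
  rw [tsum_eq_sum (s := F) fun i hi => by simp [hi]]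
  exact Finset.sum_congr rfl fun i hi => by rw [if_pos hi]; rfl

theorem tendsto_weightedSq_partialProj
    (hV : OrthogonalFamily ℝ (fun i => V i) fun i => (V i).subtypeₗᵢ) (w : ι → ℝ) (x : E) :
    Tendsto (fun F : Finset ι => weightedSq V w (partialProj V F x)) atTop
      (𝓝 (weightedSq V w x)) := by
  simp only [partialProj_apply, weightedSq_sum hV]
  exact ENNReal.summable.hasSum

theorem weightedSq_one (hV : OrthogonalFamily ℝ (fun i => V i) fun i => (V i).subtypeₗᵢ)
    {x : E} (hx : x ∈ (⨆ i, V i).topologicalClosure) : weightedSq V 1 x = ‖x‖ₑ ^ 2 := by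
  have h : HasSum (fun i => ENNReal.ofReal 1 * ‖(V i).starProjection x‖ₑ ^ 2) (‖x‖ₑ ^ 2) := by
    have hlim := ((ENNReal.continuous_pow 2).tendsto _).comp (tendsto_partialProj hV hx).enorm
    refine hlim.congr fun F => ?_
    simp only [Function.comp_apply, partialProj_apply, enorm_sum_sq hV, ENNReal.ofReal_one, one_mul]
    rfl
  exact h.tsum_eq

theorem ofReal_mul_enorm_sub_partialProj_sq_le
    (hV : OrthogonalFamily ℝ (fun i => V i) fun i => (V i).subtypeₗᵢ) {w : ι → ℝ} {F : Finset ι}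
    {R : ℝ} (hF : ∀ i ∉ F, R ≤ w i) {x : E}
    (hx : x ∈ (⨆ i, V i).topologicalClosure) :
    ENNReal.ofReal R * ‖x - partialProj V F x‖ₑ ^ 2 ≤ weightedSq V w x := by
  classical
  have hmem : x - partialProj V F x ∈ (⨆ i, V i).topologicalClosure :=
    sub_mem hx (Submodule.le_topologicalClosure _ (partialProj_mem_iSup F x))
  rw [← weightedSq_one hV hmem, weightedSq, ← ENNReal.tsum_mul_left]
  refine ENNReal.tsum_le_tsum fun i => ?_
  rw [map_sub, starProjection_partialProj hV]
  by_cases hi : i ∈ F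
  · simp [hi]
  · simp only [Pi.one_apply, ENNReal.ofReal_one, one_mul, hi, if_false, sub_zero]
    gcongr
    exact hF i hi

theorem weightedSq_inv_sum_smul
    (hV : OrthogonalFamily ℝ (fun i => V i) fun i => (V i).subtypeₗᵢ) {w : ι → ℝ}
    (hw : ∀ i, 0 < w i) (F : Finset ι) (a : ∀ i, V i) :
    weightedSq V w⁻¹ (∑ i ∈ F, ((w i • a i : V i) : E))
      = weightedSq V w (∑ i ∈ F, (a i : E)) := by
  rw [weightedSq_sum hV _ F fun i => w i • a i, weightedSq_sum hV]
  refine Finset.sum_congr rfl fun i _ => ?_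
  rw [enorm_smul, mul_pow, Real.enorm_of_nonneg (hw i).le, ← mul_assoc, sq (ENNReal.ofReal _),
    ← mul_assoc, Pi.inv_apply, ← ENNReal.ofReal_mul (inv_nonneg.2 (hw i).le),
    inv_mul_cancel₀ (hw i).ne', ENNReal.ofReal_one, one_mul]

theorem enorm_inner_sum_smul_starProjection
    (hV : OrthogonalFamily ℝ (fun i => V i) fun i => (V i).subtypeₗᵢ) {w : ι → ℝ}
    (hw : ∀ i, 0 < w i) (F : Finset ι) (x : E) :
    ‖inner ℝ x (∑ i ∈ F, ((w i • (V i).orthogonalProjectionOnto x : V i) : E))‖ₑ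
      = weightedSq V w (partialProj V F x) := by
  have h0 : ∀ i ∈ F, 0 ≤ w i * ‖(V i).orthogonalProjectionOnto x‖ ^ 2 := fun i _ =>
    mul_nonneg (hw i).le (sq_nonneg _)
  rw [partialProj_apply, weightedSq_sum hV,
    inner_sum_right_eq F x fun i => w i • (V i).orthogonalProjectionOnto x]
  simp only [real_inner_smul_right, real_inner_self_eq_norm_sq]
  rw [Real.enorm_of_nonneg (Finset.sum_nonneg h0), ENNReal.ofReal_sum_of_nonneg h0]
  refine Finset.sum_congr rfl fun i _ => ?_
  rw [ENNReal.ofReal_mul (hw i).le, ENNReal.ofReal_pow (norm_nonneg _), ofReal_norm]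

theorem weightedSq_le_of_forall_inner_sq_le
    (hV : OrthogonalFamily ℝ (fun i => V i) fun i => (V i).subtypeₗᵢ) {w : ι → ℝ}
    (hw : ∀ i, 0 < w i) {x : E} {c : ℝ≥0∞}
    (h : ∀ y ∈ ⨆ i, V i, ‖inner ℝ x y‖ₑ ^ 2 ≤ c * weightedSq V w⁻¹ y) :
    weightedSq V w x ≤ c := by
  refine le_of_tendsto (tendsto_weightedSq_partialProj hV w x) (Eventually.of_forall fun F => ?_)
  set S := weightedSq V w (partialProj V F x) with hS
  have hSS : S ^ 2 ≤ c * S := by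
    -- The test vector `∑ w i • E_i x` pairs with `x` to the weighted norm itself.
    have hmem : ∑ i ∈ F, ((w i • (V i).orthogonalProjectionOnto x : V i) : E) ∈ ⨆ i, V i :=
      Submodule.sum_mem _ fun i _ => Submodule.mem_iSup_of_mem i (Subtype.prop _)
    have := h _ hmem
    rwa [enorm_inner_sum_smul_starProjection hV hw F, weightedSq_inv_sum_smul hV hw,
      ← partialProj_apply] at this
  rcases eq_or_ne S 0 with h0 | h0
  · simp [h0]
  · have htop : S ≠ ⊤ := by
      rw [hS, partialProj_apply, weightedSq_sum hV]
      simpa using fun i _ => ENNReal.mul_ne_top ENNReal.ofReal_ne_top (by finiteness)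
    exact (ENNReal.mul_le_mul_iff_left h0 htop).1 (sq S ▸ hSS)

end WeightedNorms

/-! ### Weak solutions of the Lyapunov equation -/

section ExponentialSums

variable {ι E : Type*} [NormedAddCommGroup E] [InnerProductSpace ℝ E] {V : ι → Submodule ℝ E}
  {l : ι → ℝ}

theorem integral_exp_neg_mul_Ioi {c : ℝ} (hc : 0 < c) :
    ∫ t in Ioi (0 : ℝ), Real.exp (-c * t) = c⁻¹ := by
  rw [integral_exp_mul_Ioi (neg_neg_of_pos hc)]
  simp

theorem lintegral_exp_neg_mul_Ioi {c : ℝ} (hc : 0 < c) :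
    ∫⁻ t in Ioi (0 : ℝ), ENNReal.ofReal (Real.exp (-c * t)) = ENNReal.ofReal c⁻¹ := by
  rw [← integral_exp_neg_mul_Ioi hc, ofReal_integral_eq_lintegral_ofReal
    (exp_neg_integrableOn_Ioi 0 hc) (ae_of_all _ fun t => (Real.exp_pos _).le)]

variable (l) in
/-- The solution `∑ i ∈ F, e^{-l i t} a i` at time `t` of the evolution equation whose generator
acts as `-l i` on `V i`, with initial value `∑ i ∈ F, a i`. -/
noncomputable def expSum (F : Finset ι) (a : ∀ i, V i) (t : ℝ) : E :=
  ∑ i ∈ F, ((Real.exp (-l i * t) • a i : V i) : E)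

theorem continuous_expSum (F : Finset ι) (a : ∀ i, V i) : Continuous (expSum l F a) := by
  unfold expSum
  fun_prop

theorem lintegral_enorm_expSum_sq
    (hV : OrthogonalFamily ℝ (fun i => V i) fun i => (V i).subtypeₗᵢ) (hl : ∀ i, 0 < l i)
    (F : Finset ι) (a : ∀ i, V i) :
    ∫⁻ t in Ioi (0 : ℝ), ‖expSum l F a t‖ₑ ^ 2
      = 2⁻¹ * ∑ i ∈ F, ENNReal.ofReal (l i)⁻¹ * ‖a i‖ₑ ^ 2 := by
  have h : ∀ t, ‖expSum l F a t‖ₑ ^ 2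
      = ∑ i ∈ F, ENNReal.ofReal (Real.exp (-(2 * l i) * t)) * ‖a i‖ₑ ^ 2 := by
    intro t
    rw [expSum, enorm_sum_sq hV]
    refine Finset.sum_congr rfl fun i _ => ?_
    rw [enorm_smul, mul_pow, Real.enorm_of_nonneg (Real.exp_pos _).le,
      ← ENNReal.ofReal_pow (Real.exp_pos _).le, ← Real.exp_nat_mul]
    congr 3
    push_cast
    ring_nf
  simp only [h]
  rw [lintegral_finsetSum _ fun i _ => by fun_prop, Finset.mul_sum]
  refine Finset.sum_congr rfl fun i _ => ?_
  rw [lintegral_mul_const _ (by fun_prop), lintegral_exp_neg_mul_Ioi (by linarith [hl i]), mul_inv,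
    ENNReal.ofReal_mul (by norm_num), ENNReal.ofReal_inv_of_pos two_pos, mul_assoc]
  simp

end ExponentialSums

section Lyapunov

variable {ι E : Type*} [NormedAddCommGroup E] [InnerProductSpace ℝ E]

/-- The form `((2P - 1) x | y)` of the reflection in the range of an orthogonal projection `P`. -/
noncomputable def reflForm (P : E →L[ℝ] E) : E →L[ℝ] E →L[ℝ] ℝ :=
  (2 : ℝ) • (innerSL ℝ).bilinearComp P P - innerSL ℝ

theorem reflForm_apply (P : E →L[ℝ] E) (x y : E) :
    reflForm P x y = 2 * inner ℝ (P x) (P y) - inner ℝ x y := rfl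

theorem reflForm_comm (P : E →L[ℝ] E) (x y : E) : reflForm P x y = reflForm P y x := by
  simp only [reflForm_apply, real_inner_comm]

/-- A family of orthogonal subspaces `V i` with closed span `W`, weights `l i > 0` tending to
infinity, an orthogonal projection `P` and a bilinear form `k` bounded in the seminorm `‖P ·‖`
such that `2P - 1` solves the Lyapunov equation `L (2P - 1) + (2P - 1) L = 2k` weakly,
where `L` acts as `l i` on `V i`. -/
structure LyapunovFamily (V : ι → Submodule ℝ E) (W : Submodule ℝ E) (l : ι → ℝ) (P : E →L[ℝ] E)
    (k : E →ₗ[ℝ] E →ₗ[ℝ] ℝ) (C : NNReal) : Prop where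
  orthogonal : OrthogonalFamily ℝ (fun i => V i) fun i => (V i).subtypeₗᵢ
  closure_eq : (⨆ i, V i).topologicalClosure = W
  pos : ∀ i, 0 < l i
  tendsto : Tendsto l cofinite atTop
  projection : (P : E →ₗ[ℝ] E).IsSymmetricProjection
  enorm_le : ∀ x y, ‖k x y‖ₑ ≤ C * (‖P x‖ₑ * ‖P y‖ₑ)
  relation : ∀ i j, ∀ x ∈ V i, ∀ y ∈ V j, (l i + l j) * reflForm P x y = 2 * k x y

namespace LyapunovFamily

variable {V : ι → Submodule ℝ E} {W : Submodule ℝ E} {l : ι → ℝ} {P : E →L[ℝ] E}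
  {k : E →ₗ[ℝ] E →ₗ[ℝ] ℝ} {C : NNReal}

theorem inner_apply_right (h : LyapunovFamily V W l P k C) (x y : E) :
    inner ℝ (P x) y = inner ℝ (P x) (P y) := by
  have h1 : P (P x) = P x := congrArg (fun T : E →ₗ[ℝ] E => T x) h.projection.isIdempotentElem
  conv_lhs => rw [← h1]
  exact h.projection.isSymmetric (P x) y

theorem norm_apply_le (h : LyapunovFamily V W l P k C) (x : E) : ‖P x‖ ≤ ‖x‖ := by
  have h1 := real_inner_le_norm (P x) x
  rw [h.inner_apply_right, real_inner_self_eq_norm_sq, sq] at h1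
  rcases (norm_nonneg (P x)).eq_or_lt with h0 | h0
  · exact h0 ▸ norm_nonneg x
  · exact le_of_mul_le_mul_left h1 h0

theorem enorm_form_le (h : LyapunovFamily V W l P k C) (x y : E) :
    ‖k x y‖ₑ ≤ C * (‖x‖ₑ * ‖y‖ₑ) := by
  have hP : ∀ x, ‖P x‖ₑ ≤ ‖x‖ₑ := fun x => enorm_le_iff_norm_le.2 (h.norm_apply_le x)
  refine (h.enorm_le x y).trans ?_
  gcongr <;> exact hP _

theorem exists_gap (h : LyapunovFamily V W l P k C) : ∃ δ, 0 < δ ∧ ∀ i, δ ≤ l i := by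
  cases isEmpty_or_nonempty ι
  · exact ⟨1, one_pos, isEmptyElim⟩
  · obtain ⟨i, hi⟩ := h.tendsto.exists_forall_le
    exact ⟨l i, h.pos i, hi⟩

/-- The solution of the Lyapunov equation as an integral: `(l i + l j)⁻¹ = ∫ e^{-(l i + l j) t} dt`
on `V i × V j`. -/
theorem reflForm_sum_eq_integral (h : LyapunovFamily V W l P k C) (F : Finset ι) (a b : ∀ i, V i) :
    reflForm P (∑ i ∈ F, (a i : E)) (∑ i ∈ F, (b i : E))
      = ∫ t in Ioi (0 : ℝ), 2 * k (expSum l F a t) (expSum l F b t) := by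
  have hpos : ∀ i j, 0 < l i + l j := fun i j => add_pos (h.pos i) (h.pos j)
  have hint : ∀ i j, IntegrableOn
      (fun t : ℝ => 2 * k (a i) (b j) * Real.exp (-(l i + l j) * t)) (Ioi 0) := fun i j =>
    (exp_neg_integrableOn_Ioi 0 (hpos i j)).const_mul _
  have hterm : ∀ i j, reflForm P (a i : E) (b j : E)
      = ∫ t in Ioi (0 : ℝ), 2 * k (a i) (b j) * Real.exp (-(l i + l j) * t) := by
    intro i j
    rw [integral_const_mul, integral_exp_neg_mul_Ioi (hpos i j),
      ← h.relation i j _ (a i).2 _ (b j).2, mul_right_comm, mul_inv_cancel₀ (hpos i j).ne', one_mul]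
  have hexp : ∀ t, 2 * k (expSum l F a t) (expSum l F b t)
      = ∑ i ∈ F, ∑ j ∈ F, 2 * k (a i) (b j) * Real.exp (-(l i + l j) * t) := by
    intro t
    simp only [expSum, Submodule.coe_smul, map_sum, map_smul, LinearMap.sum_apply,
      LinearMap.smul_apply, smul_eq_mul, Finset.mul_sum, neg_add, add_mul, Real.exp_add]
    rw [Finset.sum_comm]
    exact Finset.sum_congr rfl fun i _ => Finset.sum_congr rfl fun j _ => by ring
  simp only [hexp]
  rw [integral_finsetSum _ fun i _ => integrable_finsetSum _ fun j _ => hint i j]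
  simp only [map_sum, sum_apply, integral_finsetSum _ fun j _ => hint _ j, hterm]
  exact Finset.sum_comm

theorem enorm_reflForm_sum_sq_le (h : LyapunovFamily V W l P k C) (F : Finset ι)
    (a b : ∀ i, V i) :
    ‖reflForm P (∑ i ∈ F, (a i : E)) (∑ i ∈ F, (b i : E))‖ₑ ^ 2
      ≤ C ^ 2 * (∑ i ∈ F, ENNReal.ofReal (l i)⁻¹ * ‖a i‖ₑ ^ 2)
        * ∑ i ∈ F, ENNReal.ofReal (l i)⁻¹ * ‖b i‖ₑ ^ 2 := by
  have hmeas : ∀ a : ∀ i, V i, Measurable fun t => ‖expSum l F a t‖ₑ := fun a =>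
    (continuous_expSum F a).enorm.measurable
  have hint : ‖reflForm P (∑ i ∈ F, (a i : E)) (∑ i ∈ F, (b i : E))‖ₑ
      ≤ 2 * C * ∫⁻ t in Ioi (0 : ℝ), ‖expSum l F a t‖ₑ * ‖expSum l F b t‖ₑ := by
    rw [h.reflForm_sum_eq_integral,
      ← lintegral_const_mul (2 * C : ℝ≥0∞) (f := fun t => ‖expSum l F a t‖ₑ * ‖expSum l F b t‖ₑ)
        ((hmeas a).mul (hmeas b))]
    refine (enorm_integral_le_lintegral_enorm _).trans (lintegral_mono fun t => ?_)
    rw [enorm_mul, mul_assoc]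
    gcongr
    · simp [Real.enorm_eq_ofReal_abs]
    · exact h.enorm_form_le _ _
  refine (ENNReal.pow_le_pow_left hint).trans ?_
  rw [mul_pow]
  calc _ ≤ (2 * C) ^ 2 * ((∫⁻ t in Ioi (0 : ℝ), ‖expSum l F a t‖ₑ ^ 2)
        * ∫⁻ t in Ioi (0 : ℝ), ‖expSum l F b t‖ₑ ^ 2) := by
        gcongr
        exact sq_lintegral_mul_le (hmeas a).aemeasurable (hmeas b).aemeasurable
    _ = (2 * 2⁻¹) ^ 2 * (C ^ 2 * (∑ i ∈ F, ENNReal.ofReal (l i)⁻¹ * ‖a i‖ₑ ^ 2)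
        * ∑ i ∈ F, ENNReal.ofReal (l i)⁻¹ * ‖b i‖ₑ ^ 2) := by
        rw [lintegral_enorm_expSum_sq h.orthogonal h.pos,
          lintegral_enorm_expSum_sq h.orthogonal h.pos]
        ring
    _ = _ := by rw [ENNReal.mul_inv_cancel two_ne_zero ENNReal.ofNat_ne_top, one_pow, one_mul]

theorem reflForm_sum_smul (h : LyapunovFamily V W l P k C) (F : Finset ι) (a : ∀ i, V i) :
    reflForm P (∑ i ∈ F, (a i : E)) (∑ i ∈ F, ((l i • a i : V i) : E))
      = k (∑ i ∈ F, (a i : E)) (∑ i ∈ F, (a i : E)) := by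
  set J : ι → ι → ℝ := fun i j => reflForm P (a i : E) (a j : E) with hJ
  have hleft : reflForm P (∑ i ∈ F, (a i : E)) (∑ i ∈ F, ((l i • a i : V i) : E))
      = ∑ i ∈ F, ∑ j ∈ F, l i * J i j := by
    simp only [hJ, Submodule.coe_smul, map_sum, map_smul, sum_apply, smul_eq_mul, Finset.mul_sum,
      reflForm_comm P (a _ : E) (a _ : E)]
  have hsymm : ∑ i ∈ F, ∑ j ∈ F, l i * J i j = ∑ i ∈ F, ∑ j ∈ F, l j * J i j := by
    rw [Finset.sum_comm]
    simp only [hJ, reflForm_comm P (a _ : E) (a _ : E)]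
  have hright : 2 * k (∑ i ∈ F, (a i : E)) (∑ i ∈ F, (a i : E))
      = ∑ i ∈ F, ∑ j ∈ F, (l i + l j) * J i j := by
    simp only [map_sum, LinearMap.sum_apply, Finset.mul_sum]
    rw [Finset.sum_comm]
    exact Finset.sum_congr rfl fun i _ => Finset.sum_congr rfl fun j _ =>
      (h.relation i j _ (a i).2 _ (a j).2).symm
  simp only [add_mul, Finset.sum_add_distrib, ← hsymm, ← hleft] at hright
  linarith

theorem le_closedSpan (h : LyapunovFamily V W l P k C) (i : ι) : V i ≤ W :=
  h.closure_eq ▸ (le_iSup V i).trans (Submodule.le_topologicalClosure _)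

variable [∀ i, (V i).HasOrthogonalProjection]

theorem tendsto_partialProj (h : LyapunovFamily V W l P k C) {x : E} (hx : x ∈ W) :
    Tendsto (fun F : Finset ι => partialProj V F x) atTop (𝓝 x) :=
  Graetz.tendsto_partialProj h.orthogonal (h.closure_eq ▸ hx)

theorem partialProj_mem (h : LyapunovFamily V W l P k C) (F : Finset ι) (x : E) :
    partialProj V F x ∈ W :=
  h.closure_eq ▸ Submodule.le_topologicalClosure _ (partialProj_mem_iSup F x)

theorem enorm_reflForm_sq_le (h : LyapunovFamily V W l P k C) {x y : E} (hx : x ∈ W) (hy : y ∈ W) :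
    ‖reflForm P x y‖ₑ ^ 2 ≤ C ^ 2 * weightedSq V l⁻¹ x * weightedSq V l⁻¹ y := by
  have hcont : Continuous fun p : E × E => ‖reflForm P p.1 p.2‖ₑ ^ 2 :=
    (ENNReal.continuous_pow 2).comp (reflForm P).continuous₂.enorm
  have hlim := (hcont.tendsto (x, y)).comp
    ((h.tendsto_partialProj hx).prodMk_nhds (h.tendsto_partialProj hy))
  refine le_of_tendsto hlim (Eventually.of_forall fun F => ?_)
  simp only [Function.comp_apply, partialProj_apply]
  refine (h.enorm_reflForm_sum_sq_le F _ _).trans ?_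
  gcongr <;> exact ENNReal.sum_le_tsum F

theorem exists_weightedSq_inv_le (h : LyapunovFamily V W l P k C) : ∃ K : NNReal,
    (∀ x ∈ W, weightedSq V l⁻¹ x ≤ K * ‖x‖ₑ ^ 2) ∧ ∀ x ∈ W, ‖x‖ₑ ^ 2 ≤ K * weightedSq V l x := by
  obtain ⟨δ, hδ, hgap⟩ := h.exists_gap
  refine ⟨δ⁻¹.toNNReal, fun x hx => ?_, fun x hx => ?_⟩ <;>
    rw [← weightedSq_one h.orthogonal (h.closure_eq ▸ hx)] <;>
    refine weightedSq_le_mul (by positivity) (fun i => ?_) x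
  · simpa using inv_anti₀ hδ (hgap i)
  · simpa using (one_le_inv_mul₀ hδ).2 (hgap i)

/-- On the diagonal the Lyapunov equation expresses `‖x‖_{1/2}²` by the form `k`, which vanishes
where `P` does. It has to be truncated, since `x` need not be in the domain of `L`. -/
theorem sq_weightedSq_partialProj_le (h : LyapunovFamily V W l P k C) {x : E} (hx : x ∈ W)
    (hP : P x = 0) (F : Finset ι) :
    weightedSq V l (partialProj V F x) ^ 2
      ≤ 2 * ((C ^ 2 * weightedSq V l⁻¹ (x - partialProj V F x)
          * weightedSq V l (partialProj V F x))
        + (C * (‖P (partialProj V F x)‖ₑ * ‖P (partialProj V F x)‖ₑ)) ^ 2) := by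
  set a : ∀ i, V i := fun i => l i • (V i).orthogonalProjectionOnto x
  have hmem : ∑ i ∈ F, (a i : E) ∈ W := sum_mem fun i _ => h.le_closedSpan i (a i).2
  have hsplit : -inner ℝ x (∑ i ∈ F, (a i : E))
      = reflForm P (x - partialProj V F x) (∑ i ∈ F, (a i : E))
        + k (partialProj V F x) (partialProj V F x) := by
    rw [partialProj_apply, ← h.reflForm_sum_smul, ← add_apply, ← map_add, sub_add_cancel,
      reflForm_apply, hP, inner_zero_left, mul_zero, zero_sub]
  have hJ := h.enorm_reflForm_sq_le (sub_mem hx (h.partialProj_mem F x)) hmem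
  rw [weightedSq_inv_sum_smul h.orthogonal h.pos, ← partialProj_apply] at hJ
  have hself := enorm_inner_sum_smul_starProjection h.orthogonal h.pos F x
  rw [← enorm_neg, hsplit] at hself
  nth_rw 1 [← hself]
  refine (ENNReal.pow_le_pow_left (enorm_add_le _ _)).trans ((ennreal_add_sq_le _ _).trans ?_)
  gcongr
  · exact h.enorm_le _ _

end LyapunovFamily

end Lyapunov

section Compression

variable {E : Type*} [NormedAddCommGroup E] [InnerProductSpace ℝ E]

/-- The compression of the operator `P` to the subspace `W`. -/
noncomputable def compress (P : E →L[ℝ] E) (W : Submodule ℝ E) [W.HasOrthogonalProjection] :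
    W →L[ℝ] W :=
  W.orthogonalProjectionOnto ∘L P ∘L W.subtypeL

/-- The compression of the reflection `2P - 1` to the subspace `W`. -/
noncomputable def reflCompress (P : E →L[ℝ] E) (W : Submodule ℝ E) [W.HasOrthogonalProjection] :
    W →L[ℝ] W :=
  (2 : ℝ) • compress P W - ContinuousLinearMap.id ℝ W

theorem isSelfAdjoint_inverse [CompleteSpace E] {T : E →L[ℝ] E} (hT : IsSelfAdjoint T) :
    IsSelfAdjoint T.inverse := by
  rw [← ContinuousLinearMap.ringInverse_eq_inverse]
  exact hT.ringInverse

variable {P : E →L[ℝ] E} {W : Submodule ℝ E} [W.HasOrthogonalProjection]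

theorem reflCompress_apply (x : W) : reflCompress P W x = (2 : ℝ) • compress P W x - x := rfl

theorem inner_compress_left (x y : W) : inner ℝ (compress P W x) y = inner ℝ (P x) (y : E) :=
  Submodule.inner_orthogonalProjectionOnto_eq_of_mem_right y (P x)

namespace LyapunovFamily

variable {ι : Type*} {V : ι → Submodule ℝ E} {l : ι → ℝ} {k : E →ₗ[ℝ] E →ₗ[ℝ] ℝ} {C : NNReal}

theorem inner_reflCompress_left (h : LyapunovFamily V W l P k C) (x y : W) :
    inner ℝ (reflCompress P W x) y = reflForm P (x : E) (y : E) := by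
  rw [reflCompress_apply, inner_sub_left, real_inner_smul_left, inner_compress_left,
    h.inner_apply_right]
  rfl

section Smoothing

variable [∀ i, (V i).HasOrthogonalProjection]

theorem exists_weightedSq_reflCompress_le (h : LyapunovFamily V W l P k C) :
    ∃ K : NNReal, ∀ x : W, weightedSq V l (reflCompress P W x : E) ≤ K * ‖x‖ₑ ^ 2 := by
  obtain ⟨K, hK, -⟩ := h.exists_weightedSq_inv_le
  refine ⟨C ^ 2 * K, fun x => ?_⟩
  refine weightedSq_le_of_forall_inner_sq_le h.orthogonal h.pos fun y hy => ?_
  lift y to W using h.closure_eq ▸ Submodule.le_topologicalClosure _ hy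
  have hJ := h.enorm_reflForm_sq_le x.2 y.2
  rw [← h.inner_reflCompress_left] at hJ
  refine hJ.trans ?_
  rw [ENNReal.coe_mul, ENNReal.coe_pow, mul_assoc (_ ^ 2) (K : ℝ≥0∞)]
  gcongr
  exact hK x x.2

theorem weightedSq_ne_top_of_apply_eq_zero (h : LyapunovFamily V W l P k C) {x : E} (hx : x ∈ W)
    (hP : P x = 0) : weightedSq V l x ≠ ⊤ := by
  obtain ⟨K, hK⟩ := h.exists_weightedSq_reflCompress_le
  have hT : reflCompress P W (-⟨x, hx⟩) = ⟨x, hx⟩ := by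
    simp [reflCompress_apply, compress, hP]
  have := hK (-⟨x, hx⟩)
  rw [hT] at this
  exact ne_top_of_le_ne_top (by finiteness) this

theorem eq_zero_of_apply_eq_zero (h : LyapunovFamily V W l P k C) {x : E} (hx : x ∈ W)
    (hP : P x = 0) : x = 0 := by
  obtain ⟨K, hinv, hnorm⟩ := h.exists_weightedSq_inv_le
  have hfin := h.weightedSq_ne_top_of_apply_eq_zero hx hP
  have hx_F := h.tendsto_partialProj hx
  have hS := tendsto_weightedSq_partialProj h.orthogonal l x
  have hsub : Tendsto (fun F => weightedSq V l⁻¹ (x - partialProj V F x)) atTop (𝓝 0) := by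
    have hlim : Tendsto (fun F => (K : ℝ≥0∞) * ‖x - partialProj V F x‖ₑ ^ 2) atTop (𝓝 0) := by
      have := ENNReal.Tendsto.pow (n := 2) (hx_F.const_sub x).enorm
      rw [sub_self, enorm_zero, zero_pow two_ne_zero] at this
      simpa using
        ENNReal.Tendsto.const_mul (a := (K : ℝ≥0∞)) this (Or.inr ENNReal.coe_ne_top)
    exact tendsto_of_tendsto_of_tendsto_of_le_of_le tendsto_const_nhds hlim
      (fun _ => zero_le) fun F => hinv _ (sub_mem hx (h.partialProj_mem F x))
  have hP_F : Tendsto (fun F => ‖P (partialProj V F x)‖ₑ) atTop (𝓝 0) := by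
    simpa [hP] using ((P.continuous.tendsto x).comp hx_F).enorm
  have hzero : weightedSq V l x ^ 2 ≤ 0 := by
    refine le_of_tendsto_of_tendsto' (ENNReal.Tendsto.pow hS) ?_
      (h.sq_weightedSq_partialProj_le hx hP)
    have hC : ((C : ℝ≥0∞) ^ 2) ≠ ⊤ := by finiteness
    have h1 := ENNReal.Tendsto.mul (ENNReal.Tendsto.const_mul hsub (Or.inr hC))
      (Or.inr hfin) hS (Or.inr (by simp))
    have h2 := ENNReal.Tendsto.const_mul (a := (C : ℝ≥0∞))
      (ENNReal.Tendsto.mul hP_F (by simp) hP_F (by simp)) (Or.inr ENNReal.coe_ne_top)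
    simpa using ENNReal.Tendsto.const_mul (a := 2) (h1.add (ENNReal.Tendsto.pow (n := 2) h2))
      (Or.inr (by simp))
  have := hnorm x hx
  simpa [(pow_eq_zero_iff two_ne_zero).1 (le_zero_iff.1 hzero)] using this

theorem compress_injective (h : LyapunovFamily V W l P k C) :
    Function.Injective (compress P W) := by
  refine (injective_iff_map_eq_zero _).2 fun x hx => Subtype.ext ?_
  refine h.eq_zero_of_apply_eq_zero x.2 (inner_self_eq_zero (𝕜 := ℝ).1 ?_)
  rw [← h.inner_apply_right, ← inner_compress_left, hx, inner_zero_left]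

theorem eventually_norm_sub_partialProj_le (h : LyapunovFamily V W l P k C) {ε : ℝ}
    (hε : 0 < ε) :
    ∀ᶠ F in atTop, ∀ x : W,
      ‖(reflCompress P W x : E) - partialProj V F (reflCompress P W x : E)‖ ≤ ε * ‖x‖ := by
  obtain ⟨K, hK⟩ := h.exists_weightedSq_reflCompress_le
  set R : ℝ := (K + 1) / ε ^ 2 with hR
  have hRpos : 0 < R := by positivity
  have hbelow : {i | ¬ R ≤ l i}.Finite := h.tendsto.eventually_ge_atTop R
  filter_upwards [eventually_ge_atTop hbelow.toFinset] with F hF x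
  have hRF : ∀ i ∉ F, R ≤ l i := fun i hi => by
    by_contra hlt
    exact hi (hF (hbelow.mem_toFinset.2 hlt))
  have htail := (ofReal_mul_enorm_sub_partialProj_sq_le h.orthogonal hRF
    (h.closure_eq ▸ (reflCompress P W x).2)).trans (hK x)
  rw [← ofReal_norm, ← ofReal_norm, ← ENNReal.ofReal_coe_nnreal,
    ← ENNReal.ofReal_pow (norm_nonneg _), ← ENNReal.ofReal_pow (norm_nonneg _),
    ← ENNReal.ofReal_mul hRpos.le, ← ENNReal.ofReal_mul K.coe_nonneg] at htail
  rw [ENNReal.ofReal_le_ofReal_iff (by positivity)] at htail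
  refine le_of_sq_le_sq ?_ (by positivity)
  rw [← mul_le_mul_iff_right₀ hRpos]
  refine htail.trans ?_
  have : R * (ε * ‖x‖) ^ 2 = (K + 1) * ‖x‖ ^ 2 := by
    rw [hR]; field_simp
  rw [this]
  gcongr
  exact le_add_of_nonneg_right zero_le_one

theorem isCompactOperator_reflCompress [CompleteSpace E] [∀ i, FiniteDimensional ℝ (V i)]
    (h : LyapunovFamily V W l P k C) : IsCompactOperator (reflCompress P W) := by
  have hWc : IsClosed (W : Set E) := h.closure_eq ▸ Submodule.isClosed_topologicalClosure _
  suffices hc : IsCompactOperator (W.subtypeL ∘L reflCompress P W) from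
    hc.codRestrict (fun x => (reflCompress P W x).2) hWc
  refine isCompactOperator_of_tendsto (l := atTop)
    (F := fun F : Finset ι => partialProj V F ∘L W.subtypeL ∘L reflCompress P W) ?_
    (Eventually.of_forall fun F => (isCompactOperator_partialProj F).comp_clm _)
  refine Metric.tendsto_nhds.2 fun ε hε => ?_
  filter_upwards [h.eventually_norm_sub_partialProj_le (half_pos hε)] with F hF
  rw [dist_comm, dist_eq_norm]
  exact (ContinuousLinearMap.opNorm_le_bound _ (half_pos hε).le hF).trans_lt (half_lt_self hε)

/-- Fredholm alternative: `2 • compress P W` is a compact perturbation of the identity. -/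
theorem isInvertible_compress [CompleteSpace E] [∀ i, FiniteDimensional ℝ (V i)]
    (h : LyapunovFamily V W l P k C) : (compress P W).IsInvertible := by
  have hWc : IsClosed (W : Set E) := h.closure_eq ▸ Submodule.isClosed_topologicalClosure _
  have : CompleteSpace W := hWc.completeSpace_coe
  have hunit : IsUnit (algebraMap ℝ (W →L[ℝ] W) (-1) - reflCompress P W) := by
    rcases h.isCompactOperator_reflCompress.hasEigenvalue_or_mem_resolventSet (μ := -1)
      (by norm_num) with he | he
    · obtain ⟨x, hx⟩ := he.exists_hasEigenvector
      have hTx : (2 : ℝ) • compress P W x - x = (-1 : ℝ) • x := hx.apply_eq_smul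
      rw [neg_one_smul, sub_eq_neg_self, smul_eq_zero_iff_right two_ne_zero] at hTx
      exact absurd (h.compress_injective (hTx.trans (map_zero _).symm)) hx.2
    · exact he
  have hsmul : algebraMap ℝ (W →L[ℝ] W) (-1) - reflCompress P W = (-2 : ℝ) • compress P W := by
    rw [Algebra.algebraMap_eq_smul_one, reflCompress, ContinuousLinearMap.one_def]
    module
  have hcompress : IsUnit (compress P W) := by
    have := ((IsUnit.mk0 (-2 : ℝ)⁻¹ (by norm_num)).map (algebraMap ℝ (W →L[ℝ] W))).mul hunit
    rwa [hsmul, ← Algebra.smul_def, inv_smul_smul₀ (by norm_num)] at this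
  obtain ⟨u, hu⟩ := hcompress
  exact ⟨ContinuousLinearEquiv.unitsEquiv ℝ W u, hu⟩

theorem exists_weightedSq_le_weightedSq_compress [CompleteSpace E]
    [∀ i, FiniteDimensional ℝ (V i)] (h : LyapunovFamily V W l P k C) :
    ∃ M : NNReal, ∀ x : W, weightedSq V l (x : E) ≤ M * weightedSq V l (compress P W x : E) := by
  obtain ⟨K, hK⟩ := h.exists_weightedSq_reflCompress_le
  obtain ⟨K₁, -, hnorm⟩ := h.exists_weightedSq_inv_le
  obtain ⟨e, he⟩ := h.isInvertible_compress
  set M := ‖(e.symm : W →L[ℝ] W)‖₊ with hM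
  refine ⟨2 * (4 + K * M ^ 2 * K₁), fun x => ?_⟩
  set y := compress P W x with hy
  have hxy : ‖x‖ₑ ≤ M * ‖y‖ₑ := by
    simpa [hy, ← he, hM, enorm_eq_nnnorm] using (e.symm : W →L[ℝ] W).le_opENorm (e x)
  calc weightedSq V l (x : E)
      = weightedSq V l ((2 : ℝ) • (y : E) + (-1 : ℝ) • (reflCompress P W x : E)) := by
        congr 1
        rw [reflCompress_apply]
        push_cast
        module
    _ ≤ 2 * (4 * weightedSq V l (y : E) + K * (M ^ 2 * (K₁ * weightedSq V l (y : E)))) := by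
        have h2 : ‖(2 : ℝ)‖ₑ ^ 2 = 4 := by
          rw [Real.enorm_of_nonneg zero_le_two, ENNReal.ofReal_ofNat]; norm_num
        refine (weightedSq_add_le _ _ _).trans ?_
        rw [weightedSq_smul, weightedSq_smul, enorm_neg, enorm_one, one_pow, one_mul, h2]
        gcongr
        refine (hK x).trans ?_
        gcongr
        refine (ENNReal.pow_le_pow_left hxy).trans ?_
        rw [mul_pow]
        gcongr
        exact hnorm _ y.2
    _ = _ := by push_cast; ring

end Smoothing
end LyapunovFamily
end Compression

/-! ### Estimates at a Lipschitz boundary -/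

section Segments

variable {E : Type*} [NormedAddCommGroup E]

theorem enorm_sub_sq_le_setLIntegral_deriv [NormedSpace ℝ E] [CompleteSpace E] {u : ℝ → E}
    (hu : ContDiff ℝ 1 u) {a b s t : ℝ} (hs : s ∈ Icc a b) (ht : t ∈ Icc a b) :
    ‖u t - u s‖ₑ ^ 2 ≤ ENNReal.ofReal (b - a) * ∫⁻ r in Ioo a b, ‖deriv u r‖ₑ ^ 2 := by
  have hcont : Continuous (deriv u) := hu.continuous_deriv le_rfl
  have hftc : u t - u s = ∫ r in s..t, deriv u r :=
    (intervalIntegral.integral_deriv_eq_sub (fun r _ => (hu.differentiable one_ne_zero) r)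
      (hcont.intervalIntegrable _ _)).symm
  have hsub : uIoc s t ⊆ Icc a b := uIoc_subset_uIcc.trans (uIcc_subset_Icc hs ht)
  have hnorm : ‖u t - u s‖ₑ ≤ ∫⁻ r in Ioo a b, 1 * ‖deriv u r‖ₑ := by
    rw [hftc, ← ofReal_norm, intervalIntegral.norm_intervalIntegral_eq, ofReal_norm,
      Measure.restrict_congr_set Ioo_ae_eq_Icc]
    simp only [one_mul]
    exact (enorm_integral_le_lintegral_enorm _).trans (lintegral_mono_set hsub)
  calc ‖u t - u s‖ₑ ^ 2 ≤ (∫⁻ r in Ioo a b, 1 * ‖deriv u r‖ₑ) ^ 2 := by gcongr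
    _ ≤ _ := sq_lintegral_mul_le aemeasurable_const hcont.enorm.measurable.aemeasurable
    _ = _ := by simp

theorem enorm_sq_le_setLIntegral [NormedSpace ℝ E] [CompleteSpace E] {u : ℝ → E}
    (hu : ContDiff ℝ 1 u) {ρ t : ℝ} (hρ : 0 < ρ) (ht : t ∈ Icc 0 ρ) :
    ‖u t‖ₑ ^ 2
      ≤ ENNReal.ofReal (2 / ρ + 2 * ρ) * ∫⁻ r in Ioo 0 ρ, (‖u r‖ₑ ^ 2 + ‖deriv u r‖ₑ ^ 2) := by
  have hum : Measurable fun r => ‖u r‖ₑ ^ 2 := hu.continuous.enorm.measurable.pow_const 2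
  set A := ∫⁻ r in Ioo 0 ρ, ‖u r‖ₑ ^ 2 with hA
  set B := ∫⁻ r in Ioo 0 ρ, ‖deriv u r‖ₑ ^ 2 with hB
  have hpt : ∀ s ∈ Ioo 0 ρ, ‖u t‖ₑ ^ 2 ≤ 2 * ‖u s‖ₑ ^ 2 + 2 * (ENNReal.ofReal ρ * B) := by
    intro s hs
    have hdiff := enorm_sub_sq_le_setLIntegral_deriv hu (Ioo_subset_Icc_self hs) ht
    rw [sub_zero] at hdiff
    calc ‖u t‖ₑ ^ 2 = ‖u s + (u t - u s)‖ₑ ^ 2 := by rw [add_sub_cancel]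
      _ ≤ (‖u s‖ₑ + ‖u t - u s‖ₑ) ^ 2 := by gcongr; exact enorm_add_le _ _
      _ ≤ 2 * (‖u s‖ₑ ^ 2 + ‖u t - u s‖ₑ ^ 2) := ennreal_add_sq_le _ _
      _ ≤ _ := by rw [mul_add]; gcongr
  have hmean : ENNReal.ofReal ρ * ‖u t‖ₑ ^ 2
      ≤ 2 * A + 2 * (ENNReal.ofReal ρ * B) * ENNReal.ofReal ρ := by
    calc _ = ∫⁻ _ in Ioo 0 ρ, ‖u t‖ₑ ^ 2 := by simp [mul_comm]
      _ ≤ ∫⁻ s in Ioo 0 ρ, (2 * ‖u s‖ₑ ^ 2 + 2 * (ENNReal.ofReal ρ * B)) :=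
        setLIntegral_mono' measurableSet_Ioo hpt
      _ = _ := by
        rw [lintegral_add_left (hum.const_mul 2), lintegral_const_mul _ hum]
        simp [hA]
  have hρ' : ENNReal.ofReal ρ ≠ 0 := by simpa using hρ
  rw [lintegral_add_left hum, ← hA, ← hB, ← ENNReal.mul_le_mul_iff_right hρ' ENNReal.ofReal_ne_top]
  refine hmean.trans ?_
  have hcoeff : ENNReal.ofReal ρ * ENNReal.ofReal (2 / ρ + 2 * ρ)
      = 2 + 2 * ENNReal.ofReal ρ ^ 2 := by
    rw [← ENNReal.ofReal_mul hρ.le, ← ENNReal.ofReal_pow hρ.le, ← ENNReal.ofReal_ofNat 2,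
      ← ENNReal.ofReal_mul zero_le_two, ← ENNReal.ofReal_add zero_le_two (by positivity)]
    congr 1
    field_simp
  calc _ = 2 * A + 2 * ENNReal.ofReal ρ ^ 2 * B := by ring
    _ ≤ (2 + 2 * ENNReal.ofReal ρ ^ 2) * A + (2 + 2 * ENNReal.ofReal ρ ^ 2) * B := by
      gcongr
      · exact le_self_add
      · exact le_add_self
    _ = _ := by rw [← mul_add, ← hcoeff, mul_assoc]

variable [InnerProductSpace ℝ E] {f : E → ℝ}

theorem contDiff_comp_segment (hf : ContDiff ℝ ∞ f) (x v : E) :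
    ContDiff ℝ 1 fun r : ℝ => f (x + r • v) :=
  (hf.of_le (by simp)).comp (by fun_prop)

variable [CompleteSpace E]

theorem enorm_gradient (f : E → ℝ) (x : E) : ‖gradient f x‖ₑ = ‖fderiv ℝ f x‖ₑ := by
  rw [← ofReal_norm, ← ofReal_norm, gradient, LinearIsometryEquiv.norm_map]

theorem continuous_gradient (hf : ContDiff ℝ ∞ f) : Continuous (gradient f) :=
  (InnerProductSpace.toDual ℝ E).symm.continuous.comp (hf.continuous_fderiv (by simp))

theorem enorm_deriv_comp_segment_le (hf : ContDiff ℝ ∞ f) (x v : E) (r : ℝ) :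
    ‖deriv (fun r : ℝ => f (x + r • v)) r‖ₑ ≤ ‖gradient f (x + r • v)‖ₑ * ‖v‖ₑ := by
  have hline : HasDerivAt (fun r : ℝ => x + r • v) v r := by
    simpa using ((hasDerivAt_id r).smul_const v).const_add x
  have hderiv := ((hf.differentiable (by simp)) _).hasFDerivAt.comp_hasDerivAt r hline
  rw [enorm_gradient]
  exact (congrArg _ hderiv.deriv).trans_le (ContinuousLinearMap.le_opENorm _ _)

theorem enorm_sub_sq_le_lintegral_gradient (hf : ContDiff ℝ ∞ f) (x y : E) :
    ‖f x - f y‖ₑ ^ 2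
      ≤ edist x y ^ 2 * ∫⁻ t in Ioo (0 : ℝ) 1, ‖gradient f (y + t • (x - y))‖ₑ ^ 2 := by
  have hsq := enorm_sub_sq_le_setLIntegral_deriv (contDiff_comp_segment hf y (x - y))
    (left_mem_Icc.2 zero_le_one) (right_mem_Icc.2 zero_le_one)
  simp only [one_smul, add_sub_cancel, zero_smul, add_zero, sub_zero, ENNReal.ofReal_one,
    one_mul] at hsq
  rw [edist_eq_enorm_sub, ← lintegral_const_mul' _ _ (ENNReal.pow_ne_top enorm_ne_top)]
  refine hsq.trans (lintegral_mono fun t => ?_)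
  rw [← mul_pow, mul_comm]
  gcongr
  exact enorm_deriv_comp_segment_le hf y (x - y) t

end Segments

/-- The square of the norm of `f` in `H¹(Ω)`. -/
noncomputable def sobolevSq (Ω : Set Plane) (f : Plane → ℝ) : ℝ≥0∞ :=
  ∫⁻ x in Ω, (‖f x‖ₑ ^ 2 + ‖gradient f x‖ₑ ^ 2)

theorem lintegral_hausdorffMeasure_le_of_lipschitz {X : Type*} [MetricSpace X]
    [MeasurableSpace X] [BorelSpace X] {φ : ℝ → X} {K : NNReal} (hφ : LipschitzWith K φ)
    {A : Set X} {I : Set ℝ} (hA : A ⊆ φ '' I) {g : X → ℝ≥0∞} (hg : Measurable g) :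
    ∫⁻ x in A, g x ∂(Measure.hausdorffMeasure 1) ≤ K * ∫⁻ y in I, g (φ y) := by
  have hφm := hφ.continuous.measurable
  have hle : (Measure.hausdorffMeasure 1).restrict A
      ≤ (K : ℝ≥0∞) • Measure.map φ (volume.restrict I) := by
    refine Measure.le_intro fun s hs _ => ?_
    rw [Measure.restrict_apply hs, Measure.smul_apply, Measure.map_apply hφm hs,
      Measure.restrict_apply (hφm hs), smul_eq_mul]
    have hsub : s ∩ A ⊆ φ '' (φ ⁻¹' s ∩ I) := by
      rintro x ⟨hx, hxA⟩
      obtain ⟨y, hy, rfl⟩ := hA hxA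
      exact ⟨y, ⟨hx, hy⟩, rfl⟩
    calc Measure.hausdorffMeasure 1 (s ∩ A)
        ≤ (K : ℝ≥0∞) ^ (1 : ℝ) * Measure.hausdorffMeasure 1 (φ ⁻¹' s ∩ I) :=
          (measure_mono hsub).trans (hφ.hausdorffMeasure_image_le zero_le_one _)
      _ = _ := by rw [hausdorffMeasure_real, ENNReal.rpow_one]
  refine (lintegral_mono' hle le_rfl).trans_eq ?_
  rw [lintegral_smul_measure, lintegral_map hg hφm, smul_eq_mul]

theorem eq_zero_of_mem_frontier {X : Type*} [TopologicalSpace X] {Ω U : Set X} (hΩ : IsOpen Ω)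
    (hU : IsOpen U) {g : X → ℝ} (hg : Continuous g) (h : ∀ x ∈ U, x ∈ Ω ↔ 0 < g x) {x : X}
    (hx : x ∈ frontier Ω) (hxU : x ∈ U) : g x = 0 := by
  rw [hΩ.frontier_eq] at hx
  refine le_antisymm (not_lt.1 fun hpos => hx.2 ((h x hxU).2 hpos)) (not_lt.1 fun hneg => ?_)
  obtain ⟨y, hy, hyΩ⟩ :=
    mem_closure_iff.1 hx.1 _ (hU.inter (isOpen_lt hg continuous_const)) ⟨hxU, hneg⟩
  exact lt_asymm hy.2 ((h y hy.1).1 hyΩ)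

section Chart

variable (p : Plane) (e : Plane ≃ₗᵢ[ℝ] Plane) (γ : ℝ → ℝ)

/-- The parametrization of the plane by a coordinate along the graph of `γ` and the height over
the graph, in the orthonormal coordinates `e` centred at `p`. -/
noncomputable def chart (q : ℝ × ℝ) : Plane := p + e.symm (!₂[q.1, γ q.1 + q.2])

/-- The height of `x` over the graph of `γ` in the coordinates `e` centred at `p`. -/
noncomputable def height (x : Plane) : ℝ := e (x - p) 1 - γ (e (x - p) 0)

/-- The image of the square `(-ρ, ρ)²` under `chart p e γ`. -/
def chartBox (ρ : ℝ) : Set Plane := {x | |e (x - p) 0| < ρ ∧ |height p e γ x| < ρ}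

theorem chart_coord (x : Plane) : chart p e γ (e (x - p) 0, height p e γ x) = x := by
  have : !₂[e (x - p) 0, e (x - p) 1] = e (x - p) := by
    ext i; fin_cases i <;> rfl
  rw [chart, height, add_sub_cancel, this]
  simp

theorem coord_chart (q : ℝ × ℝ) : e (chart p e γ q - p) 0 = q.1 := by simp [chart]

theorem height_chart (q : ℝ × ℝ) : height p e γ (chart p e γ q) = q.2 := by simp [chart, height]

theorem chart_mem_chartBox_iff {ρ : ℝ} (q : ℝ × ℝ) :
    chart p e γ q ∈ chartBox p e γ ρ ↔ |q.1| < ρ ∧ |q.2| < ρ := by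
  rw [chartBox, Set.mem_ofPred_eq, coord_chart, height_chart]

theorem chart_eq_add (y t : ℝ) :
    chart p e γ (y, t) = chart p e γ (y, 0) + t • e.symm !₂[0, 1] := by
  rw [chart, chart, add_assoc, ← map_smul, ← map_add]
  congr 2
  ext i; fin_cases i <;> simp

theorem enorm_direction : ‖e.symm !₂[(0 : ℝ), 1]‖ₑ = 1 := by
  rw [← ofReal_norm, LinearIsometryEquiv.norm_map, EuclideanSpace.norm_eq]
  simp

variable {γ}

theorem continuous_chart (hγ : Continuous γ) : Continuous (chart p e γ) := by
  unfold chart; fun_prop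

theorem continuous_height (hγ : Continuous γ) : Continuous (height p e γ) := by
  unfold height; fun_prop

theorem isOpen_chartBox (hγ : Continuous γ) (ρ : ℝ) : IsOpen (chartBox p e γ ρ) := by
  have hcoord : Continuous fun x : Plane => |e (x - p) 0| := by fun_prop
  exact (isOpen_lt hcoord continuous_const).inter
    (isOpen_lt (continuous_height p e hγ).abs continuous_const)

theorem measurePreserving_chart (hγ : Continuous γ) :
    MeasurePreserving (chart p e γ) (volume : Measure (ℝ × ℝ)) volume := by
  have hshear : MeasurePreserving (fun q : ℝ × ℝ => (q.1, γ q.1 + q.2)) volume volume := by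
    refine (MeasurePreserving.id (volume : Measure ℝ)).skew_product
      (g := fun a b => γ a + b) (by fun_prop) ?_
    exact Eventually.of_forall fun a => map_add_left_eq_self _ _
  have hfin := (volume_preserving_finTwoArrow ℝ).symm
  have hLp := (EuclideanSpace.volume_preserving_symm_measurableEquiv_toLp (Fin 2)).symm
  convert (measurePreserving_add_left (volume : Measure Plane) p).comp
    (e.symm.measurePreserving.comp (hLp.comp (hfin.comp hshear))) using 1
  funext q
  have : !₂[q.1, γ q.1 + q.2] = (MeasurableEquiv.toLp 2 (Fin 2 → ℝ)).symm.symm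
      (MeasurableEquiv.finTwoArrow.symm (q.1, γ q.1 + q.2)) := by
    ext j; fin_cases j <;> rfl
  rw [chart, this]
  rfl

theorem lipschitzWith_height {K : NNReal} (hγ : LipschitzWith K γ) :
    LipschitzWith (1 + K) (height p e γ) := by
  have hcoord : ∀ i, LipschitzWith 1 fun x : Plane => e (x - p) i := fun i =>
    LipschitzWith.of_dist_le_mul fun x z => by
      have hsub : e (x - p) i - e (z - p) i = e (x - z) i := by
        have := congrArg (fun y : Plane => y i) (map_sub e (x - p) (z - p))
        rw [sub_sub_sub_cancel_right] at this
        exact this.symm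
      rw [Real.dist_eq, hsub, dist_eq_norm, ← LinearIsometryEquiv.norm_map e, NNReal.coe_one,
        one_mul, ← Real.norm_eq_abs]
      exact PiLp.norm_apply_le _ _
  have hsub := (hcoord 1).sub (hγ.comp (hcoord 0))
  rw [mul_one] at hsub
  exact hsub

theorem lipschitzWith_chart_zero {K : NNReal} (hγ : LipschitzWith K γ) :
    LipschitzWith (1 + K) fun y : ℝ => chart p e γ (y, 0) := by
  refine LipschitzWith.of_dist_le_mul fun y z => ?_
  have hdist : dist (chart p e γ (y, 0)) (chart p e γ (z, 0)) = ‖!₂[y - z, γ y - γ z]‖ := by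
    rw [dist_eq_norm, chart, chart, add_sub_add_left_eq_sub, ← map_sub,
      LinearIsometryEquiv.norm_map]
    congr 1
    ext i; fin_cases i <;> simp
  have hγyz := hγ.dist_le_mul y z
  rw [Real.dist_eq, Real.dist_eq] at hγyz
  rw [hdist, EuclideanSpace.norm_eq, Real.dist_eq]
  simp only [Fin.sum_univ_two, Real.norm_eq_abs, NNReal.coe_add, NNReal.coe_one,
    Matrix.cons_val_zero, Matrix.cons_val_one]
  refine Real.sqrt_le_iff.2 ⟨by positivity, ?_⟩
  calc |y - z| ^ 2 + |γ y - γ z| ^ 2 ≤ |y - z| ^ 2 + (K * |y - z|) ^ 2 := by gcongr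
    _ ≤ _ := by nlinarith [mul_nonneg K.2 (sq_nonneg |y - z|)]

variable {p e} {Ω : Set Plane} {f : Plane → ℝ} {ρ : ℝ}

theorem lintegral_line_le (hf : ContDiff ℝ ∞ f) (hγ : Continuous γ) (hΩ : MeasurableSet Ω)
    (hbox : ∀ x ∈ chartBox p e γ ρ, x ∈ Ω ↔ 0 < height p e γ x) (hρ : 0 < ρ) {t : ℝ}
    (ht : t ∈ Icc 0 ρ) :
    ∫⁻ y in Ioo (-ρ) ρ, ‖f (chart p e γ (y, t))‖ₑ ^ 2
      ≤ ENNReal.ofReal (2 / ρ + 2 * ρ) * sobolevSq Ω f := by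
  set g : Plane → ℝ≥0∞ := fun x => ‖f x‖ₑ ^ 2 + ‖gradient f x‖ₑ ^ 2
  have hgm : Measurable g :=
    (hf.continuous.measurable.enorm.pow_const 2).add
      ((continuous_gradient hf).measurable.enorm.pow_const 2)
  have hchart := measurePreserving_chart p e hγ
  have hsub : Ioo (-ρ) ρ ×ˢ Ioo 0 ρ ⊆ chart p e γ ⁻¹' Ω := by
    rintro ⟨y, r⟩ ⟨hy, hr⟩
    have hmem := (chart_mem_chartBox_iff p e γ (y, r)).2
      ⟨abs_lt.2 hy, abs_lt.2 ⟨by linarith [hr.1], hr.2⟩⟩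
    exact (hbox _ hmem).2 (by rw [height_chart]; exact hr.1)
  have hline : ∀ y, ‖f (chart p e γ (y, t))‖ₑ ^ 2
      ≤ ENNReal.ofReal (2 / ρ + 2 * ρ) * ∫⁻ r in Ioo 0 ρ, g (chart p e γ (y, r)) := by
    intro y
    have hderiv := enorm_deriv_comp_segment_le hf (chart p e γ (y, 0)) (e.symm !₂[0, 1])
    have hsq := enorm_sq_le_setLIntegral
      (contDiff_comp_segment hf (chart p e γ (y, 0)) (e.symm !₂[0, 1])) hρ ht
    simp only [← chart_eq_add, enorm_direction, mul_one] at hderiv hsq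
    refine hsq.trans ?_
    gcongr with r
    exact add_le_add le_rfl (pow_le_pow_left' (hderiv r) 2)
  calc _ ≤ ∫⁻ y in Ioo (-ρ) ρ,
          ENNReal.ofReal (2 / ρ + 2 * ρ) * ∫⁻ r in Ioo 0 ρ, g (chart p e γ (y, r)) :=
        lintegral_mono hline
    _ = ENNReal.ofReal (2 / ρ + 2 * ρ)
          * ∫⁻ q in Ioo (-ρ) ρ ×ˢ Ioo 0 ρ, g (chart p e γ q) := by
        rw [lintegral_const_mul' _ _ ENNReal.ofReal_ne_top, Measure.volume_eq_prod,
          setLIntegral_prod]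
        exact (hgm.comp hchart.measurable).aemeasurable
    _ ≤ ENNReal.ofReal (2 / ρ + 2 * ρ) * ∫⁻ q in chart p e γ ⁻¹' Ω, g (chart p e γ q) := by
        gcongr
    _ = _ := by rw [hchart.setLIntegral_comp_preimage hΩ hgm, sobolevSq]

theorem lintegral_strip_le (hf : ContDiff ℝ ∞ f) (hγ : Continuous γ) (hΩ : MeasurableSet Ω)
    (hbox : ∀ x ∈ chartBox p e γ ρ, x ∈ Ω ↔ 0 < height p e γ x) (hρ : 0 < ρ) {A : Set Plane}
    (hA : MeasurableSet A) (hAbox : A ⊆ chartBox p e γ ρ) {δ : ℝ}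
    (hAδ : ∀ x ∈ A, height p e γ x ∈ Ioo 0 δ) :
    ∫⁻ x in A, ‖f x‖ₑ ^ 2
      ≤ ENNReal.ofReal (2 / ρ + 2 * ρ) * ENNReal.ofReal δ * sobolevSq Ω f := by
  have hchart := measurePreserving_chart p e hγ
  have hfm : Measurable fun x => ‖f x‖ₑ ^ 2 := hf.continuous.measurable.enorm.pow_const 2
  have hsub : chart p e γ ⁻¹' A ⊆ Ioo (-ρ) ρ ×ˢ Ioo 0 (min ρ δ) := by
    intro q hq
    have hqρ := (chart_mem_chartBox_iff p e γ q).1 (hAbox hq)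
    have hqδ := hAδ _ hq
    rw [height_chart] at hqδ
    exact ⟨abs_lt.1 hqρ.1, hqδ.1, lt_min (abs_lt.1 hqρ.2).2 hqδ.2⟩
  calc _ = ∫⁻ q in chart p e γ ⁻¹' A, ‖f (chart p e γ q)‖ₑ ^ 2 :=
        (hchart.setLIntegral_comp_preimage hA hfm).symm
    _ ≤ ∫⁻ q in Ioo (-ρ) ρ ×ˢ Ioo 0 (min ρ δ), ‖f (chart p e γ q)‖ₑ ^ 2 :=
        lintegral_mono_set hsub
    _ = ∫⁻ t in Ioo 0 (min ρ δ), ∫⁻ y in Ioo (-ρ) ρ, ‖f (chart p e γ (y, t))‖ₑ ^ 2 := by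
        rw [Measure.volume_eq_prod, setLIntegral_prod_symm]
        exact (hfm.comp hchart.measurable).aemeasurable
    _ ≤ ∫⁻ _ in Ioo 0 (min ρ δ), ENNReal.ofReal (2 / ρ + 2 * ρ) * sobolevSq Ω f :=
        setLIntegral_mono' measurableSet_Ioo fun t ht => lintegral_line_le hf hγ hΩ hbox hρ
          ⟨ht.1.le, (ht.2.trans_le (min_le_left _ _)).le⟩
    _ = ENNReal.ofReal (2 / ρ + 2 * ρ) * sobolevSq Ω f * ENNReal.ofReal (min ρ δ) := by simp
    _ ≤ ENNReal.ofReal (2 / ρ + 2 * ρ) * sobolevSq Ω f * ENNReal.ofReal δ := by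
        gcongr; exact min_le_right _ _
    _ = _ := by ring

variable {K : NNReal}

theorem lintegral_frontier_chartBox_le (hf : ContDiff ℝ ∞ f) (hγ : LipschitzWith K γ)
    (hΩ : IsOpen Ω) (hbox : ∀ x ∈ chartBox p e γ ρ, x ∈ Ω ↔ 0 < height p e γ x)
    (hρ : 0 < ρ) {A : Set Plane} (hA : A ⊆ chartBox p e γ ρ) :
    ∫⁻ x in frontier Ω ∩ A, ‖f x‖ₑ ^ 2 ∂len
      ≤ (1 + K : NNReal) * (ENNReal.ofReal (2 / ρ + 2 * ρ) * sobolevSq Ω f) := by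
  have hgraph : frontier Ω ∩ A ⊆ (fun y : ℝ => chart p e γ (y, 0)) '' Ioo (-ρ) ρ := by
    rintro x ⟨hx, hxA⟩
    have hheight := eq_zero_of_mem_frontier hΩ (isOpen_chartBox p e hγ.continuous ρ)
      (continuous_height p e hγ.continuous) hbox hx (hA hxA)
    refine ⟨_, abs_lt.1 (hA hxA).1, ?_⟩
    simpa only [hheight] using chart_coord p e γ x
  refine (lintegral_hausdorffMeasure_le_of_lipschitz (lipschitzWith_chart_zero p e hγ) hgraph
    (hf.continuous.measurable.enorm.pow_const 2)).trans ?_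
  gcongr
  exact lintegral_line_le hf hγ.continuous hΩ.measurableSet hbox hρ ⟨le_rfl, hρ.le⟩

theorem lintegral_thickening_chartBox_le (hf : ContDiff ℝ ∞ f) (hγ : LipschitzWith K γ)
    (hΩ : IsOpen Ω) (hbox : ∀ x ∈ chartBox p e γ ρ, x ∈ Ω ↔ 0 < height p e γ x)
    (hρ : 0 < ρ) {A : Set Plane} (hAfr : A ⊆ frontier Ω) {δ : ℝ}
    (hA : Metric.thickening δ A ⊆ chartBox p e γ ρ) :
    ∫⁻ x in Ω ∩ Metric.thickening δ A, ‖f x‖ₑ ^ 2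
      ≤ ENNReal.ofReal (2 / ρ + 2 * ρ) * ENNReal.ofReal ((1 + K : NNReal) * δ)
        * sobolevSq Ω f := by
  refine lintegral_strip_le hf hγ.continuous hΩ.measurableSet hbox hρ
    (hΩ.inter Metric.isOpen_thickening).measurableSet (inter_subset_right.trans hA) ?_
  rintro x ⟨hxΩ, hx⟩
  refine ⟨(hbox x (hA hx)).1 hxΩ, ?_⟩
  obtain ⟨z, hz, hxz⟩ := Metric.mem_thickening_iff.1 hx
  have hzbox : z ∈ chartBox p e γ ρ :=
    hA (Metric.self_subset_thickening (dist_nonneg.trans_lt hxz) _ hz)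
  have hheight := eq_zero_of_mem_frontier hΩ (isOpen_chartBox p e hγ.continuous ρ)
    (continuous_height p e hγ.continuous) hbox (hAfr hz) hzbox
  have hlip := (lipschitzWith_height p e hγ).dist_le_mul x z
  rw [hheight, Real.dist_eq, sub_zero] at hlip
  exact ((le_abs_self _).trans hlip).trans_lt (by gcongr)

theorem exists_chartBox (hΩ : IsOpen Ω) (hL : HasLipschitzBoundary Ω) (hp : p ∈ frontier Ω) :
    ∃ (e : Plane ≃ₗᵢ[ℝ] Plane) (γ : ℝ → ℝ) (K : NNReal) (ρ : ℝ), LipschitzWith K γ ∧ 0 < ρ ∧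
      p ∈ chartBox p e γ ρ ∧ ∀ x ∈ chartBox p e γ ρ, x ∈ Ω ↔ 0 < height p e γ x := by
  obtain ⟨e, γ, K, r, hγ, hr, hball⟩ := hL p hp
  have hball' : ∀ x ∈ Metric.ball p r, x ∈ Ω ↔ 0 < height p e γ x := fun x hx => by
    rw [hball x hx, height, sub_pos]
  have hheight : height p e γ p = 0 :=
    eq_zero_of_mem_frontier hΩ Metric.isOpen_ball (continuous_height p e hγ.continuous) hball' hp
      (Metric.mem_ball_self hr)
  have hchart : chart p e γ (0, 0) = p := by
    simpa [hheight] using chart_coord p e γ p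
  obtain ⟨ρ, hρ, hsub⟩ := Metric.continuousAt_iff.1
    (continuous_chart p e hγ.continuous).continuousAt r hr
  refine ⟨e, γ, K, ρ, hγ, hρ, by simpa [chartBox, hheight] using hρ, fun x hx => hball' x ?_⟩
  have hdist : dist (e (x - p) 0, height p e γ x) ((0 : ℝ), (0 : ℝ)) < ρ := by
    rw [Prod.dist_eq, Real.dist_eq, Real.dist_eq, sub_zero, sub_zero]
    exact max_lt hx.1 hx.2
  have hmem := hsub hdist
  rwa [hchart, chart_coord] at hmem

end Chart

/-- The trace inequality on the part `s` of the boundary, and the smallness of smooth functions in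
thin layers along `s`. -/
def BoundaryEstimate (Ω s : Set Plane) : Prop :=
  ∃ (C : NNReal) (δ₀ : ℝ), 0 < δ₀ ∧ ∀ f : Plane → ℝ, ContDiff ℝ ∞ f →
    ∫⁻ x in frontier Ω ∩ s, ‖f x‖ₑ ^ 2 ∂len ≤ C * sobolevSq Ω f ∧
    ∀ δ ≤ δ₀, ∫⁻ x in Ω ∩ Metric.thickening δ (frontier Ω ∩ s), ‖f x‖ₑ ^ 2
      ≤ C * ENNReal.ofReal δ * sobolevSq Ω f

namespace BoundaryEstimate

variable {Ω s t : Set Plane}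

theorem exists_ball (hΩ : IsOpen Ω) (hL : HasLipschitzBoundary Ω) {p : Plane}
    (hp : p ∈ frontier Ω) : ∃ R > 0, BoundaryEstimate Ω (Metric.ball p R) := by
  obtain ⟨e, γ, K, ρ, hγ, hρ, hpbox, hbox⟩ := exists_chartBox hΩ hL hp
  obtain ⟨R, hR, hsub⟩ :=
    Metric.isOpen_iff.1 (isOpen_chartBox p e hγ.continuous ρ) p hpbox
  refine ⟨R / 2, half_pos hR, (2 / ρ + 2 * ρ).toNNReal * (1 + K), R / 2, half_pos hR,
    fun f hf => ⟨?_, fun δ hδ => ?_⟩⟩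
  · refine (lintegral_frontier_chartBox_le hf hγ hΩ hbox hρ
      ((Metric.ball_subset_ball (half_le_self hR.le)).trans hsub)).trans_eq ?_
    rw [ENNReal.coe_mul, ENNReal.ofReal]
    ring
  · have hthick : Metric.thickening δ (frontier Ω ∩ Metric.ball p (R / 2))
        ⊆ chartBox p e γ ρ := by
      intro x hx
      obtain ⟨z, hz, hxz⟩ := Metric.mem_thickening_iff.1 hx
      refine hsub (Metric.mem_ball.2 ((dist_triangle x z p).trans_lt ?_))
      linarith [Metric.mem_ball.1 hz.2]
    refine (lintegral_thickening_chartBox_le hf hγ hΩ hbox hρ inter_subset_left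
      hthick).trans_eq ?_
    rw [ENNReal.ofReal_mul NNReal.zero_le_coe, ENNReal.ofReal_coe_nnreal, ENNReal.coe_mul,
      ENNReal.ofReal, ← mul_assoc]

theorem mono (hst : frontier Ω ∩ s ⊆ frontier Ω ∩ t) (h : BoundaryEstimate Ω t) :
    BoundaryEstimate Ω s := by
  obtain ⟨C, δ₀, hδ₀, h⟩ := h
  exact ⟨C, δ₀, hδ₀, fun f hf => ⟨(lintegral_mono_set hst).trans (h f hf).1, fun δ hδ =>
    (lintegral_mono_set (inter_subset_inter_right _
      (Metric.thickening_subset_of_subset δ hst))).trans ((h f hf).2 δ hδ)⟩⟩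

theorem union (hs : BoundaryEstimate Ω s) (ht : BoundaryEstimate Ω t) :
    BoundaryEstimate Ω (s ∪ t) := by
  obtain ⟨C, δ₀, hδ₀, h⟩ := hs
  obtain ⟨C', δ₀', hδ₀', h'⟩ := ht
  refine ⟨C + C', min δ₀ δ₀', lt_min hδ₀ hδ₀', fun f hf => ⟨?_, fun δ hδ => ?_⟩⟩
  · rw [inter_union_distrib_left, ENNReal.coe_add, add_mul]
    exact (lintegral_union_le _ _ _).trans (add_le_add (h f hf).1 (h' f hf).1)
  · rw [inter_union_distrib_left, Metric.thickening_union, inter_union_distrib_left,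
      ENNReal.coe_add, add_mul, add_mul]
    exact (lintegral_union_le _ _ _).trans (add_le_add
      ((h f hf).2 δ (hδ.trans (min_le_left _ _)))
      ((h' f hf).2 δ (hδ.trans (min_le_right _ _))))

theorem univ (hΩ : IsOpen Ω) (hb : Bornology.IsBounded Ω) (hL : HasLipschitzBoundary Ω) :
    BoundaryEstimate Ω univ := by
  have hcompact : IsCompact (frontier Ω) :=
    Metric.isCompact_of_isClosed_isBounded isClosed_frontier
      (hb.closure.subset frontier_subset_closure)
  suffices h : BoundaryEstimate Ω (frontier Ω) from h.mono (by simp)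
  refine hcompact.induction_on (p := BoundaryEstimate Ω) ?_ ?_ ?_ ?_
  · exact ⟨0, 1, one_pos, fun f _ => by simp⟩
  · exact fun s t hst => mono (inter_subset_inter_right _ hst)
  · exact fun s t => union
  · intro p hp
    obtain ⟨R, hR, h⟩ := exists_ball hΩ hL hp
    exact ⟨_, mem_nhdsWithin_of_mem_nhds (Metric.ball_mem_nhds p hR), h⟩

end BoundaryEstimate

/-! ### Means over the cells of a grid -/

section Poincare

variable {E : Type*} [NormedAddCommGroup E] [MeasurableSpace E] [BorelSpace E] {Q : Set E}

section Homothety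

variable [NormedSpace ℝ E] [FiniteDimensional ℝ E] (μ : Measure E) [μ.IsAddHaarMeasure]
  {g : E → ℝ≥0∞} {t : ℝ}

theorem setLIntegral_homothety_le (hQ : Convex ℝ Q) (hQm : MeasurableSet Q) (hg : Measurable g)
    {y : E} (hy : y ∈ Q) (ht : 1 / 2 ≤ t) (ht1 : t ≤ 1) :
    ∫⁻ x in Q, g (y + t • (x - y)) ∂μ ≤ 2 ^ Module.finrank ℝ E * ∫⁻ x in Q, g x ∂μ := by
  have ht0 : 0 < t := by linarith
  have hindicator : ∫⁻ x in Q, g (y + t • (x - y)) ∂μ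
      ≤ ∫⁻ x, Q.indicator g ((y - t • y) + t • x) ∂μ := by
    rw [← lintegral_indicator hQm]
    refine lintegral_mono (indicator_le fun x hx => ?_)
    have hpoint : (y - t • y) + t • x = y + t • (x - y) := by rw [smul_sub]; abel
    rw [hpoint, indicator_of_mem (hQ.add_smul_sub_mem hy hx ⟨ht0.le, ht1⟩)]
  have hscale : ∫⁻ x, Q.indicator g ((y - t • y) + t • x) ∂μ
      = ENNReal.ofReal |(t ^ Module.finrank ℝ E)⁻¹| * ∫⁻ x in Q, g x ∂μ := by
    rw [← lintegral_map (f := fun z => Q.indicator g ((y - t • y) + z))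
        ((hg.indicator hQm).comp (measurable_const_add _)) (measurable_const_smul t),
      Measure.map_addHaar_smul _ ht0.ne', lintegral_smul_measure,
      lintegral_add_left_eq_self (μ := μ) (Q.indicator g), lintegral_indicator hQm, smul_eq_mul]
  refine hindicator.trans (hscale.le.trans ?_)
  gcongr
  rw [← ENNReal.ofReal_ofNat 2, ← ENNReal.ofReal_pow zero_le_two, abs_of_pos (by positivity),
    ← inv_pow]
  gcongr
  rw [inv_le_comm₀ ht0 two_pos]
  linarith

theorem setLIntegral_setLIntegral_homothety_le (hQ : Convex ℝ Q) (hQm : MeasurableSet Q)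
    (hg : Measurable g) (ht : t ∈ Icc (0 : ℝ) 1) :
    ∫⁻ y in Q, ∫⁻ x in Q, g (y + t • (x - y)) ∂μ ∂μ
      ≤ 2 ^ Module.finrank ℝ E * μ Q * ∫⁻ x in Q, g x ∂μ := by
  have hconst : ∫⁻ _ in Q, 2 ^ Module.finrank ℝ E * ∫⁻ x in Q, g x ∂μ ∂μ
      = 2 ^ Module.finrank ℝ E * μ Q * ∫⁻ x in Q, g x ∂μ := by
    rw [setLIntegral_const, mul_right_comm]
  rw [← hconst]
  rcases le_total (1 / 2) t with h | h
  · exact setLIntegral_mono' hQm fun y hy => setLIntegral_homothety_le μ hQ hQm hg hy h ht.2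
  · -- The point `y + t • (x - y)` is symmetric in `(x, t)` and `(y, 1 - t)`.
    have hpair : Measurable fun z : E × E => g (z.1 + t • (z.2 - z.1)) := hg.comp (by fun_prop)
    rw [lintegral_lintegral_swap hpair.aemeasurable]
    refine setLIntegral_mono' hQm fun x hx => le_of_eq_of_le (lintegral_congr fun y => ?_)
      (setLIntegral_homothety_le μ hQ hQm hg hx (t := 1 - t) (by linarith) (by linarith [ht.1]))
    congr 1
    simp only [smul_sub, sub_smul, one_smul]
    abel

end Homothety

theorem sq_mul_enorm_sq_le_lintegral {X : Type*} [MeasurableSpace X] {μ : Measure X}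
    [IsFiniteMeasure μ] {f : X → ℝ} (hf : Integrable f μ) (x : X) :
    μ univ ^ 2 * ‖f x‖ₑ ^ 2
      ≤ 2 * (μ univ * ∫⁻ y, ‖f y - f x‖ₑ ^ 2 ∂μ) + 2 * ‖∫ y, f y ∂μ‖ₑ ^ 2 := by
  have hfx : μ.real univ * f x = (∫ y, f y ∂μ) - ∫ y, (f y - f x) ∂μ := by
    rw [integral_sub hf (integrable_const _), integral_const, smul_eq_mul, sub_sub_cancel]
  have hnorm : μ univ * ‖f x‖ₑ ≤ ‖∫ y, f y ∂μ‖ₑ + ∫⁻ y, ‖f y - f x‖ₑ * 1 ∂μ := by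
    calc μ univ * ‖f x‖ₑ = ‖μ.real univ * f x‖ₑ := by
          rw [enorm_mul, Real.enorm_eq_ofReal measureReal_nonneg, ofReal_measureReal]
      _ ≤ ‖∫ y, f y ∂μ‖ₑ + ‖∫ y, (f y - f x) ∂μ‖ₑ := hfx ▸ enorm_sub_le
      _ ≤ _ := by
        simp only [mul_one]
        gcongr
        exact enorm_integral_le_lintegral_enorm _
  calc _ = (μ univ * ‖f x‖ₑ) ^ 2 := (mul_pow _ _ _).symm
    _ ≤ (‖∫ y, f y ∂μ‖ₑ + ∫⁻ y, ‖f y - f x‖ₑ * 1 ∂μ) ^ 2 := by gcongr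
    _ ≤ 2 * (‖∫ y, f y ∂μ‖ₑ ^ 2 + (∫⁻ y, ‖f y - f x‖ₑ * 1 ∂μ) ^ 2) := ennreal_add_sq_le _ _
    _ ≤ 2 * (‖∫ y, f y ∂μ‖ₑ ^ 2
        + (∫⁻ y, ‖f y - f x‖ₑ ^ 2 ∂μ) * ∫⁻ _, 1 ^ 2 ∂μ) := by
      gcongr
      exact sq_lintegral_mul_le (hf.aestronglyMeasurable.sub aestronglyMeasurable_const).enorm
        aemeasurable_const
    _ = _ := by rw [one_pow, lintegral_one]; ring

theorem measurable_lintegral_enorm_sub_sq {X : Type*} [MeasurableSpace X] {μ : Measure X}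
    [SFinite μ] {f : X → ℝ} (hf : Measurable f) :
    Measurable fun x => ∫⁻ y, ‖f y - f x‖ₑ ^ 2 ∂μ := by
  have : Measurable fun z : X × X => ‖f z.2 - f z.1‖ₑ ^ 2 :=
    ((hf.comp measurable_snd).sub (hf.comp measurable_fst)).enorm.pow_const 2
  exact this.lintegral_prod_right'

theorem mul_lintegral_enorm_sq_le {X : Type*} [MeasurableSpace X] {μ : Measure X}
    [IsFiniteMeasure μ] {f : X → ℝ} (hfm : Measurable f) (hf : Integrable f μ) :
    μ univ * ∫⁻ x, ‖f x‖ₑ ^ 2 ∂μ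
      ≤ 2 * (∫⁻ x, ∫⁻ y, ‖f y - f x‖ₑ ^ 2 ∂μ ∂μ) + 2 * ‖∫ x, f x ∂μ‖ₑ ^ 2 := by
  rcases eq_or_ne μ 0 with rfl | hμ
  · simp
  have hdiff := measurable_lintegral_enorm_sub_sq (μ := μ) hfm
  rw [← ENNReal.mul_le_mul_iff_right (Measure.measure_univ_ne_zero.2 hμ) (measure_ne_top μ univ)]
  calc _ = ∫⁻ x, μ univ ^ 2 * ‖f x‖ₑ ^ 2 ∂μ := by
        rw [lintegral_const_mul _ (hfm.enorm.pow_const 2), sq, mul_assoc]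
    _ ≤ ∫⁻ x, (2 * (μ univ * ∫⁻ y, ‖f y - f x‖ₑ ^ 2 ∂μ) + 2 * ‖∫ y, f y ∂μ‖ₑ ^ 2) ∂μ :=
        lintegral_mono (sq_mul_enorm_sq_le_lintegral hf)
    _ = _ := by
        rw [lintegral_add_right _ measurable_const, lintegral_const_mul _ (hdiff.const_mul _),
          lintegral_const_mul _ hdiff, lintegral_const]
        ring

variable [InnerProductSpace ℝ E] [FiniteDimensional ℝ E] {f : E → ℝ}

variable (μ : Measure E) [μ.IsAddHaarMeasure]

theorem setLIntegral_setLIntegral_enorm_sub_sq_le (hQ : Convex ℝ Q) (hQm : MeasurableSet Q)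
    (hf : ContDiff ℝ ∞ f) :
    ∫⁻ y in Q, ∫⁻ x in Q, ‖f x - f y‖ₑ ^ 2 ∂μ ∂μ
      ≤ Metric.ediam Q ^ 2
        * (2 ^ Module.finrank ℝ E * μ Q * ∫⁻ x in Q, ‖gradient f x‖ₑ ^ 2 ∂μ) := by
  set g : E → ℝ≥0∞ := fun x => ‖gradient f x‖ₑ ^ 2
  have hg : Measurable g := (continuous_gradient hf).enorm.measurable.pow_const 2
  have hg_fst : ∀ y, Measurable fun z : E × ℝ => g (y + z.2 • (z.1 - y)) := fun y =>
    hg.comp (by fun_prop)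
  have hg_snd : Measurable fun z : (E × ℝ) × E => g (z.1.1 + z.1.2 • (z.2 - z.1.1)) :=
    hg.comp (by fun_prop)
  have hg_pair : Measurable fun z : (E × E) × ℝ => g (z.1.1 + z.2 • (z.1.2 - z.1.1)) :=
    hg.comp (by fun_prop)
  calc _ ≤ ∫⁻ y in Q, ∫⁻ x in Q,
          Metric.ediam Q ^ 2 * (∫⁻ t in Ioo (0 : ℝ) 1, g (y + t • (x - y))) ∂μ ∂μ :=
        setLIntegral_mono' hQm fun y hy => setLIntegral_mono' hQm fun x hx =>
          (enorm_sub_sq_le_lintegral_gradient hf x y).trans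
            (by gcongr; exact Metric.edist_le_ediam_of_mem hx hy)
    _ = Metric.ediam Q ^ 2
          * ∫⁻ y in Q, ∫⁻ x in Q, (∫⁻ t in Ioo (0 : ℝ) 1, g (y + t • (x - y))) ∂μ ∂μ := by
        simp only [lintegral_const_mul _ (hg_fst _).lintegral_prod_right']
        exact lintegral_const_mul _ hg_pair.lintegral_prod_right'.lintegral_prod_right'
    _ = Metric.ediam Q ^ 2
          * ∫⁻ t in Ioo (0 : ℝ) 1, ∫⁻ y in Q, ∫⁻ x in Q, g (y + t • (x - y)) ∂μ ∂μ := by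
        congr 1
        exact (lintegral_congr fun y => lintegral_lintegral_swap (hg_fst y).aemeasurable).trans
          (lintegral_lintegral_swap hg_snd.lintegral_prod_right'.aemeasurable)
    _ ≤ Metric.ediam Q ^ 2 * ∫⁻ _ in Ioo (0 : ℝ) 1,
          2 ^ Module.finrank ℝ E * μ Q * ∫⁻ x in Q, g x ∂μ := by
        gcongr 1
        exact setLIntegral_mono' measurableSet_Ioo fun t ht =>
          setLIntegral_setLIntegral_homothety_le μ hQ hQm hg (Ioo_subset_Icc_self ht)
    _ = _ := by simp

theorem setLIntegral_enorm_sq_le_of_convex (hQ : Convex ℝ Q) (hQm : MeasurableSet Q)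
    (hQb : Bornology.IsBounded Q) (hf : ContDiff ℝ ∞ f) :
    ∫⁻ x in Q, ‖f x‖ₑ ^ 2 ∂μ
      ≤ 2 * 2 ^ Module.finrank ℝ E * Metric.ediam Q ^ 2 * (∫⁻ x in Q, ‖gradient f x‖ₑ ^ 2 ∂μ)
        + 2 * (μ Q)⁻¹ * ‖∫ x in Q, f x ∂μ‖ₑ ^ 2 := by
  have hfin : μ Q ≠ ⊤ := hQb.measure_lt_top.ne
  rcases eq_or_ne (μ Q) 0 with h0 | h0
  · simp [Measure.restrict_eq_zero.2 h0]
  have : IsFiniteMeasure (μ.restrict Q) := ⟨by simpa using hfin.lt_top⟩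
  have hint : IntegrableOn f Q μ :=
    (hf.continuous.continuousOn.integrableOn_compact hQb.isCompact_closure).mono_set subset_closure
  have hmean := mul_lintegral_enorm_sq_le hf.continuous.measurable hint
  rw [Measure.restrict_apply_univ] at hmean
  rw [← ENNReal.mul_le_mul_iff_right h0 hfin]
  calc _ ≤ 2 * (Metric.ediam Q ^ 2
          * (2 ^ Module.finrank ℝ E * μ Q * ∫⁻ x in Q, ‖gradient f x‖ₑ ^ 2 ∂μ))
        + 2 * ‖∫ x in Q, f x ∂μ‖ₑ ^ 2 := by
        refine hmean.trans ?_
        gcongr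
        exact setLIntegral_setLIntegral_enorm_sub_sq_le μ hQ hQm hf
    _ = 2 * (Metric.ediam Q ^ 2
          * (2 ^ Module.finrank ℝ E * μ Q * ∫⁻ x in Q, ‖gradient f x‖ₑ ^ 2 ∂μ))
        + μ Q * (μ Q)⁻¹ * (2 * ‖∫ x in Q, f x ∂μ‖ₑ ^ 2) := by
        rw [ENNReal.mul_inv_cancel h0 hfin, one_mul]
    _ = _ := by ring

end Poincare

section Grid

theorem nonempty_inter_frontier {X : Type*} [TopologicalSpace X] {s u : Set X}
    (hs : IsPreconnected s) (hu : IsOpen u) (hsu : (s ∩ u).Nonempty) (hsub : ¬s ⊆ u) :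
    (s ∩ frontier u).Nonempty := by
  by_contra hne
  refine hsub (hs.subset_left_of_subset_union hu isClosed_closure.isOpen_compl
    (disjoint_compl_right_iff_subset.2 subset_closure) (fun x hx => ?_) hsu)
  refine or_iff_not_imp_left.2 fun hxu hxc => hne ⟨x, hx, ?_⟩
  rw [hu.frontier_eq]
  exact ⟨hxc, hxu⟩

/-- The cells of the square grid of mesh `ε`, on which the means of a function are taken. -/
def gridCell (ε : ℝ) (i : ℤ × ℤ) : Set Plane := {x | ⌊x 0 / ε⌋ = i.1 ∧ ⌊x 1 / ε⌋ = i.2}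

variable {ε : ℝ}

theorem mem_gridCell_iff (hε : 0 < ε) (i : ℤ × ℤ) (x : Plane) : x ∈ gridCell ε i ↔
    (i.1 * ε ≤ x 0 ∧ x 0 < (i.1 + 1) * ε) ∧ (i.2 * ε ≤ x 1 ∧ x 1 < (i.2 + 1) * ε) := by
  simp only [gridCell, Set.mem_ofPred_eq, Int.floor_eq_iff, le_div_iff₀ hε, div_lt_iff₀ hε]

theorem pairwise_disjoint_gridCell (ε : ℝ) :
    Pairwise fun i j => Disjoint (gridCell ε i) (gridCell ε j) := fun _ _ hij =>
  Set.disjoint_left.2 fun _ hi hj =>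
    hij (Prod.ext (hi.1.symm.trans hj.1) (hi.2.symm.trans hj.2))

theorem measurableSet_gridCell (ε : ℝ) (i : ℤ × ℤ) : MeasurableSet (gridCell ε i) := by
  have hfloor : ∀ k : Fin 2, Measurable fun x : Plane => ⌊x k / ε⌋ := fun k =>
    Int.measurable_floor.comp (by fun_prop)
  exact (hfloor 0 (measurableSet_singleton i.1)).inter (hfloor 1 (measurableSet_singleton i.2))

theorem convex_gridCell (hε : 0 < ε) (i : ℤ × ℤ) : Convex ℝ (gridCell ε i) := by
  have hcoord : ∀ k : Fin 2, IsLinearMap ℝ fun x : Plane => x k := fun k => ⟨by simp, by simp⟩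
  have hhalf : gridCell ε i = ({x : Plane | i.1 * ε ≤ x 0} ∩ {x : Plane | x 0 < (i.1 + 1) * ε})
      ∩ ({x : Plane | i.2 * ε ≤ x 1} ∩ {x : Plane | x 1 < (i.2 + 1) * ε}) := by
    ext x; rw [mem_gridCell_iff hε]; rfl
  rw [hhalf]
  exact ((convex_halfSpace_ge (hcoord 0) _).inter (convex_halfSpace_lt (hcoord 0) _)).inter
    ((convex_halfSpace_ge (hcoord 1) _).inter (convex_halfSpace_lt (hcoord 1) _))

theorem ediam_gridCell_le (hε : 0 < ε) (i : ℤ × ℤ) :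
    Metric.ediam (gridCell ε i) ≤ ENNReal.ofReal (2 * ε) := by
  refine Metric.ediam_le fun x hx y hy => ?_
  obtain ⟨⟨hx0, hx0'⟩, hx1, hx1'⟩ := (mem_gridCell_iff hε i x).1 hx
  obtain ⟨⟨hy0, hy0'⟩, hy1, hy1'⟩ := (mem_gridCell_iff hε i y).1 hy
  have hsq0 : (x 0 - y 0) ^ 2 ≤ ε ^ 2 := sq_le_sq' (by linarith) (by linarith)
  have hsq1 : (x 1 - y 1) ^ 2 ≤ ε ^ 2 := sq_le_sq' (by linarith) (by linarith)
  rw [edist_dist, EuclideanSpace.dist_eq]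
  refine ENNReal.ofReal_le_ofReal (Real.sqrt_le_iff.2 ⟨by positivity, ?_⟩)
  simp only [Fin.sum_univ_two, Real.dist_eq, sq_abs]
  nlinarith

theorem nonempty_gridCell (hε : 0 < ε) (i : ℤ × ℤ) : (gridCell ε i).Nonempty :=
  ⟨!₂[i.1 * ε, i.2 * ε], (mem_gridCell_iff hε i _).2 (by simp [hε])⟩

theorem volume_gridCell_ne_zero (hε : 0 < ε) (i : ℤ × ℤ) : volume (gridCell ε i) ≠ 0 := by
  have hopen : IsOpen {x : Plane | (i.1 * ε < x 0 ∧ x 0 < (i.1 + 1) * ε) ∧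
      (i.2 * ε < x 1 ∧ x 1 < (i.2 + 1) * ε)} := by
    have hcoord : ∀ (k : Fin 2) (a b : ℝ), IsOpen {x : Plane | a < x k ∧ x k < b} := fun k a b =>
      isOpen_Ioo.preimage (show Continuous fun x : Plane => x k by fun_prop)
    exact (hcoord 0 _ _).inter (hcoord 1 _ _)
  have hne : (!₂[(i.1 + 1 / 2) * ε, (i.2 + 1 / 2) * ε] : Plane) ∈
      {x : Plane | (i.1 * ε < x 0 ∧ x 0 < (i.1 + 1) * ε) ∧
        (i.2 * ε < x 1 ∧ x 1 < (i.2 + 1) * ε)} := by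
    refine ⟨⟨?_, ?_⟩, ?_, ?_⟩ <;> simp [hε] <;> norm_num
  refine ((hopen.measure_pos volume ⟨_, hne⟩).trans_le (measure_mono fun x hx => ?_)).ne'
  exact (mem_gridCell_iff hε i x).2 ⟨⟨hx.1.1.le, hx.1.2⟩, hx.2.1.le, hx.2.2⟩

variable {Ω : Set Plane}

theorem finite_gridCell_subset (hb : Bornology.IsBounded Ω) (hε : 0 < ε) :
    {i | gridCell ε i ⊆ Ω}.Finite := by
  obtain ⟨M, hM⟩ := hb.exists_norm_le
  have hfin := Set.finite_Icc (⌊-M / ε⌋) (⌊M / ε⌋)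
  refine (hfin.prod hfin).subset fun i hi => ?_
  obtain ⟨x, hx⟩ := nonempty_gridCell hε i
  have hfloor : ∀ k, ⌊x k / ε⌋ ∈ Icc (⌊-M / ε⌋) (⌊M / ε⌋) := fun k => by
    have hk := abs_le.1 ((PiLp.norm_apply_le x k).trans (hM x (hi hx)))
    constructor
    · gcongr; exact hk.1
    · gcongr; exact hk.2
  rw [← Prod.mk.eta (p := i), ← hx.1, ← hx.2]
  exact ⟨hfloor 0, hfloor 1⟩

theorem subset_thickening_union_gridCell (hΩ : IsOpen Ω) (hε : 0 < ε) {δ : ℝ} (hεδ : 2 * ε < δ) :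
    Ω ⊆ Ω ∩ Metric.thickening δ (frontier Ω) ∪ ⋃ i ∈ {i | gridCell ε i ⊆ Ω}, gridCell ε i := by
  intro x hx
  set i : ℤ × ℤ := (⌊x 0 / ε⌋, ⌊x 1 / ε⌋)
  have hxi : x ∈ gridCell ε i := ⟨rfl, rfl⟩
  by_cases hsub : gridCell ε i ⊆ Ω
  · exact Or.inr (mem_biUnion (Set.mem_ofPred_eq ▸ hsub) hxi)
  obtain ⟨z, hz, hzf⟩ := nonempty_inter_frontier (convex_gridCell hε i).isPreconnected hΩ
    ⟨x, hxi, hx⟩ hsub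
  refine Or.inl ⟨hx, (Metric.mem_thickening_iff_exists_edist_lt _ _).2 ⟨z, hzf, ?_⟩⟩
  exact ((Metric.edist_le_ediam_of_mem hxi hz).trans (ediam_gridCell_le hε i)).trans_lt
    ((ENNReal.ofReal_lt_ofReal_iff (by linarith)).2 hεδ)

theorem sum_lintegral_gridCell_le (hε : 0 < ε) {J : Finset (ℤ × ℤ)}
    (hJ : ∀ i ∈ J, gridCell ε i ⊆ Ω) {f : Plane → ℝ} (hf : ContDiff ℝ ∞ f) :
    ∑ i ∈ J, ∫⁻ x in gridCell ε i, ‖f x‖ₑ ^ 2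
      ≤ ENNReal.ofReal (32 * ε ^ 2) * sobolevSq Ω f
        + ∑ i ∈ J, 2 * (volume (gridCell ε i))⁻¹ * ‖∫ x in gridCell ε i, f x‖ₑ ^ 2 := by
  have hdiam : ∀ i, 2 * 2 ^ Module.finrank ℝ Plane * Metric.ediam (gridCell ε i) ^ 2
      ≤ ENNReal.ofReal (32 * ε ^ 2) := fun i => by
    have hcoeff : (32 : ℝ) * ε ^ 2 = 8 * (2 * ε) ^ 2 := by ring
    rw [hcoeff, ENNReal.ofReal_mul (by norm_num), ENNReal.ofReal_pow (by positivity),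
      finrank_euclideanSpace_fin, ENNReal.ofReal_ofNat]
    gcongr
    · norm_num
    · exact ediam_gridCell_le hε i
  have hgrad : ∑ i ∈ J, ∫⁻ x in gridCell ε i, ‖gradient f x‖ₑ ^ 2 ≤ sobolevSq Ω f := by
    rw [← lintegral_biUnion_finset ((pairwise_disjoint_gridCell ε).set_pairwise _)
      fun i _ => measurableSet_gridCell ε i]
    exact (lintegral_mono_set (iUnion₂_subset hJ)).trans (lintegral_mono fun x => le_add_self)
  have hbounded : ∀ i, Bornology.IsBounded (gridCell ε i) := fun i =>
    Metric.isBounded_iff_ediam_ne_top.2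
      ((ediam_gridCell_le hε i).trans_lt ENNReal.ofReal_lt_top).ne
  calc _ ≤ ∑ i ∈ J, (ENNReal.ofReal (32 * ε ^ 2) * (∫⁻ x in gridCell ε i, ‖gradient f x‖ₑ ^ 2)
          + 2 * (volume (gridCell ε i))⁻¹ * ‖∫ x in gridCell ε i, f x‖ₑ ^ 2) := by
        refine Finset.sum_le_sum fun i _ => (setLIntegral_enorm_sq_le_of_convex volume
          (convex_gridCell hε i) (measurableSet_gridCell ε i) (hbounded i) hf).trans ?_
        gcongr
        exact hdiam i
    _ ≤ _ := by
        rw [Finset.sum_add_distrib, ← Finset.mul_sum]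
        gcongr

theorem exists_means_estimate (hΩ : IsOpen Ω) (hb : Bornology.IsBounded Ω)
    (hL : HasLipschitzBoundary Ω) {η : ℝ} (hη : 0 < η) :
    ∃ (J : Finset (ℤ × ℤ)) (Q : ℤ × ℤ → Set Plane) (c : ℤ × ℤ → NNReal),
      (∀ i ∈ J, MeasurableSet (Q i) ∧ Q i ⊆ Ω) ∧
      ∀ f : Plane → ℝ, ContDiff ℝ ∞ f → ∫⁻ x in Ω, ‖f x‖ₑ ^ 2
        ≤ ENNReal.ofReal η * sobolevSq Ω f + ∑ i ∈ J, c i * ‖∫ x in Q i, f x‖ₑ ^ 2 := by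
  obtain ⟨C, δ₀, hδ₀, hbd⟩ := BoundaryEstimate.univ hΩ hb hL
  obtain ⟨δ, ⟨hδ, hδδ₀⟩, hCδ⟩ : ∃ δ, δ ∈ Ioo 0 δ₀ ∧ C * δ < η / 2 := by
    have hlim : Tendsto (fun δ : ℝ => C * δ) (𝓝[>] 0) (𝓝 0) :=
      ((continuous_const_mul _).tendsto' 0 0 (mul_zero _)).mono_left nhdsWithin_le_nhds
    exact ((eventually_mem_set.2 (Ioo_mem_nhdsGT hδ₀)).and
      (hlim.eventually_lt_const (half_pos hη))).exists
  obtain ⟨ε, ⟨hε, hεδ⟩, hεη⟩ : ∃ ε, ε ∈ Ioo 0 (δ / 2) ∧ 32 * ε ^ 2 < η / 2 := by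
    have hlim : Tendsto (fun ε : ℝ => 32 * ε ^ 2) (𝓝[>] 0) (𝓝 0) :=
      (Continuous.tendsto' (by fun_prop) 0 0 (by simp)).mono_left nhdsWithin_le_nhds
    exact ((eventually_mem_set.2 (Ioo_mem_nhdsGT (half_pos hδ))).and
      (hlim.eventually_lt_const (half_pos hη))).exists
  set J := (finite_gridCell_subset hb hε).toFinset
  have hJ : ∀ i ∈ J, gridCell ε i ⊆ Ω := fun i hi => by simpa [J] using hi
  refine ⟨J, gridCell ε, fun i => (2 * (volume (gridCell ε i))⁻¹).toNNReal,
    fun i hi => ⟨measurableSet_gridCell ε i, hJ i hi⟩, fun f hf => ?_⟩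
  have hcoe : ∀ i, ((2 * (volume (gridCell ε i))⁻¹).toNNReal : ℝ≥0∞)
      = 2 * (volume (gridCell ε i))⁻¹ := fun i =>
    ENNReal.coe_toNNReal (ENNReal.mul_ne_top (by simp)
      (ENNReal.inv_ne_top.2 (volume_gridCell_ne_zero hε i)))
  have hlayer := (hbd f hf).2 δ hδδ₀.le
  rw [inter_univ, ← ENNReal.ofReal_coe_nnreal, ← ENNReal.ofReal_mul NNReal.zero_le_coe] at hlayer
  calc ∫⁻ x in Ω, ‖f x‖ₑ ^ 2
      ≤ (∫⁻ x in Ω ∩ Metric.thickening δ (frontier Ω), ‖f x‖ₑ ^ 2)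
        + ∑ i ∈ J, ∫⁻ x in gridCell ε i, ‖f x‖ₑ ^ 2 := by
        rw [← lintegral_biUnion_finset ((pairwise_disjoint_gridCell ε).set_pairwise _)
          fun i _ => measurableSet_gridCell ε i]
        refine (lintegral_mono_set ?_).trans (lintegral_union_le _ _ _)
        simpa [J] using subset_thickening_union_gridCell hΩ hε (by linarith)
    _ ≤ ENNReal.ofReal (η / 2) * sobolevSq Ω f + (ENNReal.ofReal (η / 2) * sobolevSq Ω f
          + ∑ i ∈ J, 2 * (volume (gridCell ε i))⁻¹ * ‖∫ x in gridCell ε i, f x‖ₑ ^ 2) := by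
        refine add_le_add (hlayer.trans ?_) ((sum_lintegral_gridCell_le hε hJ hf).trans ?_)
        all_goals gcongr
    _ = _ := by
        simp only [hcoe]
        rw [← add_assoc, ← add_mul, ← ENNReal.ofReal_add (by positivity) (by positivity),
          add_halves]

end Grid

/-! ### Traces -/

theorem enorm_sq_eq_lintegral {α E : Type*} [MeasurableSpace α] {μ : Measure α}
    [NormedAddCommGroup E] (f : Lp E 2 μ) : ‖f‖ₑ ^ 2 = ∫⁻ x, ‖f x‖ₑ ^ 2 ∂μ := by
  rw [Lp.enorm_def]
  simpa using eLpNorm_nnreal_pow_eq_lintegral (f := f) (μ := μ) (p := 2) two_ne_zero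

theorem enorm_toLp_sq_eq_lintegral {α E : Type*} [MeasurableSpace α] {μ : Measure α}
    [NormedAddCommGroup E] {f : α → E} (hf : MemLp f 2 μ) :
    ‖hf.toLp f‖ₑ ^ 2 = ∫⁻ x, ‖f x‖ₑ ^ 2 ∂μ := by
  rw [Lp.enorm_toLp]
  simpa using eLpNorm_nnreal_pow_eq_lintegral (f := f) (μ := μ) (p := 2) two_ne_zero

theorem edist_toLp {α E : Type*} [MeasurableSpace α] {μ : Measure α} [NormedAddCommGroup E]
    {f : α → E} (hf : MemLp f 2 μ) (s : Lp E 2 μ) :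
    edist (hf.toLp f) s = eLpNorm (fun x => f x - s x) 2 μ := by
  rw [Lp.edist_def]
  refine eLpNorm_congr_ae ?_
  filter_upwards [hf.coeFn_toLp] with x hx
  rw [Pi.sub_apply, hx]

theorem continuous_setLIntegral_enorm_sq {α E : Type*} [MeasurableSpace α] {μ : Measure α}
    [NormedAddCommGroup E] [NormedSpace ℝ E] (Q : Set α) :
    Continuous fun s : Lp E 2 μ => ∫⁻ x in Q, ‖s x‖ₑ ^ 2 ∂μ := by
  have hrestrict : ∀ s : Lp E 2 μ,
      ∫⁻ x in Q, ‖s x‖ₑ ^ 2 ∂μ = ‖LpToLpRestrictCLM α E ℝ μ 2 Q s‖ₑ ^ 2 := fun s => by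
    rw [enorm_sq_eq_lintegral]
    refine lintegral_congr_ae ?_
    filter_upwards [LpToLpRestrictCLM_coeFn ℝ Q s] with x hx
    rw [hx]
  simp only [hrestrict]
  fun_prop

theorem continuous_setIntegral_Lp_two {α : Type*} [MeasurableSpace α] {μ : Measure α}
    {Q : Set α} (hQ : MeasurableSet Q) (hQμ : μ Q ≠ ⊤) :
    Continuous fun s : Lp ℝ 2 μ => ∫ x in Q, s x ∂μ := by
  simp only [← L2.inner_indicatorConstLp_one hQ hQμ]
  fun_prop

theorem exists_finite_cover_of_totallyBounded_image {X Y : Type*} [PseudoMetricSpace X]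
    [PseudoMetricSpace Y] {f : X → Y} {s : Set X} (hf : TotallyBounded (f '' s)) {δ ε : ℝ}
    (hδ : 0 < δ) (h : ∀ x ∈ s, ∀ y ∈ s, dist (f x) (f y) < δ → dist x y < ε) :
    ∃ t : Set X, t.Finite ∧ s ⊆ ⋃ y ∈ t, Metric.ball y ε := by
  obtain ⟨t, hts, ht, hcover⟩ := exists_subset_image_finite_and.1
    (hf.exists_subset (Metric.dist_mem_uniformity hδ))
  refine ⟨t, ht, fun x hx => ?_⟩
  rw [biUnion_image] at hcover
  obtain ⟨y, hy, hxy⟩ := mem_iUnion₂.1 (hcover (mem_image_of_mem f hx))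
  exact mem_iUnion₂.2 ⟨y, hy, h x hx y (hts hy) hxy⟩

theorem exists_ae_eq_const_of_locally {X Y : Type*} [TopologicalSpace X]
    [SecondCountableTopology X] [MeasurableSpace X] [OpensMeasurableSpace X] {μ : Measure X}
    [μ.IsOpenPosMeasure] {U : Set X} (hU : IsOpen U) (hconn : IsConnected U) {f : X → Y}
    (hf : ∀ x ∈ U, ∃ V, IsOpen V ∧ x ∈ V ∧ ∃ k, ∀ᵐ y ∂μ.restrict V, f y = k) :
    ∃ k, ∀ᵐ x ∂μ.restrict U, f x = k := by
  obtain ⟨x₀, hx₀⟩ := hconn.nonempty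
  obtain ⟨V₀, -, -, k₀, -⟩ := hf x₀ hx₀
  have : Nonempty Y := ⟨k₀⟩
  choose! V hV hxV k hk using hf
  have hnear : ∀ x ∈ U, ∀ y ∈ U, y ∈ V x → k x = k y := fun x hx y hy hyx => by
    have : NeBot (ae (μ.restrict (V x ∩ V y))) := by
      rw [ae_neBot, Ne, Measure.restrict_eq_zero]
      exact (((hV x hx).inter (hV y hy)).measure_pos μ ⟨y, hyx, hxV y hy⟩).ne'
    obtain ⟨z, hzx, hzy⟩ :=
      ((ae_restrict_of_ae_restrict_of_subset inter_subset_left (hk x hx)).and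
        (ae_restrict_of_ae_restrict_of_subset inter_subset_right (hk y hy))).exists
    exact hzx.symm.trans hzy
  have hconst : ∀ x ∈ U, k x = k x₀ := fun x hx => by
    refine hconn.isPreconnected.induction₂ (fun a b => k a = k b) (fun a ha => ?_)
      (fun _ _ _ _ _ _ => Eq.trans) (fun _ _ _ _ => Eq.symm) hx hx₀
    filter_upwards [self_mem_nhdsWithin,
      mem_nhdsWithin_of_mem_nhds ((hV a ha).mem_nhds (hxV a ha))] with b hb hba
    exact hnear a ha b hb hba
  refine ⟨k x₀, ?_⟩
  rw [ae_restrict_iff' hU.measurableSet, ae_iff]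
  refine measure_null_of_locally_null _ fun x hx => ?_
  simp only [Set.mem_ofPred_eq, Classical.not_imp] at hx
  refine ⟨_, inter_mem_nhdsWithin _ ((hV x hx.1).mem_nhds (hxV x hx.1)), ?_⟩
  refine measure_mono_null (fun y hy => ?_)
    (ae_iff.1 ((ae_restrict_iff' (hV x hx.1).measurableSet).1 (hk x hx.1)))
  simp only [Set.mem_inter_iff, Set.mem_ofPred_eq, Classical.not_imp] at hy ⊢
  exact ⟨hy.2, by rw [hconst x hx.1]; exact hy.1.2⟩

namespace Data

variable (D : Data)

section Traces

instance : IsFiniteMeasure D.vol :=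
  isFiniteMeasure_restrict.2 D.isBounded_Ω.measure_lt_top.ne

instance : IsFiniteMeasure D.bd := by
  obtain ⟨C, _, -, h⟩ := BoundaryEstimate.univ D.isOpen_Ω D.isBounded_Ω D.lipschitz_Ω
  refine isFiniteMeasure_restrict.2 (lt_of_le_of_lt ?_
    (ENNReal.mul_lt_top (ENNReal.coe_lt_top (r := C))
      (D.isBounded_Ω.measure_lt_top (μ := volume)))).ne
  simpa [sobolevSq, gradient] using (h (fun _ => 1) contDiff_const).1

theorem memLp_restrict {μ : Measure Plane} {E : Type*} [NormedAddCommGroup E]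
    [SecondCountableTopology E] {A : Set Plane} (hA : MeasurableSet A) (hAΩ : A ⊆ closure D.Ω)
    [IsFiniteMeasure (μ.restrict A)] {f : Plane → E} (hf : Continuous f) :
    MemLp f 2 (μ.restrict A) := by
  obtain ⟨M, hM⟩ :=
    D.isBounded_Ω.isCompact_closure.exists_bound_of_continuousOn hf.continuousOn
  exact MemLp.of_bound hf.aestronglyMeasurable M
    ((ae_restrict_mem hA).mono fun x hx => hM x (hAΩ hx))

theorem memLp_vol {E : Type*} [NormedAddCommGroup E] [SecondCountableTopology E]
    {f : Plane → E} (hf : Continuous f) : MemLp f 2 D.vol :=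
  D.memLp_restrict D.isOpen_Ω.measurableSet subset_closure hf

theorem memLp_bd {f : Plane → ℝ} (hf : Continuous f) : MemLp f 2 D.bd :=
  D.memLp_restrict isClosed_frontier.measurableSet frontier_subset_closure hf

/-- The restriction of a smooth function to `Ω`, its gradient and its boundary values. The triples
of this form are dense among the Sobolev functions with a trace. -/
noncomputable def smoothTriple (f : Plane → ℝ) (hf : ContDiff ℝ ∞ f) : D.Triple :=
  ((D.memLp_vol hf.continuous).toLp f, (D.memLp_vol (continuous_gradient hf)).toLp (gradient f),
    (D.memLp_bd hf.continuous).toLp f)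

theorem edist_smoothTriple {f : Plane → ℝ} (hf : ContDiff ℝ ∞ f) (w : D.Triple) :
    edist (D.smoothTriple f hf) w = max (eLpNorm (fun x => f x - w.1 x) 2 D.vol)
      (max (eLpNorm (fun x => gradient f x - w.2.1 x) 2 D.vol)
        (eLpNorm (fun x => f x - w.2.2 x) 2 D.bd)) := by
  rw [← edist_toLp (D.memLp_vol hf.continuous), ← edist_toLp (D.memLp_vol (continuous_gradient hf)),
    ← edist_toLp (D.memLp_bd hf.continuous)]
  rfl

theorem isTrace_iff_mem_closure (w : D.Triple) : D.IsTrace w.1 w.2.1 w.2.2 ↔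
    w ∈ closure {w | ∃ f hf, D.smoothTriple f hf = w} := by
  rw [EMetric.mem_closure_iff]
  constructor
  · intro h ε hε
    obtain ⟨ε', hε', hlt⟩ := exists_between hε
    obtain ⟨f, hf, hfn, hgrad, htrace⟩ := h ε' hε'
    refine ⟨_, ⟨f, hf, rfl⟩, lt_of_le_of_lt ?_ hlt⟩
    rw [edist_comm, edist_smoothTriple]
    exact max_le hfn (max_le hgrad htrace)
  · intro h ε hε
    obtain ⟨_, ⟨f, hf, rfl⟩, hlt⟩ := h ε hε
    rw [edist_comm, edist_smoothTriple] at hlt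
    obtain ⟨hfn, hgrad, htrace⟩ := by simpa only [max_le_iff] using hlt.le
    exact ⟨f, hf, hfn, hgrad, htrace⟩

theorem isClosed_isTrace : IsClosed {w : D.Triple | D.IsTrace w.1 w.2.1 w.2.2} := by
  simp only [isTrace_iff_mem_closure]
  exact isClosed_closure

theorem isTrace_smoothTriple {f : Plane → ℝ} (hf : ContDiff ℝ ∞ f) :
    D.IsTrace (D.smoothTriple f hf).1 (D.smoothTriple f hf).2.1 (D.smoothTriple f hf).2.2 :=
  (D.isTrace_iff_mem_closure _).2 (subset_closure ⟨f, hf, rfl⟩)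

variable {D}

theorem IsTrace.induction {p : D.Triple → Prop} (hp : IsClosed {w | p w})
    (hsmooth : ∀ f (hf : ContDiff ℝ ∞ f), p (D.smoothTriple f hf)) {w : D.Triple}
    (hw : D.IsTrace w.1 w.2.1 w.2.2) : p w := by
  refine closure_minimal ?_ hp ((D.isTrace_iff_mem_closure w).1 hw)
  rintro _ ⟨f, hf, rfl⟩
  exact hsmooth f hf

theorem IsTrace.sub {w w' : D.Triple} (h : D.IsTrace w.1 w.2.1 w.2.2)
    (h' : D.IsTrace w'.1 w'.2.1 w'.2.2) :
    D.IsTrace (w - w').1 (w - w').2.1 (w - w').2.2 := by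
  simpa [sub_eq_add_neg] using D.isTrace_add h (D.isTrace_smul (-1) h')

theorem sobolevSq_eq_smoothTriple {f : Plane → ℝ} (hf : ContDiff ℝ ∞ f) : sobolevSq D.Ω f
    = ‖(D.smoothTriple f hf).1‖ₑ ^ 2 + ‖(D.smoothTriple f hf).2.1‖ₑ ^ 2 := by
  rw [smoothTriple, enorm_toLp_sq_eq_lintegral, enorm_toLp_sq_eq_lintegral, sobolevSq,
    lintegral_add_left (hf.continuous.measurable.enorm.pow_const 2)]

variable (D)

theorem exists_trace_bound : ∃ C : NNReal, ∀ w : D.Triple, D.IsTrace w.1 w.2.1 w.2.2 →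
    ‖w.2.2‖ ^ 2 ≤ C * (‖w.1‖ ^ 2 + ‖w.2.1‖ ^ 2) := by
  obtain ⟨C, _, -, h⟩ := BoundaryEstimate.univ D.isOpen_Ω D.isBounded_Ω D.lipschitz_Ω
  refine ⟨C, fun w hw => IsTrace.induction (p := fun w : D.Triple =>
    ‖w.2.2‖ ^ 2 ≤ C * (‖w.1‖ ^ 2 + ‖w.2.1‖ ^ 2)) (isClosed_le (by fun_prop) (by fun_prop))
    (fun f hf => ?_) hw⟩
  have hbd := (h f hf).1
  rw [inter_univ, ← enorm_toLp_sq_eq_lintegral (D.memLp_bd hf.continuous),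
    sobolevSq_eq_smoothTriple hf] at hbd
  simp only [enorm_eq_nnnorm] at hbd
  exact_mod_cast hbd

end Traces

section Compactness

variable {D} in
theorem setIntegral_smoothTriple {Q : Set Plane} (hQ : Q ⊆ D.Ω) {f : Plane → ℝ}
    (hf : ContDiff ℝ ∞ f) :
    ∫ x in Q, (D.smoothTriple f hf).1 x ∂D.vol = ∫ x in Q, f x := by
  rw [Measure.restrict_restrict_of_subset hQ]
  exact integral_congr_ae (ae_restrict_of_ae_restrict_of_subset hQ
    (D.memLp_vol hf.continuous).coeFn_toLp)

theorem exists_finite_dimensional_estimate {η : ℝ} (hη : 0 < η) :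
    ∃ (J : Finset (ℤ × ℤ)) (T : Lp ℝ 2 D.vol →L[ℝ] EuclideanSpace ℝ J), ∀ w : D.Triple,
      D.IsTrace w.1 w.2.1 w.2.2 →
        ‖w.1‖ ^ 2 ≤ η * (‖w.1‖ ^ 2 + ‖w.2.1‖ ^ 2) + ‖T w.1‖ ^ 2 := by
  obtain ⟨J, Q, c, hQ, h⟩ := exists_means_estimate D.isOpen_Ω D.isBounded_Ω D.lipschitz_Ω hη
  let T : Lp ℝ 2 D.vol →L[ℝ] EuclideanSpace ℝ J :=
    (EuclideanSpace.equiv J ℝ).symm ∘L ContinuousLinearMap.pi fun i : J =>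
      √(c i) • innerSL ℝ (indicatorConstLp 2 (hQ i i.2).1 (measure_ne_top D.vol (Q i)) (1 : ℝ))
  have hT : ∀ (s : Lp ℝ 2 D.vol) (i : J), T s i = √(c i) * ∫ x in Q i, s x ∂D.vol := fun s i =>
    congrArg (√(c i) * ·) (L2.inner_indicatorConstLp_one (hQ i i.2).1 _ s)
  refine ⟨J, T, fun w hw => IsTrace.induction (p := fun w : D.Triple =>
    ‖w.1‖ ^ 2 ≤ η * (‖w.1‖ ^ 2 + ‖w.2.1‖ ^ 2) + ‖T w.1‖ ^ 2)
    (isClosed_le (by fun_prop) (by fun_prop)) (fun f hf => ?_) hw⟩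
  have hmeans := h f hf
  rw [← enorm_toLp_sq_eq_lintegral (D.memLp_vol hf.continuous), sobolevSq_eq_smoothTriple hf,
    ← Finset.sum_coe_sort] at hmeans
  lift η to NNReal using hη.le
  simp only [enorm_eq_nnnorm, ENNReal.ofReal_coe_nnreal] at hmeans
  rw [EuclideanSpace.norm_sq_eq]
  simp only [hT, norm_mul, mul_pow, setIntegral_smoothTriple (hQ _ (Subtype.coe_prop _)).2,
    Real.norm_of_nonneg (Real.sqrt_nonneg _), Real.sq_sqrt (NNReal.coe_nonneg _)]
  norm_cast at hmeans
  refine (NNReal.coe_le_coe.2 hmeans).trans_eq ?_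
  simp only [NNReal.coe_add, NNReal.coe_mul, NNReal.coe_pow, NNReal.coe_sum, coe_nnnorm]

theorem totallyBounded_fn (R : ℝ) : TotallyBounded {s : Lp ℝ 2 D.vol | ∃ w : D.Triple,
    D.IsTrace w.1 w.2.1 w.2.2 ∧ ‖w.1‖ ≤ R ∧ ‖w.2.1‖ ≤ R ∧ w.1 = s} := by
  refine Metric.totallyBounded_iff.2 fun ε hε => ?_
  obtain ⟨J, T, hT⟩ := D.exists_finite_dimensional_estimate (η := ε ^ 2 / (16 * (R ^ 2 + 1)))
    (by positivity)
  have hbounded : Bornology.IsBounded {s : Lp ℝ 2 D.vol | ∃ w : D.Triple,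
      D.IsTrace w.1 w.2.1 w.2.2 ∧ ‖w.1‖ ≤ R ∧ ‖w.2.1‖ ≤ R ∧ w.1 = s} :=
    isBounded_iff_forall_norm_le.2 ⟨R, by rintro _ ⟨w, -, hw, -, rfl⟩; exact hw⟩
  refine exists_finite_cover_of_totallyBounded_image
    ((T.lipschitz.isBounded_image hbounded).isCompact_closure.totallyBounded.subset subset_closure)
    (half_pos hε) ?_
  rintro _ ⟨w, hw, hwR, hwR', rfl⟩ _ ⟨v, hv, hvR, hvR', rfl⟩ hlt
  rw [dist_eq_norm, ← map_sub] at hlt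
  rw [dist_eq_norm]
  have hfn : ‖(w - v).1‖ ^ 2 ≤ (2 * R) ^ 2 := by
    gcongr; exact (norm_sub_le _ _).trans (by linarith)
  have hgrad : ‖(w - v).2.1‖ ^ 2 ≤ (2 * R) ^ 2 := by
    gcongr; exact (norm_sub_le _ _).trans (by linarith)
  refine lt_of_pow_lt_pow_left₀ 2 hε.le ?_
  calc ‖(w - v).1‖ ^ 2
      ≤ ε ^ 2 / (16 * (R ^ 2 + 1)) * (‖(w - v).1‖ ^ 2 + ‖(w - v).2.1‖ ^ 2) + ‖T (w - v).1‖ ^ 2 :=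
        hT (w - v) (hw.sub hv)
    _ ≤ ε ^ 2 / (16 * (R ^ 2 + 1)) * (8 * (R ^ 2 + 1)) + (ε / 2) ^ 2 := by
        gcongr
        · linarith
        · exact hlt.le
    _ = ε ^ 2 * (3 / 4) := by field_simp; norm_num
    _ < ε ^ 2 := by nlinarith [sq_pos_of_pos hε]

variable {D}

theorem IsTrace.setLIntegral_enorm_sq_le_of_convex {Q : Set Plane} (hQ : Convex ℝ Q)
    (hQm : MeasurableSet Q) (hQΩ : Q ⊆ D.Ω) (hQ0 : volume Q ≠ 0) {w : D.Triple}
    (hw : D.IsTrace w.1 w.2.1 w.2.2) :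
    ∫⁻ x in Q, ‖w.1 x‖ₑ ^ 2 ∂D.vol
      ≤ 2 * 2 ^ Module.finrank ℝ Plane * Metric.ediam Q ^ 2 * (∫⁻ x in Q, ‖w.2.1 x‖ₑ ^ 2 ∂D.vol)
        + 2 * (volume Q)⁻¹ * ‖∫ x in Q, w.1 x ∂D.vol‖ₑ ^ 2 := by
  have hbounded : Bornology.IsBounded Q := D.isBounded_Ω.subset hQΩ
  have hdiam : 2 * 2 ^ Module.finrank ℝ Plane * Metric.ediam Q ^ 2 ≠ ⊤ :=
    ENNReal.mul_ne_top (ENNReal.mul_ne_top (by simp) (ENNReal.pow_ne_top (by simp)))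
      (ENNReal.pow_ne_top (Metric.isBounded_iff_ediam_ne_top.1 hbounded))
  have hinv : 2 * (volume Q)⁻¹ ≠ ⊤ := ENNReal.mul_ne_top (by simp) (ENNReal.inv_ne_top.2 hQ0)
  have hmean := continuous_setIntegral_Lp_two hQm (measure_ne_top D.vol Q)
  refine IsTrace.induction (p := fun w : D.Triple => ∫⁻ x in Q, ‖w.1 x‖ₑ ^ 2 ∂D.vol
      ≤ 2 * 2 ^ Module.finrank ℝ Plane * Metric.ediam Q ^ 2 * (∫⁻ x in Q, ‖w.2.1 x‖ₑ ^ 2 ∂D.vol)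
        + 2 * (volume Q)⁻¹ * ‖∫ x in Q, w.1 x ∂D.vol‖ₑ ^ 2) ?_ (fun f hf => ?_) hw
  · refine isClosed_le ((continuous_setLIntegral_enorm_sq Q).comp continuous_fst)
      (((ENNReal.continuous_const_mul hdiam).comp
        ((continuous_setLIntegral_enorm_sq Q).comp (continuous_fst.comp continuous_snd))).add
      ((ENNReal.continuous_const_mul hinv).comp ?_))
    exact (ENNReal.continuous_pow 2).comp (hmean.comp continuous_fst).enorm
  · have hfn := ae_restrict_of_ae_restrict_of_subset hQΩ (D.memLp_vol hf.continuous).coeFn_toLp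
    have hgrad := ae_restrict_of_ae_restrict_of_subset hQΩ
      (D.memLp_vol (continuous_gradient hf)).coeFn_toLp
    rw [setIntegral_smoothTriple hQΩ, Measure.restrict_restrict_of_subset hQΩ]
    convert Graetz.setLIntegral_enorm_sq_le_of_convex volume hQ hQm hbounded hf using 1
    · exact lintegral_congr_ae (hfn.mono fun x hx => congrArg (‖·‖ₑ ^ 2) hx)
    · congr 2
      exact lintegral_congr_ae (hgrad.mono fun x hx => congrArg (‖·‖ₑ ^ 2) hx)

theorem IsTrace.exists_ae_eq_const_of_convex {Q : Set Plane} (hQ : Convex ℝ Q)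
    (hQm : MeasurableSet Q) (hQΩ : Q ⊆ D.Ω) (hQ0 : volume Q ≠ 0) {s : Lp ℝ 2 D.vol}
    {g : Lp ℝ 2 D.bd} (h : D.IsTrace s 0 g) : ∃ k, ∀ᵐ x ∂volume.restrict Q, s x = k := by
  set k : ℝ := ⨍ x in Q, s x
  have hk : ContDiff ℝ ∞ fun _ : Plane => k := contDiff_const
  refine ⟨k, ?_⟩
  set w : D.Triple := (s, 0, g) - D.smoothTriple _ hk
  have hw : D.IsTrace w.1 w.2.1 w.2.2 := IsTrace.sub (w := (s, 0, g)) h (D.isTrace_smoothTriple hk)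
  have hw1 : ∀ᵐ x ∂volume.restrict Q, w.1 x = s x - k := by
    refine ae_restrict_of_ae_restrict_of_subset hQΩ ?_
    filter_upwards [Lp.coeFn_sub s (D.smoothTriple _ hk).1,
      (D.memLp_vol hk.continuous).coeFn_toLp] with x hsub hconst
    exact hsub.trans (congrArg (s x - ·) hconst)
  have hgrad : ∫⁻ x in Q, ‖w.2.1 x‖ₑ ^ 2 ∂D.vol = 0 := by
    have hzero : w.2.1 = 0 := by simp [w, smoothTriple]
    refine le_antisymm ((setLIntegral_le_lintegral Q _).trans_eq ?_) zero_le
    rw [← enorm_sq_eq_lintegral, hzero, enorm_zero, zero_pow two_ne_zero]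
  have hmean : ∫ x in Q, w.1 x ∂D.vol = 0 := by
    rw [Measure.restrict_restrict_of_subset hQΩ, integral_congr_ae hw1]
    exact setAverage_sub_setAverage (D.isBounded_Ω.subset hQΩ).measure_lt_top.ne s
  have hzero := hw.setLIntegral_enorm_sq_le_of_convex hQ hQm hQΩ hQ0
  rw [hgrad, hmean, enorm_zero, zero_pow two_ne_zero, mul_zero, mul_zero, add_zero,
    Measure.restrict_restrict_of_subset hQΩ, nonpos_iff_eq_zero, lintegral_eq_zero_iff'] at hzero
  · filter_upwards [hzero, hw1] with x hx hx1
    simpa [hx1, sub_eq_zero] using hx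
  · exact ((Lp.aestronglyMeasurable w.1).mono_measure
      (Measure.restrict_mono hQΩ le_rfl)).enorm.pow_const 2

theorem IsTrace.exists_ae_eq_const {s : Lp ℝ 2 D.vol} {g : Lp ℝ 2 D.bd}
    (h : D.IsTrace s 0 g) : ∃ k : ℝ, ∀ᵐ x ∂D.vol, s x = k := by
  refine exists_ae_eq_const_of_locally D.isOpen_Ω D.isConnected_Ω fun x hx => ?_
  obtain ⟨r, hr, hrΩ⟩ := Metric.isOpen_iff.1 D.isOpen_Ω x hx
  exact ⟨Metric.ball x r, Metric.isOpen_ball, Metric.mem_ball_self hr,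
    h.exists_ae_eq_const_of_convex (convex_ball x r) Metric.isOpen_ball.measurableSet hrΩ
      (Metric.measure_ball_pos volume x hr).ne'⟩

end Compactness

end Data

/-! ### The energy form -/

section Gradient

variable {E : Type*} [NormedAddCommGroup E] [InnerProductSpace ℝ E] [FiniteDimensional ℝ E]
  [MeasurableSpace E] [BorelSpace E] (μ : Measure E) [μ.IsAddHaarMeasure]

theorem integral_gradient_eq_zero {φ : E → ℝ} (hφ : ContDiff ℝ ∞ φ) (hc : HasCompactSupport φ) :
    ∫ x, gradient φ x ∂μ = 0 := by
  have hcompact : HasCompactSupport (gradient φ) :=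
    (hc.fderiv (𝕜 := ℝ)).comp_left (map_zero (InnerProductSpace.toDual ℝ E).symm)
  have hint : Integrable (gradient φ) μ :=
    (continuous_gradient hφ).integrable_of_hasCompactSupport hcompact
  refine ext_inner_left ℝ fun v => ?_
  have hfderiv (x : E) : inner ℝ v (gradient φ x) = fderiv ℝ φ x v := by
    rw [real_inner_comm, gradient, InnerProductSpace.toDual_symm_apply]
  have hparts := integral_mul_fderiv_eq_neg_fderiv_mul_of_integrable (μ := μ)
    (f := fun _ => (1 : ℝ)) (g := φ) (v := v) (by simp)
    (by simpa only [one_mul, ← hfderiv] using hint.const_inner v)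
    (by simpa using hφ.continuous.integrable_of_hasCompactSupport hc)
    (fun x _ => by fun_prop) (fun x _ => hφ.differentiable (by simp) x)
  simpa [← integral_inner hint, hfderiv] using hparts

end Gradient

section WeightedIntegral

variable {α E : Type*} [MeasurableSpace α] {μ : Measure α} [NormedAddCommGroup E]
  [InnerProductSpace ℝ E] {w : α → ℝ} (G : Lp E 2 μ)

theorem mul_norm_sq_le_integral_mul_inner {m : ℝ} (hm : ∀ᵐ x ∂μ, m ≤ w x)
    (hint : Integrable (fun x => w x * inner ℝ (G x) (G x)) μ) :
    m * ‖G‖ ^ 2 ≤ ∫ x, w x * inner ℝ (G x) (G x) ∂μ := by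
  rw [← real_inner_self_eq_norm_sq, L2.inner_def, ← integral_const_mul]
  exact integral_mono_ae ((L2.integrable_inner (𝕜 := ℝ) G G).const_mul m) hint
    (hm.mono fun x hx => mul_le_mul_of_nonneg_right hx real_inner_self_nonneg)

theorem integral_mul_inner_le_mul_norm_sq {M : ℝ} (hM : ∀ᵐ x ∂μ, w x ≤ M)
    (hint : Integrable (fun x => w x * inner ℝ (G x) (G x)) μ) :
    ∫ x, w x * inner ℝ (G x) (G x) ∂μ ≤ M * ‖G‖ ^ 2 := by
  rw [← real_inner_self_eq_norm_sq, L2.inner_def, ← integral_const_mul]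
  exact integral_mono_ae hint ((L2.integrable_inner (𝕜 := ℝ) G G).const_mul M)
    (hM.mono fun x hx => mul_le_mul_of_nonneg_right hx real_inner_self_nonneg)

end WeightedIntegral

namespace Data

variable (D : Data)

theorem setIntegral_gradient_eq_zero {φ : Plane → ℝ} (hφ : ContDiff ℝ ∞ φ)
    (hc : HasCompactSupport φ) (hs : tsupport φ ⊆ D.Ω) : ∫ x in D.Ω, gradient φ x = 0 := by
  rw [← integral_gradient_eq_zero volume hφ hc]
  refine setIntegral_eq_integral_of_forall_compl_eq_zero fun x hx => ?_
  have hx' : x ∉ tsupport (fderiv ℝ φ) := fun h => hx (hs (tsupport_fderiv_subset ℝ h))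
  rw [gradient, image_eq_zero_of_notMem_tsupport hx', map_zero]

theorem isClosed_isWeakGradient : IsClosed {w : D.Triple | D.IsWeakGradient w.1 w.2.1} := by
  simp only [IsWeakGradient, Set.ofPred_forall]
  refine isClosed_iInter fun φ => isClosed_iInter fun hφ => isClosed_iInter fun _ =>
    isClosed_iInter fun _ => ?_
  have hφL := D.memLp_vol hφ.continuous
  have hgradL := D.memLp_vol (continuous_gradient hφ)
  let pairing := (ContinuousLinearMap.lsmul ℝ ℝ (E := Plane)).lpPairing D.vol 2 2
  have hleft (s : Lp ℝ 2 D.vol) :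
      ∫ x in D.Ω, s x • gradient φ x = pairing s (hgradL.toLp _) := by
    rw [ContinuousLinearMap.lpPairing_eq_integral]
    exact integral_congr_ae (hgradL.coeFn_toLp.mono fun x hx => congrArg (s x • ·) hx.symm)
  have hright (G : Lp Plane 2 D.vol) : ∫ x in D.Ω, φ x • G x = pairing (hφL.toLp _) G := by
    rw [ContinuousLinearMap.lpPairing_eq_integral]
    exact integral_congr_ae (hφL.coeFn_toLp.mono fun x hx => congrArg (· • G x) hx.symm)
  simp only [hleft, hright]
  exact isClosed_eq (by fun_prop) (by fun_prop)

theorem isClosed_boundaryConditions :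
    IsClosed {g : Lp ℝ 2 D.bd | D.VanishesOnDirichlet g ∧ D.IsPeriodic g} := by
  refine IsSeqClosed.isClosed fun g g₀ hg hlim => ?_
  obtain ⟨ns, -, hns⟩ := (tendstoInMeasure_of_tendsto_Lp hlim).exists_seq_tendsto_ae
  refine ⟨?_, fun j => ?_⟩
  · have hzero : ∀ᵐ x ∂(len.restrict D.ΓD), ∀ n, g n x = 0 := ae_all_iff.2 fun n => (hg n).1
    filter_upwards [hzero, ae_restrict_of_ae_restrict_of_subset D.ΓD_subset hns] with x hx hlimx
    exact tendsto_nhds_unique hlimx (by simp only [hx, tendsto_const_nhds])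
  · have hperiodic : ∀ᵐ x ∂(len.restrict (D.piece j)), ∀ n, g n (x + D.shift j) = g n x :=
      ae_all_iff.2 fun n => (hg n).2 j
    filter_upwards [hperiodic, D.ae_piece hns j, D.ae_shift hns j] with x hx hlimx hlimshift
    simp only [hx] at hlimshift
    exact tendsto_nhds_unique hlimshift hlimx

theorem isClosed_sobolev : IsClosed (D.sobolev : Set D.Triple) :=
  D.isClosed_isWeakGradient.inter (D.isClosed_isTrace.inter
    (D.isClosed_boundaryConditions.preimage (continuous_snd.comp continuous_snd)))

instance : CompleteSpace D.sobolev := D.isClosed_sobolev.completeSpace_coe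

theorem smoothTriple_const_fn (k : ℝ) :
    ∀ᵐ x ∂D.vol, (D.smoothTriple (fun _ => k) contDiff_const).1 x = k :=
  (D.memLp_vol continuous_const).coeFn_toLp

theorem smoothTriple_const_trace (k : ℝ) :
    ∀ᵐ x ∂D.bd, (D.smoothTriple (fun _ => k) contDiff_const).2.2 x = k :=
  (D.memLp_bd continuous_const).coeFn_toLp

theorem smoothTriple_const_grad (k : ℝ) :
    (D.smoothTriple (fun _ => k) contDiff_const).2.1 = 0 := by
  simp [smoothTriple]

variable {D}

theorem isWeakGradient_zero_of_ae_eq_const {s : Lp ℝ 2 D.vol} {k : ℝ}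
    (hk : ∀ᵐ x ∂D.vol, s x = k) : D.IsWeakGradient s 0 := by
  intro φ hφ hc hs
  have hleft : ∫ x in D.Ω, s x • gradient φ x = 0 := by
    rw [integral_congr_ae (hk.mono fun x hx => congrArg (· • gradient φ x) hx), integral_smul,
      D.setIntegral_gradient_eq_zero hφ hc hs, smul_zero]
  have hright : ∫ x in D.Ω, φ x • (0 : Lp Plane 2 D.vol) x = 0 :=
    integral_eq_zero_of_ae ((Lp.coeFn_zero Plane 2 D.vol).mono fun x hx => by
      simp only [hx, Pi.zero_apply, smul_zero])
  exact hleft.trans (neg_eq_zero.2 hright).symm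

theorem IsWeakGradient.unique {s : Lp ℝ 2 D.vol} {G G' : Lp Plane 2 D.vol}
    (h : D.IsWeakGradient s G) (h' : D.IsWeakGradient s G') : G = G' := by
  have hint (G : Lp Plane 2 D.vol) : IntegrableOn G D.Ω :=
    (Lp.memLp G).integrable (by norm_num)
  have hsmul {φ : Plane → ℝ} (hφ : ContDiff ℝ ∞ φ) (hc : HasCompactSupport φ)
      (G : Lp Plane 2 D.vol) : IntegrableOn (fun x => φ x • G x) D.Ω :=
    D.integrable_smul_grad G hφ hc
  have hzero : ∀ᵐ x, x ∈ D.Ω → (G x - G' x) = 0 :=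
    D.isOpen_Ω.ae_eq_zero_of_integral_contDiff_smul_eq_zero
      ((hint G).sub (hint G')).locallyIntegrableOn fun φ hφ hc hs => ?_
  · exact Lp.ext ((ae_restrict_iff' D.isOpen_Ω.measurableSet).2
      (hzero.mono fun x hx hxΩ => sub_eq_zero.1 (hx hxΩ)))
  rw [← setIntegral_eq_integral_of_forall_compl_eq_zero (s := D.Ω) fun x hx => by
    rw [image_eq_zero_of_notMem_tsupport (mt (@hs x) hx), zero_smul]]
  simp only [smul_sub]
  rw [integral_sub (hsmul hφ hc G) (hsmul hφ hc G'), sub_eq_zero]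
  exact neg_injective ((h φ hφ hc hs).symm.trans (h' φ hφ hc hs))

theorem IsTrace.unique {s : Lp ℝ 2 D.vol} {G : Lp Plane 2 D.vol} {g g' : Lp ℝ 2 D.bd}
    (h : D.IsTrace s G g) (h' : D.IsTrace s G g') : g = g' := by
  obtain ⟨C, hC⟩ := D.exists_trace_bound
  have hsq := hC _ (IsTrace.sub (w := (s, G, g)) (w' := (s, G, g')) h h')
  have hzero : ‖g - g'‖ ^ 2 ≤ 0 := by simpa using hsq
  exact sub_eq_zero.1 (norm_eq_zero.1 (pow_eq_zero_iff two_ne_zero |>.1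
    (hzero.antisymm (sq_nonneg _))))

theorem V.isWeakGradient (s : D.V) : D.IsWeakGradient s.fn s.grad := s.2.1

theorem V.isTrace (s : D.V) : D.IsTrace s.fn s.grad s.trace := s.2.2.1

theorem V.vanishesOnDirichlet (s : D.V) : D.VanishesOnDirichlet s.trace := s.2.2.2.1

theorem V.grad_eq_zero_of_ae_eq_const (s : D.V) {k : ℝ} (hk : ∀ᵐ x ∂D.vol, s.fn x = k) :
    s.grad = 0 :=
  s.isWeakGradient.unique (isWeakGradient_zero_of_ae_eq_const hk)

theorem V.trace_ae_eq_of_ae_eq_const (s : D.V) {k : ℝ} (hk : ∀ᵐ x ∂D.vol, s.fn x = k) :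
    ∀ᵐ x ∂D.bd, s.trace x = k := by
  have hfn : s.fn = (D.smoothTriple (fun _ => k) contDiff_const).1 :=
    Lp.ext (EventuallyEq.trans hk (EventuallyEq.symm (D.smoothTriple_const_fn k)))
  have htrace := s.isTrace
  rw [s.grad_eq_zero_of_ae_eq_const hk, ← D.smoothTriple_const_grad k, hfn] at htrace
  rw [htrace.unique (D.isTrace_smoothTriple _)]
  exact D.smoothTriple_const_trace k

section Energy

theorem norm_sq_eq_energy (s : D.V) : ‖s‖ ^ 2 = energy s s := (real_inner_self_eq_norm_sq s).symm

theorem setIntegral_ΓR_eq (g : Lp ℝ 2 D.bd) : ∫ x in D.ΓR, D.a x * (g x * g x) ∂len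
    = ∫ x, D.ΓR.indicator D.a x * inner ℝ (g x) (g x) ∂D.bd := by
  rw [← bd_restrict, ← integral_indicator D.measurableSet_ΓR]
  exact integral_congr_ae (ae_of_all _ fun x => indicator_mul_left D.ΓR D.a _)

theorem integrable_indicator_ΓR (g : Lp ℝ 2 D.bd) :
    Integrable (fun x => D.ΓR.indicator D.a x * inner ℝ (g x) (g x)) D.bd := by
  have hint : IntegrableOn (fun x => D.a x * (g x * g x)) D.ΓR D.bd := by
    rw [IntegrableOn, bd_restrict]
    exact integrable_trace g g
  exact (hint.integrable_indicator D.measurableSet_ΓR).congr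
    (ae_of_all _ fun x => indicator_mul_left D.ΓR D.a _)

variable (D)

theorem exists_norm_grad_le : ∃ C : NNReal, ∀ s : D.V, ‖s.grad‖ ≤ C * ‖s‖ := by
  obtain ⟨m, M, hm, hσ⟩ := D.σ_bound
  refine ⟨NNReal.mk (√m)⁻¹ (by positivity), fun s => ?_⟩
  have hgrad := mul_norm_sq_le_integral_mul_inner s.grad (hσ.mono fun x hx => hx.1)
    (integrable_grad s.grad s.grad)
  have hrobin : 0 * ‖s.trace‖ ^ 2 ≤ _ := mul_norm_sq_le_integral_mul_inner s.trace
    (ae_of_all _ (indicator_nonneg fun x hx => (D.a_bound.choose_spec x hx).1.le))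
    (integrable_indicator_ΓR s.trace)
  rw [← setIntegral_ΓR_eq, zero_mul] at hrobin
  have hle : m * ‖s.grad‖ ^ 2 ≤ ‖s‖ ^ 2 := by
    rw [norm_sq_eq_energy, energy]
    exact hgrad.trans (le_add_of_nonneg_right hrobin)
  rw [NNReal.coe_mk, inv_mul_eq_div, le_div_iff₀ (Real.sqrt_pos.2 hm)]
  refine le_of_sq_le_sq ?_ (norm_nonneg _)
  rwa [mul_pow, Real.sq_sqrt hm.le, mul_comm]

theorem exists_norm_le_norm_coe : ∃ C : NNReal, ∀ s : D.V, ‖s‖ ≤ C * ‖(s.1 : D.Triple)‖ := by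
  obtain ⟨m, M, -, hσ⟩ := D.σ_bound
  obtain ⟨A, ha⟩ := D.a_bound
  refine ⟨NNReal.mk √(|M| + |A|) (by positivity), fun s => ?_⟩
  have hgrad := integral_mul_inner_le_mul_norm_sq s.grad
    (hσ.mono fun x hx => hx.2.trans (le_abs_self M)) (integrable_grad s.grad s.grad)
  have hrobin := integral_mul_inner_le_mul_norm_sq s.trace
    (ae_of_all _ (indicator_le' (fun x hx => (ha x hx).2.trans (le_abs_self A))
      fun x _ => abs_nonneg A)) (integrable_indicator_ΓR s.trace)
  rw [← setIntegral_ΓR_eq] at hrobin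
  have hG : ‖s.grad‖ ≤ ‖(s.1 : D.Triple)‖ := (norm_fst_le s.1.2).trans (norm_snd_le s.1)
  have hg : ‖s.trace‖ ≤ ‖(s.1 : D.Triple)‖ := (norm_snd_le s.1.2).trans (norm_snd_le s.1)
  refine le_of_sq_le_sq ?_ (by positivity)
  rw [NNReal.coe_mk, mul_pow, Real.sq_sqrt (by positivity)]
  calc ‖s‖ ^ 2 ≤ |M| * ‖s.grad‖ ^ 2 + |A| * ‖s.trace‖ ^ 2 := by
        rw [norm_sq_eq_energy, energy]
        exact add_le_add hgrad hrobin
    _ ≤ |M| * ‖(s.1 : D.Triple)‖ ^ 2 + |A| * ‖(s.1 : D.Triple)‖ ^ 2 := by gcongr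
    _ = (|M| + |A|) * ‖(s.1 : D.Triple)‖ ^ 2 := by ring

theorem setIntegral_a_eq_zero_iff : ∫ x in D.ΓR, D.a x ∂len = 0 ↔ len D.ΓR = 0 := by
  obtain ⟨A, ha⟩ := D.a_bound
  have hint : IntegrableOn D.a D.ΓR len := by
    rw [IntegrableOn, ← bd_restrict]
    refine Integrable.of_bound D.measurable_a.aestronglyMeasurable A ?_
    filter_upwards [ae_restrict_mem D.measurableSet_ΓR] with x hx
    rw [Real.norm_eq_abs, abs_of_pos (ha x hx).1]
    exact (ha x hx).2
  have hsupport : Function.support D.a ∩ D.ΓR = D.ΓR :=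
    inter_eq_right.2 fun x hx => (ha x hx).1.ne'
  have hpos := setIntegral_pos_iff_support_of_nonneg_ae
    (ae_restrict_of_forall_mem D.measurableSet_ΓR fun x hx => (ha x hx).1.le) hint
  rw [hsupport] at hpos
  have hnonneg := setIntegral_nonneg (μ := len) D.measurableSet_ΓR fun x hx => (ha x hx).1.le
  rw [← not_iff_not, ← ne_eq, ← hnonneg.lt_iff_ne', hpos, pos_iff_ne_zero]

variable {D}

theorem energy_self_of_ae_eq_const {s : D.V} {k : ℝ} (hk : ∀ᵐ x ∂D.vol, s.fn x = k) :
    energy s s = (∫ x in D.ΓR, D.a x ∂len) * (k * k) := by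
  have hgrad : ∫ x in D.Ω, D.σ x * inner ℝ (s.grad x) (s.grad x) = 0 := by
    rw [s.grad_eq_zero_of_ae_eq_const hk]
    exact integral_eq_zero_of_ae ((Lp.coeFn_zero Plane 2 D.vol).mono fun x hx => by
      simp only [hx, Pi.zero_apply, inner_zero_left, mul_zero])
  rw [energy, hgrad, zero_add, ← integral_mul_const]
  exact integral_congr_ae ((ae_ΓR (s.trace_ae_eq_of_ae_eq_const hk)).mono fun x hx => by
    simp only [hx])

theorem V.len_ΓD_eq_zero_of_ae_eq_const (s : D.V) {k : ℝ} (hk : ∀ᵐ x ∂D.vol, s.fn x = k)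
    (hk0 : k ≠ 0) : len D.ΓD = 0 := by
  rw [← Measure.restrict_eq_zero, ← ae_eq_bot, ← Filter.empty_mem_iff_bot]
  filter_upwards [s.vanishesOnDirichlet, ae_restrict_of_ae_restrict_of_subset D.ΓD_subset
    (s.trace_ae_eq_of_ae_eq_const hk)] with x hzero hconst
  exact hk0 (hconst.symm.trans hzero)

theorem not_constantsControlled_iff :
    ¬ D.ConstantsControlled ↔ len D.ΓD = 0 ∧ len D.ΓR = 0 := by
  rw [ConstantsControlled, not_lt, nonpos_iff_eq_zero, measure_union_null_iff]

theorem energy_eq_zero_iff (s : D.V) : energy s s = 0 ↔ D.IsNegligible s := by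
  constructor
  · intro h
    obtain ⟨C, hC⟩ := D.exists_norm_grad_le
    have hgrad : s.grad = 0 := by
      rw [← norm_sq_eq_energy, sq_eq_zero_iff] at h
      simpa [h] using hC s
    obtain ⟨k, hk⟩ := (hgrad ▸ s.isTrace).exists_ae_eq_const
    rw [energy_self_of_ae_eq_const hk, mul_eq_zero, setIntegral_a_eq_zero_iff,
      mul_self_eq_zero] at h
    rcases eq_or_ne k 0 with rfl | hk0
    · exact Or.inl hk
    · exact Or.inr ⟨not_constantsControlled_iff.2
        ⟨s.len_ΓD_eq_zero_of_ae_eq_const hk hk0, h.resolve_right hk0⟩, k, hk⟩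
  · rintro (h | ⟨hcon, k, hk⟩)
    · rw [energy_self_of_ae_eq_const h, mul_zero, mul_zero]
    · rw [energy_self_of_ae_eq_const hk,
        D.setIntegral_a_eq_zero_iff.2 (not_constantsControlled_iff.1 hcon).2, zero_mul]

end Energy

end Data

/-! ### Compactness of the energy space in `L²` -/

section CompactPerturbation

variable {X Y F : Type*} [NormedAddCommGroup X] [NormedSpace ℝ X] [NormedAddCommGroup Y]
  [NormedSpace ℝ Y] [NormedAddCommGroup F] [NormedSpace ℝ F]

theorem isCompactOperator_of_totallyBounded_image [CompleteSpace Y] {f : X →L[ℝ] Y}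
    (hf : TotallyBounded (f '' Metric.closedBall 0 1)) : IsCompactOperator f :=
  (isCompactOperator_iff_isCompact_closure_image_closedBall (f : X →ₗ[ℝ] Y) one_pos).2
    (hf.closure.isCompact_of_isClosed isClosed_closure)

theorem isCompactOperator_prod {f : X →L[ℝ] Y} {g : X →L[ℝ] F} (hf : IsCompactOperator f)
    (hg : IsCompactOperator g) : IsCompactOperator (f.prod g) := by
  have hsum : ⇑(f.prod g)
      = ContinuousLinearMap.inl ℝ Y F ∘ f + ContinuousLinearMap.inr ℝ Y F ∘ g :=
    funext fun x => Prod.ext (add_zero _).symm (zero_add _).symm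
  rw [hsum]
  exact (hf.clm_comp _).add (hg.clm_comp _)

theorem finiteDimensional_of_isCompactOperator_of_antilipschitzWith {K : X →L[ℝ] Y}
    (hK : IsCompactOperator K) {C : NNReal} (hC : AntilipschitzWith C K) :
    FiniteDimensional ℝ X := by
  obtain ⟨S, hS, hKS⟩ :=
    IsCompactOperator.image_closedBall_subset_compact (f := (K : X →ₗ[ℝ] Y)) hK 1
  exact FiniteDimensional.of_totallyBounded_nhds_zero ℝ
    (Metric.closedBall_mem_nhds (0 : X) one_pos)
    ((totallyBounded_preimage (hC.isUniformInducing K.uniformContinuous)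
      hS.totallyBounded).subset (image_subset_iff.1 hKS))

theorem finiteDimensional_ker_of_norm_le {T : X →L[ℝ] F} {K : X →L[ℝ] Y}
    (hK : IsCompactOperator K) {C : NNReal} (hC : ∀ x, ‖x‖ ≤ C * max ‖K x‖ ‖T x‖) :
    FiniteDimensional ℝ T.ker :=
  finiteDimensional_of_isCompactOperator_of_antilipschitzWith (K := K ∘L T.ker.subtypeL)
    (hK.comp_clm T.ker.subtypeL) <|
    (K ∘L T.ker.subtypeL).antilipschitz_of_bound fun x => by
      simpa [show T x = 0 from x.2] using hC x

variable [CompleteSpace X]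

theorem exists_antilipschitzWith_of_norm_le {T : X →L[ℝ] F} (hT : Function.Injective T)
    {K : X →L[ℝ] Y} (hK : IsCompactOperator K) {C : NNReal}
    (hC : ∀ x, ‖x‖ ≤ C * max ‖K x‖ ‖T x‖) : ∃ M, AntilipschitzWith M T := by
  by_contra! hM
  have hbasis := (Metric.nhds_basis_ball (x := (0 : F))).comap T
  have hfrequently : ∃ᶠ x in comap T (𝓝 0), x ∈ Metric.sphere (0 : X) 1 := by
    refine hbasis.frequently_iff.2 fun ε hε => ?_
    lift ε to NNReal using hε.le
    obtain ⟨x, hx⟩ : ∃ x, (ε⁻¹ : NNReal) * ‖T x‖ < ‖x‖ := by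
      by_contra! h
      exact hM _ (T.antilipschitz_of_bound h)
    have hx0 : 0 < ‖x‖ := (by positivity : (0 : ℝ) ≤ (ε⁻¹ : NNReal) * ‖T x‖).trans_lt hx
    refine ⟨‖x‖⁻¹ • x, ?_, ?_⟩
    · rw [NNReal.coe_inv, inv_mul_lt_iff₀ hε] at hx
      simpa [norm_smul, inv_mul_lt_iff₀ hx0, mul_comm] using hx
    · simp [norm_smul, hx0.ne']
  have : (comap T (𝓝 0) ⊓ 𝓟 (Metric.sphere (0 : X) 1)).NeBot :=
    frequently_mem_iff_neBot.1 hfrequently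
  let U := Ultrafilter.of (comap T (𝓝 0) ⊓ 𝓟 (Metric.sphere (0 : X) 1))
  have hTU : Tendsto T U (𝓝 0) := tendsto_iff_comap.2 ((Ultrafilter.of_le _).trans inf_le_left)
  have hU : (U : Filter X) ≤ 𝓟 (Metric.sphere 0 1) := (Ultrafilter.of_le _).trans inf_le_right
  obtain ⟨S, hS, hKS⟩ :=
    IsCompactOperator.image_closedBall_subset_compact (f := (K : X →ₗ[ℝ] Y)) hK 1
  obtain ⟨y, -, hKU⟩ := hS.ultrafilter_le_nhds (U.map K) (le_principal_iff.2
    (mem_of_superset (image_mem_map (le_principal_iff.1 hU))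
      ((image_mono Metric.sphere_subset_closedBall).trans hKS)))
  have hanti : AntilipschitzWith C (K.prod T) := (K.prod T).antilipschitz_of_bound hC
  have hcauchy : Cauchy (U : Filter X) :=
    (hanti.isUniformInducing (K.prod T).uniformContinuous).cauchy_map_iff.1
      (Tendsto.cauchy_map (a := (y, 0)) (Tendsto.prodMk_nhds hKU hTU))
  obtain ⟨x, hx⟩ := CompleteSpace.complete hcauchy
  have hTx : T x = 0 := tendsto_nhds_unique ((T.continuous.tendsto x).comp hx) hTU
  have hx1 : x ∈ Metric.sphere (0 : X) 1 :=
    Metric.isClosed_sphere.mem_of_tendsto (b := (U : Filter X)) (f := id) hx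
      (le_principal_iff.1 hU)
  rw [hT (hTx.trans (map_zero T).symm)] at hx1
  simp at hx1

theorem exists_isCompl_ker_antilipschitzWith_of_norm_le {T : X →L[ℝ] F} {K : X →L[ℝ] Y}
    (hK : IsCompactOperator K) {C : NNReal} (hC : ∀ x, ‖x‖ ≤ C * max ‖K x‖ ‖T x‖) :
    ∃ W : Submodule ℝ X, IsClosed (W : Set X) ∧ IsCompl T.ker W ∧
      ∃ M, AntilipschitzWith M (T ∘L W.subtypeL) := by
  have := finiteDimensional_ker_of_norm_le hK hC
  obtain ⟨W, hW, hcompl⟩ :=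
    (Submodule.ClosedComplemented.of_finiteDimensional T.ker).exists_isClosed_isCompl
  have := hW.completeSpace_coe
  refine ⟨W, hW, hcompl, exists_antilipschitzWith_of_norm_le ?_
    (K := K ∘L W.subtypeL) (hK.comp_clm W.subtypeL) fun x => hC x⟩
  rw [injective_iff_map_eq_zero]
  exact fun x hx => Subtype.ext (Submodule.disjoint_def.1 hcompl.disjoint x hx x.2)

theorem completeSpace_and_hasRightInverse_of_norm_le {T : X →L[ℝ] F}
    (hT : Function.Surjective T) {K : X →L[ℝ] Y} (hK : IsCompactOperator K) {C : NNReal}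
    (hC : ∀ x, ‖x‖ ≤ C * max ‖K x‖ ‖T x‖) : CompleteSpace F ∧ T.HasRightInverse := by
  obtain ⟨W, hW, hcompl, M, hM⟩ := exists_isCompl_ker_antilipschitzWith_of_norm_le hK hC
  have := hW.completeSpace_coe
  have hsurj : Function.Surjective (T ∘L W.subtypeL) := fun y => by
    obtain ⟨x, rfl⟩ := hT y
    obtain ⟨k, hk, w, hw, rfl⟩ :=
      Submodule.mem_sup.1 (hcompl.sup_eq_top ▸ Submodule.mem_top (x := x))
    exact ⟨⟨w, hw⟩, by simp [show T k = 0 from hk]⟩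
  have hcomplete : CompleteSpace F := ((hM.isUniformInducing
    (ContinuousLinearMap.uniformContinuous _)).completeSpace_congr hsurj).1 inferInstance
  let e := ContinuousLinearEquiv.ofBijective (T ∘L W.subtypeL)
    (LinearMap.ker_eq_bot.2 hM.injective) (LinearMap.range_eq_top.2 hsurj)
  exact ⟨hcomplete, W.subtypeL ∘L e.symm, fun y => e.apply_symm_apply y⟩

end CompactPerturbation

namespace Data

variable (D : Data)

/-- The embedding of the Sobolev space `sobolev` into `L²(Ω)`. -/
noncomputable def sobolevFn : D.sobolev →L[ℝ] Lp ℝ 2 D.vol :=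
  ContinuousLinearMap.fst ℝ _ _ ∘L D.sobolev.subtypeL

/-- The map from the Sobolev space `sobolev`, with the norm of `H¹(Ω)`, onto the energy space. -/
noncomputable def energyMap : D.sobolev →L[ℝ] D.H :=
  LinearMap.mkContinuousOfExistsBound
    { toFun := fun s => V.toH s
      map_add' := fun _ _ => rfl
      map_smul' := fun _ _ => rfl }
    (have ⟨C, hC⟩ := D.exists_norm_le_norm_coe; ⟨C, hC⟩)

theorem surjective_energyMap : Function.Surjective D.energyMap :=
  SeparationQuotient.surjective_mk (X := D.V)

theorem isCompactOperator_sobolevFn : IsCompactOperator D.sobolevFn := by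
  refine isCompactOperator_of_totallyBounded_image ((D.totallyBounded_fn 1).subset ?_)
  rintro _ ⟨s, hs, rfl⟩
  have hs1 : ‖(s : D.Triple)‖ ≤ 1 := mem_closedBall_zero_iff.1 hs
  exact ⟨s, s.2.2.1, (norm_fst_le _).trans hs1, (norm_fst_le _).trans ((norm_snd_le _).trans hs1),
    rfl⟩

theorem exists_norm_coe_le :
    ∃ C : NNReal, ∀ s : D.V, ‖(s.1 : D.Triple)‖ ≤ C * max ‖s.fn‖ ‖s‖ := by
  obtain ⟨Cg, hgrad⟩ := D.exists_norm_grad_le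
  obtain ⟨Ct, htrace⟩ := D.exists_trace_bound
  refine ⟨max 1 (max Cg (NNReal.sqrt (Ct * (1 + Cg ^ 2)))), fun s => ?_⟩
  have hfn_le : ‖s.fn‖ ≤ max ‖s.fn‖ ‖s‖ := le_max_left _ _
  have hgrad_le : ‖s.grad‖ ≤ Cg * max ‖s.fn‖ ‖s‖ :=
    (hgrad s).trans (by gcongr; exact le_max_right _ _)
  have htrace_le : ‖s.trace‖ ≤ NNReal.sqrt (Ct * (1 + Cg ^ 2)) * max ‖s.fn‖ ‖s‖ := by
    refine le_of_sq_le_sq ((htrace s.1 s.isTrace).trans ?_) (by positivity)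
    calc Ct * (‖s.fn‖ ^ 2 + ‖s.grad‖ ^ 2)
        ≤ Ct * (max ‖s.fn‖ ‖s‖ ^ 2 + (Cg * max ‖s.fn‖ ‖s‖) ^ 2) := by gcongr
      _ = _ := by
        rw [mul_pow, mul_pow, ← NNReal.coe_pow (NNReal.sqrt _), NNReal.sq_sqrt]
        push_cast
        ring
  rw [NNReal.coe_max, NNReal.coe_max, NNReal.coe_one,
    max_mul_of_nonneg _ _ (by positivity), max_mul_of_nonneg _ _ (by positivity), one_mul]
  exact max_le_max hfn_le (max_le_max hgrad_le htrace_le)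

theorem completeSpace_and_hasRightInverse_energyMap :
    CompleteSpace D.H ∧ D.energyMap.HasRightInverse :=
  have ⟨_, hC⟩ := D.exists_norm_coe_le
  completeSpace_and_hasRightInverse_of_norm_le D.surjective_energyMap
    D.isCompactOperator_sobolevFn fun s => hC s

instance : CompleteSpace D.H := D.completeSpace_and_hasRightInverse_energyMap.1

/-- A continuous linear choice, in `L²(Ω)`, of a function that represents a class in `H`. -/
noncomputable def representative : D.H →L[ℝ] Lp ℝ 2 D.vol :=
  D.sobolevFn ∘L D.completeSpace_and_hasRightInverse_energyMap.2.rightInverse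

theorem isCompactOperator_representative : IsCompactOperator D.representative :=
  D.isCompactOperator_sobolevFn.comp_clm _

theorem exists_toH_eq_fn_eq_representative (s : D.H) :
    ∃ v : D.V, v.toH = s ∧ v.fn = D.representative s :=
  have h := D.completeSpace_and_hasRightInverse_energyMap.2
  ⟨h.rightInverse s, h.rightInverse_rightInverse s, rfl⟩

end Data

/-! ### The Graetz operator -/

namespace Data

variable (D : Data)

/-- The measure `c dx` on `Ω`. -/
noncomputable abbrev cvol : Measure Plane := D.vol.withDensity fun x => ENNReal.ofReal (D.c x)

theorem exists_cvol_le_smul_vol : ∃ M : ℝ≥0∞, M ≠ ⊤ ∧ D.cvol ≤ M • D.vol := by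
  obtain ⟨m, M, -, hc⟩ := D.c_bound
  refine ⟨ENNReal.ofReal M, ENNReal.ofReal_ne_top, ?_⟩
  rw [← withDensity_const]
  exact withDensity_mono (hc.mono fun x hx => ENNReal.ofReal_le_ofReal hx.2)

theorem exists_vol_le_smul_cvol : ∃ M : ℝ≥0∞, M ≠ ⊤ ∧ D.vol ≤ M • D.cvol := by
  obtain ⟨m, M, hm, hc⟩ := D.c_bound
  have hm0 : ENNReal.ofReal m ≠ 0 := by simpa using hm
  refine ⟨(ENNReal.ofReal m)⁻¹, ENNReal.inv_ne_top.2 hm0, ?_⟩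
  rw [← withDensity_smul' _ _ (ENNReal.inv_ne_top.2 hm0)]
  conv_lhs => rw [← withDensity_one (μ := D.vol)]
  refine withDensity_mono (hc.mono fun x hx => ?_)
  calc (1 : ℝ≥0∞) = (ENNReal.ofReal m)⁻¹ * ENNReal.ofReal m :=
        (ENNReal.inv_mul_cancel hm0 ENNReal.ofReal_ne_top).symm
    _ ≤ (ENNReal.ofReal m)⁻¹ * ENNReal.ofReal (D.c x) := by gcongr; exact hx.1

/-- The identity map, as an isomorphism of `L²(Ω)` with `L²(Ω)` weighted by `c`. -/
noncomputable def toL2c : Lp ℝ 2 D.vol ≃L[ℝ] D.L2c :=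
  have hc := D.exists_cvol_le_smul_vol
  have hvol := D.exists_vol_le_smul_cvol
  ContinuousLinearEquiv.equivOfInverse (Lp.LpToLpOfMeasureLeSMul hc.choose_spec.1 hc.choose_spec.2)
    (Lp.LpToLpOfMeasureLeSMul hvol.choose_spec.1 hvol.choose_spec.2)
    (fun f => Lp.ext ((Lp.coeFn_LpToLpOfMeasureLeSMul _ _ _).trans
      (vol_ac.ae_le (Lp.coeFn_LpToLpOfMeasureLeSMul _ _ f))))
    (fun f => Lp.ext ((Lp.coeFn_LpToLpOfMeasureLeSMul _ _ _).trans
      ((withDensity_absolutelyContinuous _ _).ae_le (Lp.coeFn_LpToLpOfMeasureLeSMul _ _ f))))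

variable {D}

theorem coeFn_toL2c (g : Lp ℝ 2 D.vol) : D.toL2c g =ᵐ[D.vol] g :=
  vol_ac.ae_le (Lp.coeFn_LpToLpOfMeasureLeSMul D.exists_cvol_le_smul_vol.choose_spec.1
    D.exists_cvol_le_smul_vol.choose_spec.2 g)

theorem eq_toL2c {f : D.L2c} {g : Lp ℝ 2 D.vol} (h : f =ᵐ[D.vol] g) : f = D.toL2c g :=
  Lp.ext ((withDensity_absolutelyContinuous _ _).ae_le
    (h.trans (coeFn_toL2c g).symm))

theorem inner_L2c (f g : D.L2c) : inner ℝ f g = ∫ x in D.Ω, D.c x * (f x * g x) := by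
  obtain ⟨m, M, hm, hc⟩ := D.c_bound
  rw [L2.inner_def, integral_withDensity_eq_integral_toReal_smul
    (by have := D.measurable_c; fun_prop) (Eventually.of_forall fun x => ENNReal.ofReal_lt_top)]
  refine integral_congr_ae (hc.mono fun x hx => ?_)
  simp [ENNReal.toReal_ofReal (hm.le.trans hx.1), mul_comm]

variable (D) in
theorem memLp_top_h_div_c : MemLp (fun x => D.h x / D.c x) ∞ D.cvol := by
  obtain ⟨m, M, hm, hc⟩ := D.c_bound
  obtain ⟨A, hA⟩ := D.h_bound
  refine memLp_top_of_bound (D.measurable_h.div D.measurable_c).aestronglyMeasurable (|A| / m)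
    ((withDensity_absolutelyContinuous _ _).ae_le ?_)
  filter_upwards [hc, hA] with x hcx hAx
  rw [Real.norm_eq_abs, abs_div, abs_of_pos (hm.trans_le hcx.1)]
  exact div_le_div₀ (abs_nonneg A) (hAx.trans (le_abs_self A)) hm hcx.1

variable (D) in
/-- Multiplication by `h / c` on `L²(Ω)` weighted by `c`: the zeroth-order term of the Graetz
operator. -/
noncomputable def velocity : D.L2c →L[ℝ] D.L2c :=
  (ContinuousLinearMap.mul ℝ ℝ).holderL D.cvol ∞ 2 2 (D.memLp_top_h_div_c.toLp _)

theorem coeFn_velocity (f : D.L2c) :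
    D.velocity f =ᵐ[D.vol] fun x => D.h x / D.c x * f x := by
  refine vol_ac.ae_le ?_
  filter_upwards [(ContinuousLinearMap.mul ℝ ℝ).coeFn_holder (r := 2)
    (D.memLp_top_h_div_c.toLp _) f, D.memLp_top_h_div_c.coeFn_toLp] with x hmul hquot
  exact hmul.trans (by rw [hquot]; rfl)

theorem inner_velocity (f g : D.L2c) :
    inner ℝ (D.velocity f) g = ∫ x in D.Ω, D.h x * (f x * g x) := by
  obtain ⟨m, M, hm, hc⟩ := D.c_bound
  rw [inner_L2c]
  refine integral_congr_ae ?_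
  filter_upwards [coeFn_velocity f, hc] with x hf hcx
  have : D.c x ≠ 0 := (hm.trans_le hcx.1).ne'
  rw [hf]
  field_simp

theorem inner_velocity_comm (f g : D.L2c) :
    inner ℝ (D.velocity f) g = inner ℝ (D.velocity g) f := by
  simp only [inner_velocity, mul_comm (f _)]

variable (D) in
/-- The bilinear form `∫_Ω h u u'` of two pairs `(u, s)` and `(u', s')`. -/
noncomputable def velocityForm : D.Space →ₗ[ℝ] D.Space →ₗ[ℝ] ℝ :=
  (innerₗ D.L2c).compl₁₂ ((D.velocity : D.L2c →ₗ[ℝ] D.L2c) ∘ₗ WithLp.fstₗ 2 ℝ D.L2c D.H)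
    (WithLp.fstₗ 2 ℝ D.L2c D.H)

theorem velocityForm_apply (φ ψ : D.Space) :
    D.velocityForm φ ψ = inner ℝ (D.velocity φ.fst) ψ.fst := rfl

theorem inner_space (φ ψ : D.Space) :
    inner ℝ φ ψ = inner ℝ φ.fst ψ.fst + inner ℝ φ.snd ψ.snd :=
  WithLp.prod_inner_apply φ ψ

theorem inner_P_left (φ ψ : D.Space) : inner ℝ (D.P φ) ψ = inner ℝ φ.fst ψ.fst := by
  rw [inner_space, show (D.P φ).snd = 0 from rfl, inner_zero_left, add_zero]
  rfl

theorem norm_P (φ : D.Space) : ‖D.P φ‖ = ‖φ.fst‖ := by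
  rw [@norm_eq_sqrt_real_inner _ _ _ (D.P φ), inner_P_left]
  exact (norm_eq_sqrt_real_inner φ.fst).symm

variable (D) in
theorem isSymmetricProjection_P : (D.P : D.Space →ₗ[ℝ] D.Space).IsSymmetricProjection where
  isIdempotentElem := rfl
  isSymmetric φ ψ := by
    change inner ℝ (D.P φ) ψ = inner ℝ φ (D.P ψ)
    rw [real_inner_comm (D.P ψ) φ, inner_P_left, inner_P_left, real_inner_comm]

theorem reflForm_P (φ ψ : D.Space) :
    reflForm D.P φ ψ = inner ℝ φ.fst ψ.fst - inner ℝ φ.snd ψ.snd := by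
  rw [reflForm_apply, inner_P_left, inner_space, show (D.P ψ).fst = ψ.fst from rfl]
  ring

theorem IsImage.exists_toL2c_fn {φ ψ : D.Space} (h : IsImage φ ψ) :
    ∃ u : D.V, φ.fst = D.toL2c u.fn ∧ ψ.snd = u.toH :=
  have ⟨u, _, _, _, hu, _, _, hψ⟩ := h
  ⟨u, eq_toL2c hu, hψ⟩

theorem IsImage.inner_fst_toL2c {φ ψ : D.Space} (h : IsImage φ ψ) (v : D.V) :
    inner ℝ ψ.fst (D.toL2c v.fn)
      = inner ℝ (D.velocity φ.fst) (D.toL2c v.fn) + inner ℝ φ.snd v.toH := by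
  obtain ⟨u, s, f, hf, hu, hs, hψ, -⟩ := h
  obtain ⟨m, M, hm, hc⟩ := D.c_bound
  obtain ⟨A, hA⟩ := D.h_bound
  have hfv : Integrable (fun x => f x * v.fn x) D.vol :=
    MemLp.integrable_mul (Lp.memLp _) (Lp.memLp _)
  have huv : Integrable (fun x => D.h x * (u.fn x * v.fn x)) D.vol :=
    Integrable.bdd_mul (c := A) (MemLp.integrable_mul (Lp.memLp _) (Lp.memLp _))
      D.measurable_h.aestronglyMeasurable hA
  have hvelocity : inner ℝ (D.velocity φ.fst) (D.toL2c v.fn)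
      = ∫ x in D.Ω, D.h x * (u.fn x * v.fn x) := by
    rw [inner_velocity]
    refine integral_congr_ae ?_
    filter_upwards [hu, coeFn_toL2c v.fn] with x hux hvx
    rw [hux, hvx]
  have hs : inner ℝ φ.snd v.toH = ∫ x in D.Ω, f x * v.fn x := by
    rw [← hf v, hs]
    exact SeparationQuotient.inner_mk_mk s v
  rw [hvelocity, hs, ← integral_add huv hfv, inner_L2c]
  refine integral_congr_ae ?_
  filter_upwards [hψ, coeFn_toL2c v.fn, hc] with x hψx hvx hcx
  have : D.c x ≠ 0 := (hm.trans_le hcx.1).ne'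
  rw [hψx, hvx]
  field_simp

theorem IsImage.inner_fst_fst {φ ψ φ' ψ' : D.Space} (h : IsImage φ ψ) (h' : IsImage φ' ψ') :
    inner ℝ ψ.fst φ'.fst = inner ℝ (D.velocity φ.fst) φ'.fst + inner ℝ φ.snd ψ'.snd := by
  obtain ⟨u', hφ', hψ'⟩ := h'.exists_toL2c_fn
  rw [hφ', hψ', h.inner_fst_toL2c]

theorem IsImage.inner_comm {φ ψ φ' ψ' : D.Space} (h : IsImage φ ψ) (h' : IsImage φ' ψ') :
    inner ℝ ψ φ' = inner ℝ φ ψ' := by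
  rw [inner_space, inner_space, h.inner_fst_fst h', real_inner_comm ψ'.fst, h'.inner_fst_fst h,
    inner_velocity_comm, real_inner_comm ψ.snd]
  ring

theorem IsImage.reflForm_add_reflForm {φ ψ φ' ψ' : D.Space} (h : IsImage φ ψ)
    (h' : IsImage φ' ψ') :
    reflForm D.P ψ φ' + reflForm D.P φ ψ' = 2 * D.velocityForm φ φ' := by
  rw [reflForm_P, reflForm_P, h.inner_fst_fst h', real_inner_comm ψ'.fst, h'.inner_fst_fst h,
    inner_velocity_comm φ'.fst, real_inner_comm ψ.snd, velocityForm_apply]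
  ring

variable (D) in
/-- The functions in `L²(Ω)`, weighted by `c`, that represent the two components of a pair. -/
noncomputable def functions : D.Space →L[ℝ] D.L2c × D.L2c :=
  (WithLp.fstL 2 ℝ D.L2c D.H).prod
    ((D.toL2c : Lp ℝ 2 D.vol →L[ℝ] D.L2c) ∘L D.representative ∘L WithLp.sndL 2 ℝ D.L2c D.H)

theorem IsImage.norm_sq_le {φ ψ : D.Space} (h : IsImage φ ψ) :
    ‖φ‖ ^ 2 ≤ (‖φ‖ + ‖ψ‖ + ‖D.velocity‖ * ‖φ‖) * ‖D.functions φ‖ := by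
  obtain ⟨v, hv, hrep⟩ := D.exists_toH_eq_fn_eq_representative φ.snd
  have hfst : ‖φ.fst‖ ≤ ‖D.functions φ‖ := norm_fst_le (D.functions φ)
  have hsnd : ‖D.toL2c v.fn‖ ≤ ‖D.functions φ‖ := hrep ▸ norm_snd_le (D.functions φ)
  have hsq : ‖φ.snd‖ ^ 2 = inner ℝ (ψ.fst - D.velocity φ.fst) (D.toL2c v.fn) := by
    rw [inner_sub_left, h.inner_fst_toL2c, hv, real_inner_self_eq_norm_sq]
    ring
  calc ‖φ‖ ^ 2 = ‖φ.fst‖ * ‖φ.fst‖ + inner ℝ (ψ.fst - D.velocity φ.fst) (D.toL2c v.fn) := by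
        rw [WithLp.prod_norm_sq_eq_of_L2, hsq, sq]
    _ ≤ ‖φ.fst‖ * ‖φ.fst‖ + ‖ψ.fst - D.velocity φ.fst‖ * ‖D.toL2c v.fn‖ := by
        gcongr
        exact real_inner_le_norm _ _
    _ ≤ ‖φ‖ * ‖D.functions φ‖ + (‖ψ‖ + ‖D.velocity‖ * ‖φ‖) * ‖D.functions φ‖ := by
        gcongr
        · exact WithLp.norm_fst_le _ φ
        · refine (norm_sub_le _ _).trans (add_le_add (WithLp.norm_fst_le _ ψ) ?_)
          exact (D.velocity.le_opNorm _).trans (by gcongr; exact WithLp.norm_fst_le _ φ)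
    _ = _ := by ring

theorem IsImage.norm_le {φ ψ : D.Space} (h : IsImage φ ψ) {R : ℝ} (hψ : ‖ψ‖ ≤ R * ‖φ‖) :
    ‖φ‖ ≤ (1 + R + ‖D.velocity‖) * ‖D.functions φ‖ := by
  rcases eq_or_ne φ 0 with rfl | hφ
  · simp
  refine le_of_mul_le_mul_right ?_ (norm_pos_iff.2 hφ)
  calc ‖φ‖ * ‖φ‖ = ‖φ‖ ^ 2 := (sq _).symm
    _ ≤ (‖φ‖ + ‖ψ‖ + ‖D.velocity‖ * ‖φ‖) * ‖D.functions φ‖ := h.norm_sq_le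
    _ ≤ (‖φ‖ + R * ‖φ‖ + ‖D.velocity‖ * ‖φ‖) * ‖D.functions φ‖ := by gcongr
    _ = (1 + R + ‖D.velocity‖) * ‖D.functions φ‖ * ‖φ‖ := by ring

variable (D) in
theorem totallyBounded_fst_isImage (R : ℝ) :
    TotallyBounded {f : D.L2c | ∃ φ ψ, IsImage φ ψ ∧ ‖φ‖ ≤ R ∧ ‖ψ‖ ≤ R ∧ φ.fst = f} := by
  obtain ⟨C, hC⟩ := D.exists_norm_grad_le
  refine ((D.totallyBounded_fn (max (‖(D.toL2c.symm : D.L2c →L[ℝ] Lp ℝ 2 D.vol)‖ * R)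
    (C * R))).image D.toL2c.toContinuousLinearMap.uniformContinuous).subset ?_
  rintro f ⟨φ, ψ, h, hφ, hψ, rfl⟩
  obtain ⟨u, hu, hψu⟩ := h.exists_toL2c_fn
  have hfn : u.fn = D.toL2c.symm φ.fst := by rw [hu, D.toL2c.symm_apply_apply]
  have hnorm : ‖u‖ = ‖ψ.snd‖ := by rw [hψu]; exact (SeparationQuotient.norm_mk u).symm
  refine ⟨u.fn, ⟨u.1, u.isTrace, le_max_of_le_left ?_, le_max_of_le_right ?_, rfl⟩, hu.symm⟩
  · change ‖u.fn‖ ≤ _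
    rw [hfn]
    refine ((D.toL2c.symm : D.L2c →L[ℝ] Lp ℝ 2 D.vol).le_opNorm _).trans ?_
    gcongr
    exact (WithLp.norm_fst_le _ φ).trans hφ
  · refine (hC u).trans ?_
    gcongr
    exact hnorm.trans_le ((WithLp.norm_snd_le _ ψ).trans hψ)

theorem finiteDimensional_of_forall_exists_isImage {W : Submodule ℝ D.Space} {R : NNReal}
    (hW : ∀ φ ∈ W, ∃ ψ, IsImage φ ψ ∧ ‖ψ‖ ≤ R * ‖φ‖) : FiniteDimensional ℝ W := by
  have hfst : IsCompactOperator (WithLp.fstL 2 ℝ D.L2c D.H ∘L W.subtypeL) := by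
    refine isCompactOperator_of_totallyBounded_image
      ((D.totallyBounded_fst_isImage (max 1 R)).subset ?_)
    rintro _ ⟨φ, hφ, rfl⟩
    have hφ1 : ‖(φ : D.Space)‖ ≤ 1 := mem_closedBall_zero_iff.1 hφ
    obtain ⟨ψ, h, hψ⟩ := hW φ φ.2
    exact ⟨φ, ψ, h, le_max_of_le_left hφ1,
      le_max_of_le_right (hψ.trans (mul_le_of_le_one_right R.2 hφ1)), rfl⟩
  have hsnd : IsCompactOperator
      (((D.toL2c : Lp ℝ 2 D.vol →L[ℝ] D.L2c) ∘L D.representative ∘L WithLp.sndL 2 ℝ D.L2c D.H)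
        ∘L W.subtypeL) :=
    (D.isCompactOperator_representative.comp_clm
      (WithLp.sndL 2 ℝ D.L2c D.H ∘L W.subtypeL)).clm_comp (D.toL2c : Lp ℝ 2 D.vol →L[ℝ] D.L2c)
  have hcompact : IsCompactOperator (D.functions ∘L W.subtypeL) := isCompactOperator_prod hfst hsnd
  refine finiteDimensional_of_isCompactOperator_of_antilipschitzWith
    (C := 1 + R + ‖D.velocity‖₊) hcompact (ContinuousLinearMap.antilipschitz_of_bound _ fun φ => ?_)
  obtain ⟨ψ, h, hψ⟩ := hW φ φ.2
  exact h.norm_le hψ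

variable (D) in
theorem orthogonalFamily_eigenspace :
    OrthogonalFamily ℝ (fun μ => D.eigenspace μ) fun μ => (D.eigenspace μ).subtypeₗᵢ := by
  intro μ ν hμν φ ψ
  have h : inner ℝ (μ • φ : D.Space) ψ = inner ℝ (φ : D.Space) (ν • ψ : D.Space) :=
    IsImage.inner_comm φ.2 ψ.2
  rw [real_inner_smul_left, real_inner_smul_right] at h
  exact (mul_eq_mul_right_iff.1 h).resolve_left hμν

theorem add_mul_reflForm_eigenspace {μ ν : ℝ} {φ ψ : D.Space} (hφ : φ ∈ D.eigenspace μ)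
    (hψ : ψ ∈ D.eigenspace ν) : (μ + ν) * reflForm D.P φ ψ = 2 * D.velocityForm φ ψ := by
  have h : reflForm D.P (μ • φ) ψ + reflForm D.P φ (ν • ψ) = 2 * D.velocityForm φ ψ :=
    IsImage.reflForm_add_reflForm hφ hψ
  simpa only [map_smul, _root_.smul_apply, smul_eq_mul, add_mul] using h

theorem exists_isImage_of_mem_iSup_eigenspace {R : NNReal} {φ : D.Space}
    (hφ : φ ∈ ⨆ μ : {μ : ℝ // |μ| ≤ R}, D.eigenspace μ) :
    ∃ ψ, IsImage φ ψ ∧ ‖ψ‖ ≤ R * ‖φ‖ := by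
  obtain ⟨x, hx, rfl⟩ := (Submodule.mem_iSup_iff_exists_finsupp _ _).1 hφ
  have horth := D.orthogonalFamily_eigenspace.comp
    (Subtype.val_injective (p := fun μ : ℝ => |μ| ≤ R))
  let a (μ : {μ : ℝ // |μ| ≤ R}) : D.eigenspace μ := ⟨x μ, hx μ⟩
  have hgraph : ∑ μ ∈ x.support, (x μ, (μ : ℝ) • x μ) ∈ D.graph :=
    Submodule.sum_mem _ fun μ _ => hx μ
  rw [← prod_mk_sum] at hgraph
  refine ⟨∑ μ ∈ x.support, (μ : ℝ) • x μ, hgraph, le_of_sq_le_sq ?_ (by positivity)⟩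
  calc ‖∑ μ ∈ x.support, (μ : ℝ) • x μ‖ ^ 2
      = ∑ μ ∈ x.support, ‖(μ : ℝ) • a μ‖ ^ 2 :=
        horth.norm_sum (fun μ => (μ : ℝ) • a μ) x.support
    _ ≤ ∑ μ ∈ x.support, R ^ 2 * ‖a μ‖ ^ 2 := by
        refine Finset.sum_le_sum fun μ _ => ?_
        rw [norm_smul, mul_pow, Real.norm_eq_abs]
        gcongr
        exact μ.2
    _ = R ^ 2 * ‖x.sum fun _ y => y‖ ^ 2 := by
        rw [← Finset.mul_sum]
        exact congrArg _ (horth.norm_sum a x.support).symm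
    _ = (R * ‖x.sum fun _ y => y‖) ^ 2 := (mul_pow _ _ _).symm

theorem finiteDimensional_iSup_eigenspace (R : NNReal) :
    FiniteDimensional ℝ (⨆ μ : {μ : ℝ // |μ| ≤ R}, D.eigenspace μ : Submodule ℝ D.Space) :=
  finiteDimensional_of_forall_exists_isImage fun _ => exists_isImage_of_mem_iSup_eigenspace

instance (μ : ℝ) : FiniteDimensional ℝ (D.eigenspace μ) := by
  have := finiteDimensional_iSup_eigenspace (D := D) ‖μ‖₊
  exact Submodule.finiteDimensional_of_le
    (le_iSup (fun ν : {ν : ℝ // |ν| ≤ ‖μ‖₊} => D.eigenspace ν) ⟨μ, le_rfl⟩)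

theorem finite_setOf_eigenspace_ne_bot (R : NNReal) :
    {μ : ℝ | D.eigenspace μ ≠ ⊥ ∧ |μ| ≤ R}.Finite := by
  have := finiteDimensional_iSup_eigenspace (D := D) R
  choose x hx hx0 using fun μ : {μ : ℝ | D.eigenspace μ ≠ ⊥ ∧ |μ| ≤ R} =>
    (Submodule.ne_bot_iff _).1 μ.2.1
  let y (μ : {μ : ℝ | D.eigenspace μ ≠ ⊥ ∧ |μ| ≤ R}) :
      (⨆ μ : {μ : ℝ // |μ| ≤ R}, D.eigenspace μ : Submodule ℝ D.Space) :=
    ⟨x μ, Submodule.mem_iSup_of_mem ⟨μ, μ.2.2⟩ (hx μ)⟩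
  have hy : LinearIndependent ℝ y :=
    linearIndependent_of_ne_zero_of_inner_eq_zero (fun μ h => hx0 μ (congrArg Subtype.val h))
      fun μ ν hμν => D.orthogonalFamily_eigenspace (Subtype.val_injective.ne hμν)
        ⟨x μ, hx μ⟩ ⟨x ν, hx ν⟩
  exact Set.finite_coe_iff.1 hy.finite

/-! ### The spectral projections -/

variable (D) in
/-- The eigenvalues of the Graetz operator that lie in `S`. -/
def eigenvalues (S : Set ℝ) : Set ℝ := {μ ∈ S | D.eigenspace μ ≠ ⊥}

theorem abs_eq_mul_of_pos {ε μ : ℝ} (hε : |ε| = 1) (hμ : 0 < ε * μ) : |μ| = ε * μ := by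
  rw [← abs_of_pos hμ, abs_mul, hε, one_mul]

theorem topologicalClosure_iSup_eigenvalues (S : Set ℝ) :
    (⨆ μ : D.eigenvalues S, D.eigenspace μ).topologicalClosure = D.spectralSpace S := by
  rw [spectralSpace]
  congr 1
  refine le_antisymm (iSup_le fun μ => le_iSup₂_of_le _ μ.2.1 le_rfl) (iSup₂_le fun μ hμ => ?_)
  by_cases hbot : D.eigenspace μ = ⊥
  · simp [hbot]
  · exact le_iSup (fun μ : D.eigenvalues S => D.eigenspace μ) ⟨μ, hμ, hbot⟩

theorem lyapunovFamily_eigenspace {S : Set ℝ} {ε : ℝ} (hε : |ε| = 1) (hS : ∀ μ ∈ S, 0 < ε * μ) :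
    LyapunovFamily (fun μ : D.eigenvalues S => D.eigenspace μ) (D.spectralSpace S)
      (fun μ => ε * μ) D.P (ε • D.velocityForm) ‖D.velocity‖₊ where
  orthogonal := D.orthogonalFamily_eigenspace.comp Subtype.val_injective
  closure_eq := topologicalClosure_iSup_eigenvalues S
  pos μ := hS μ μ.2.1
  tendsto := by
    refine tendsto_atTop.2 fun R => ?_
    refine ((finite_setOf_eigenspace_ne_bot R.toNNReal).preimage
      Subtype.val_injective.injOn).subset fun μ (hμ : ¬ R ≤ ε * μ) => ⟨μ.2.2, ?_⟩
    rw [abs_eq_mul_of_pos hε (hS μ μ.2.1)]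
    exact (not_le.1 hμ).le.trans R.le_coe_toNNReal
  projection := D.isSymmetricProjection_P
  enorm_le φ ψ := by
    have hnorm : ‖(ε • D.velocityForm) φ ψ‖ ≤ ‖D.velocity‖ * (‖D.P φ‖ * ‖D.P ψ‖) := by
      calc ‖ε * inner ℝ (D.velocity φ.fst) ψ.fst‖
          = ‖inner ℝ (D.velocity φ.fst) ψ.fst‖ := by
            rw [norm_mul, Real.norm_eq_abs ε, hε, one_mul]
        _ ≤ ‖D.velocity φ.fst‖ * ‖ψ.fst‖ := norm_inner_le_norm _ _
        _ ≤ ‖D.velocity‖ * ‖φ.fst‖ * ‖ψ.fst‖ := by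
            gcongr
            exact D.velocity.le_opNorm _
        _ = ‖D.velocity‖ * (‖D.P φ‖ * ‖D.P ψ‖) := by rw [norm_P, norm_P, mul_assoc]
    simpa only [enorm_eq_nnnorm] using mod_cast hnorm
  relation μ ν φ hφ ψ hψ := by
    rw [LinearMap.smul_apply, LinearMap.smul_apply, smul_eq_mul]
    linear_combination ε * add_mul_reflForm_eigenspace hφ hψ

theorem eigenProj_apply (μ : ℝ) (φ : D.Space) :
    D.eigenProj μ φ = (D.eigenspace μ).starProjection φ := by
  have h : (D.eigenspace μ).topologicalClosure = D.eigenspace μ :=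
    (D.eigenspace μ).closed_of_finiteDimensional.submodule_topologicalClosure_eq
  unfold eigenProj
  congr! 1
  simp only [h]

theorem starProjection_eigenspace_eq_zero {S : Set ℝ} {μ : ℝ} (hμ : μ ∉ D.eigenvalues S)
    {φ : D.Space} (hφ : φ ∈ D.spectralSpace S) : (D.eigenspace μ).starProjection φ = 0 := by
  rw [Submodule.starProjection_apply_eq_zero_iff]
  rw [← topologicalClosure_iSup_eigenvalues] at hφ
  refine Submodule.topologicalClosure_minimal _ ?_ (Submodule.isClosed_orthogonal _) hφ
  exact iSup_le fun ν => Submodule.isOrtho_iff_le.1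
    (D.orthogonalFamily_eigenspace.isOrtho fun h : (ν : ℝ) = μ => hμ (h ▸ ν.2))

theorem powNorm_half_eq_weightedSq_rpow {S : Set ℝ} {ε : ℝ} (hε : |ε| = 1)
    (hS : ∀ μ ∈ S, 0 < ε * μ) {φ : D.Space} (hφ : φ ∈ D.spectralSpace S) :
    D.powNorm (1 / 2) φ = weightedSq (fun μ : D.eigenvalues S => D.eigenspace μ)
      (fun μ => ε * μ) φ ^ (1 / 2 : ℝ) := by
  unfold powNorm weightedSq
  congr 1
  simp only [eigenProj_apply, mul_one_div_cancel (two_ne_zero (α := ℝ)), Real.rpow_one]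
  rw [← tsum_subtype_eq_of_support_subset (s := D.eigenvalues S)]
  · exact tsum_congr fun μ => by rw [abs_eq_mul_of_pos hε (hS μ μ.2.1)]
  · refine Function.support_subset_iff'.2 fun μ hμ => ?_
    simp [starProjection_eigenspace_eq_zero hμ hφ]

instance (S : Set ℝ) : CompleteSpace (D.spectralSpace S) :=
  (Submodule.isClosed_topologicalClosure _).completeSpace_coe

theorem isSelfAdjoint_compression (S : Set ℝ) : IsSelfAdjoint (D.compression S) := by
  rw [compression, ← Submodule.adjoint_subtypeL]
  exact D.isSymmetricProjection_P.isSymmetric.isSelfAdjoint.adjoint_conj _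

theorem isSelfAdjoint_B (S : Set ℝ) : IsSelfAdjoint (D.B S) := by
  have h := (isSelfAdjoint_inverse (isSelfAdjoint_compression (D := D) S)).conj_adjoint
    (D.spectralSpace S).subtypeL
  rwa [Submodule.adjoint_subtypeL] at h

theorem norm_B_le (S : Set ℝ) (φ : D.Space) :
    ‖D.B S φ‖ ≤ ‖(D.compression S).inverse‖ * ‖D.proj S φ‖ :=
  (D.compression S).inverse.le_opNorm _

theorem exists_powNorm_half_B_le {S : Set ℝ} {ε : ℝ} (hε : |ε| = 1) (hS : ∀ μ ∈ S, 0 < ε * μ) :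
    ∃ M : NNReal, ∀ φ, D.powNorm (1 / 2) (D.B S φ) ≤ M * D.powNorm (1 / 2) (D.proj S φ) := by
  have h := lyapunovFamily_eigenspace (D := D) hε hS
  obtain ⟨M, hM⟩ := h.exists_weightedSq_le_weightedSq_compress
  refine ⟨M ^ (1 / 2 : ℝ), fun φ => ?_⟩
  set x := (D.spectralSpace S).orthogonalProjectionOnto φ
  have hinv : compress D.P (D.spectralSpace S) ((D.compression S).inverse x) = x := by
    obtain ⟨e, he⟩ := h.isInvertible_compress
    change D.compression S _ = x
    rw [show D.compression S = e from he.symm, ContinuousLinearMap.inverse_equiv]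
    exact e.apply_symm_apply x
  have hbound := hM ((D.compression S).inverse x)
  rw [hinv] at hbound
  have hB : D.B S φ ∈ D.spectralSpace S := Subtype.coe_prop _
  have hproj : D.proj S φ ∈ D.spectralSpace S := Subtype.coe_prop _
  rw [powNorm_half_eq_weightedSq_rpow hε hS hB, powNorm_half_eq_weightedSq_rpow hε hS hproj,
    ENNReal.coe_rpow_of_nonneg _ (by norm_num), ← ENNReal.mul_rpow_of_nonneg _ _ (by norm_num)]
  exact ENNReal.rpow_le_rpow hbound (by norm_num)

theorem invertibleWithBounds {S : Set ℝ} {ε : ℝ} (hε : |ε| = 1) (hS : ∀ μ ∈ S, 0 < ε * μ) :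
    D.InvertibleWithBounds S := by
  obtain ⟨M, hM⟩ := exists_powNorm_half_B_le (D := D) hε hS
  refine ⟨(lyapunovFamily_eigenspace hε hS).isInvertible_compress, isSelfAdjoint_B S,
    ‖(D.compression S).inverse‖ + M + 1, by positivity, fun φ => ⟨?_, (hM φ).trans ?_⟩⟩
  · refine (norm_B_le S φ).trans ?_
    gcongr
    linarith [M.coe_nonneg]
  · rw [← ENNReal.ofReal_coe_nnreal]
    gcongr
    linarith [norm_nonneg (D.compression S).inverse]

end Data

end Graetz

/-- For every Graetz problem, the form is definite on `H` and the space of pairs is a Hilbert space;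
`π₋ P π₋` and `π₊ P π₊` are invertible on the ranges of `π₋` and `π₊`, and `B₋`, `B₊` are
self-adjoint and bounded in the norm of the space and in the `1/2`-norm. -/
theorem mainTheorem1 (D : Graetz.Data) :
    (∀ s : D.V, Graetz.Data.energy s s = 0 ↔ D.IsNegligible s) ∧
      ∃ _ : CompleteSpace D.Space,
        D.InvertibleWithBounds (Set.Iio 0) ∧ D.InvertibleWithBounds (Set.Ioi 0) :=
  ⟨Graetz.Data.energy_eq_zero_iff, inferInstance,
    Graetz.Data.invertibleWithBounds (ε := -1) (by simp) fun μ hμ => by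
      simpa using Set.mem_Iio.1 hμ,
    Graetz.Data.invertibleWithBounds (ε := 1) (by simp) fun μ hμ => by
      simpa using Set.mem_Ioi.1 hμ⟩
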